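/- Consider an urn with four colors (white, black, green, yellow) whose contents after $n$ draws are the row vector $C_n=(W_n,B_n,G_n,Y_n)\in[0,\infty)^4$. Let $C_0$ be a deterministic probability vector with $W_0+B_0>0$, and let the replacement matrix $$R=\begin{pmatrix} sQ & E\\ 0 & P\end{pmatrix},\qquad 0<s<1,$$ be stochastic (nonnegative entries, each row summing to $1$), where all blocks are $2\times2$ and $P,Q$ are irreducible stochastic matrices with stationary distributions $\pi_P,\pi_Q$. Given $C_0,\dots,C_{n-1}$, a ball of color $i$ is drawn at the $n$-th trial with probability $C_{i,n-1}/n$, and then the $i$-th row of $R$ is added to the contents. Let $\lambda\ne1$ be the non-principal eigenvalue of $Q$ and $\xi\neq 0$ a real vector with $Q\xi=\lambda\xi$; let $\xi^2$ be its coordinatewise square, and put $v_1=(1,1,0,0)'$, $v_2=(\xi',0,0)'$. Then: (i) $C_n\mathbf 1/(n+1)=1$ for all $n\ge0$. (ii) $C_n/n\to(0,0,\pi_P)$ almost surely. There is a non-degenerate (that is, not almost surely constant), almost surely positive random variable $U$ such that: (iii) $(W_n,B_n)/n^s\to U\,\pi_Q$ almost surely. (iv) $C_nv_1/n^s\to U$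 almost surely and in $L^2$. (v) If $\lambda<1/2$, then $C_nv_2/n^{s/2}\Rightarrow N\!\left(0,\frac{s^2\lambda^2}{s(1-2\lambda)}\,U\,\pi_Q\xi^2\right)$. (vi) If $\lambda=1/2$, then $C_nv_2/\sqrt{n^s\log n}\Rightarrow N\!\left(0,s^2\lambda^2\,U\,\pi_Q\xi^2\right)$. (vii) If $\lambda>1/2$, then there is a non-degenerate random variable $V$ such that $C_nv_2/n^{s\lambda}\to V$ almost surely and in $L^2$. Here $N(0,T)$, for a nonnegative random variable $T$, is the variance mixture of normals, i.e. the law of $\sqrt T\,Z$ with $Z$ standard normal and independent of $T$. Moreover, consider any three-color urn $(W'_n,B'_n,G'_n)$ run by the same rule with replacement matrix $\begin{pmatrix} sQ & (1-s)\mathbf 1\\ 0&1\end{pmatrix}$ and initial vector $(W_0,B_0,G_0+Y_0)$. Then $(W'_n+B'_n)/(n+1)^s$ converges almost surely and in $L^2$ to a random variable with the same distribution as $U$, and, if $\lambda>1/2$, $(W'_n,B'_n)\xi/n^{s\lambda}$ converges almost surely and in $L^2$ to a random variable with the same distribution as $V$. -/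

import Mathlib

universe uOne uTwo

open MeasureTheory ProbabilityTheory Filter Topology

/-- An urn whose colours are indexed by `ι`, with replacement matrix `R` and initial contents `c₀`.
`C n` is the (row) vector of contents after `n` draws and `draw n` is the colour drawn at the
`(n + 1)`-st trial. The initial contents have total mass one and the rows of `R` sum to one, so the
urn has total contents `n + 1` before that trial. The conditional probabilities are taken with
respect to the natural filtration of the contents. -/
structure IsUrn {Ω ι : Type*} [MeasurableSpace Ω] [Fintype ι]
    (μ : Measure Ω) (R : Matrix ι ι ℝ) (c₀ : ι → ℝ)
    (C : ℕ → Ω → ι → ℝ) (draw : ℕ → Ω → ι) : Prop where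
  measurable_contents : ∀ n, Measurable (C n)
  measurableSet_draw : ∀ n i, MeasurableSet (draw n ⁻¹' {i})
  initial : ∀ ω, C 0 ω = c₀
  step : ∀ n ω, C (n + 1) ω = C n ω + R (draw n ω)
  condProb_draw : ∀ n i,
    μ[(draw n ⁻¹' {i}).indicator (fun _ => (1 : ℝ)) |
        Filtration.natural C (fun k => (measurable_contents k).stronglyMeasurable) n]
      =ᵐ[μ] fun ω => C n ω i / ((n : ℝ) + 1)

/-- The replacement matrix `[[sQ, E], [0, P]]`. The colours are
`inl 0` (white), `inl 1` (black), `inr 0` (green), `inr 1` (yellow). -/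
def fourColorMatrix (s : ℝ) (Q E P : Matrix (Fin 2) (Fin 2) ℝ) :
    Matrix (Fin 2 ⊕ Fin 2) (Fin 2 ⊕ Fin 2) ℝ :=
  Matrix.fromBlocks (s • Q) E 0 P

/-- The replacement matrix `[[sQ, 1 - s], [0, 1]]`. The colours are
`inl 0` (white), `inl 1` (black), `inr 0` (green). -/
def threeColorMatrix (s : ℝ) (Q : Matrix (Fin 2) (Fin 2) ℝ) :
    Matrix (Fin 2 ⊕ Fin 1) (Fin 2 ⊕ Fin 1) ℝ :=
  Matrix.fromBlocks (s • Q) (Matrix.of fun _ _ => 1 - s) 0 1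

/-- The initial vector `(W₀, B₀, G₀ + Y₀)` obtained from `(W₀, B₀, G₀, Y₀)`. -/
def mergeDominant (c : Fin 2 ⊕ Fin 2 → ℝ) : Fin 2 ⊕ Fin 1 → ℝ :=
  Sum.elim (fun i => c (Sum.inl i)) (fun _ => c (Sum.inr 0) + c (Sum.inr 1))

/-- `π` is a stationary distribution of the stochastic matrix `M`. -/
def IsStationaryDistribution (M : Matrix (Fin 2) (Fin 2) ℝ) (π : Fin 2 → ℝ) : Prop :=
  π ∈ stdSimplex ℝ (Fin 2) ∧ Matrix.vecMul π M = π

/-- `X n → Y` almost surely, as well as in `L²`. -/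
def TendstoAEAndL2 {Ω : Type*} [MeasurableSpace Ω] (μ : Measure Ω)
    (X : ℕ → Ω → ℝ) (Y : Ω → ℝ) : Prop :=
  (∀ n, MemLp (X n) 2 μ) ∧ MemLp Y 2 μ ∧
    (∀ᵐ ω ∂μ, Tendsto (fun n => X n ω) atTop (𝓝 (Y ω))) ∧
    Tendsto (fun n => eLpNorm (fun ω => X n ω - Y ω) 2 μ) atTop (𝓝 0)

/-- A random variable is non-degenerate if it is not almost surely constant. -/
def IsNondegenerate {Ω : Type*} [MeasurableSpace Ω] (μ : Measure Ω) (Y : Ω → ℝ) : Prop :=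
  ¬ ∃ c : ℝ, ∀ᵐ ω ∂μ, Y ω = c

/-- `X n ⇒ N(0, v)` for a random variance `v ≥ 0`: the limit law is that of `√v · Z`,
where `Z` is standard normal and independent of `v`. -/
def TendstoNormalMixture {Ω : Type*} [MeasurableSpace Ω] (μ : Measure Ω) [IsProbabilityMeasure μ]
    (X : ℕ → Ω → ℝ) (v : Ω → ℝ) : Prop :=
  TendstoInDistribution X atTop (fun p : Ω × ℝ => √(v p.1) * p.2)
    (fun _ => μ) (μ.prod (gaussianReal 0 1))

/-! ### Real sequences -/

/-! The zero block makes the white-black pair autonomous. An eigenvector `ζ` of `Q` with eigenvalue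
`ν`, extended by zero, is an eigenvector of `R` with eigenvalue `s * ν`, so `T n = C n ⬝ᵥ (ζ, 0)`
satisfies `T (n + 1) = T n * (1 + s * ν / (n + 1)) + noise`. Dividing by the product of these
factors (`urnGrowth`, of order `n ^ (s * ν)`) leaves a martingale up to a constant. With `S n = W n
+ B n`, the noise at step `n` has variance at most of order `E (S n) / n`, that is `n ^ (s - 1)`, so
the martingale is bounded in `L²` when `ν > 1 / 2`. The case `ν = 1` produces `U` and the case `ν =
lam > 1 / 2` produces `V`; non-degeneracy follows from one step whose noise has positive variance
(`exists_tendsto_div_rpow`). For `ν < 1`, division by `urnGrowth s` leaves a genuine contraction, so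
`T n = o(n ^ s)`, and the pair points in the direction of `πQ`. The same contraction for an
eigenvector of `P`, on the linear scale, gives the limit of `C n / n`.

Positivity of `U`: `S n` is affine in the number `K n` of dominated draws, and a product behaving
like `K n ^ (-a)` has an explicit mean of order `n ^ (-(s * a))`. By Fatou, `(K n / n ^ s) ^ (-a)`
cannot tend to infinity with positive probability (`ae_pos_of_tendsto`).

Central limit theorems: the chance of drawing a dominated colour depends on `K n` alone, so given `K
n = k` the pair has the law of a two-colour urn after `k` draws (`integral_dominated_eq_embedded`).
A one-step expansion of the characteristic function of that embedded urn, compared with the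
recursion `varianceSeq`, gives a Gaussian approximation uniform on the natural scale
(`exists_norm_embeddedCharFun_sub_gaussian_le`). Inserting the random time `K n`, which is
asymptotic to `U * n ^ s / s`, turns the Gaussian limit into a variance mixture.

Comparison with three colours: the transitions of the pair do not involve `E` or `P`, so its law at
each time, and hence the law of each limit, is the same in both urns. -/

theorem tendsto_zero_of_le_contraction {z c ε : ℕ → ℝ} (hz : ∀ᶠ n in atTop, 0 ≤ z n)
    (hc0 : ∀ᶠ n in atTop, 0 ≤ c n) (hc1 : ∀ᶠ n in atTop, c n ≤ 1) (hc : ¬ Summable c)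
    (hε : Tendsto ε atTop (𝓝 0))
    (h : ∀ᶠ n in atTop, z (n + 1) ≤ (1 - c n) * z n + c n * ε n) :
    Tendsto z atTop (𝓝 0) := by
  rw [Metric.tendsto_atTop]
  intro η hη
  have hε' : ∀ᶠ n in atTop, ε n ≤ η / 2 :=
    (hε.eventually (gt_mem_nhds (half_pos hη))).mono fun n hn => hn.le
  obtain ⟨N, hN⟩ := eventually_atTop.1 (hz.and (hc0.and (hc1.and (hε'.and h))))
  have hsum : Tendsto (fun k => ∑ i ∈ Finset.range k, c (i + N)) atTop atTop := by
    refine (not_summable_iff_tendsto_nat_atTop_of_nonneg fun i => ?_).1 ?_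
    · exact (hN _ (Nat.le_add_left _ _)).2.1
    · rwa [summable_nat_add_iff]
  -- Once `ε` is below `η / 2`, the excess of `z` over `η / 2` is multiplied by at most `1 - c ≤ exp
  -- (-c)` at each step; divergence of `∑ c` kills it.
  have key : ∀ k, z (k + N) ≤ η / 2 + z N * Real.exp (-∑ i ∈ Finset.range k, c (i + N)) := by
    intro k
    induction k with
    | zero => simp; linarith
    | succ k ih =>
      obtain ⟨-, h0, h1, h2, h3⟩ := hN (k + N) (Nat.le_add_left _ _)
      have hzN := (hN N le_rfl).1
      rw [Finset.sum_range_succ, neg_add, Real.exp_add]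
      have e1 : 1 - c (k + N) ≤ Real.exp (-c (k + N)) := by
        have := Real.add_one_le_exp (-c (k + N)); linarith
      set e := Real.exp (-∑ i ∈ Finset.range k, c (i + N))
      have he : 0 ≤ e := (Real.exp_pos _).le
      have hk : k + 1 + N = k + N + 1 := by ring
      rw [hk]
      calc z (k + N + 1) ≤ (1 - c (k + N)) * z (k + N) + c (k + N) * ε (k + N) := h3
        _ ≤ (1 - c (k + N)) * (η / 2 + z N * e) + c (k + N) * (η / 2) := by
          gcongr
        _ = η / 2 + z N * e * (1 - c (k + N)) := by ring
        _ ≤ η / 2 + z N * e * Real.exp (-c (k + N)) := by gcongr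
        _ = _ := by ring
  have hlim : Tendsto (fun k => z N * Real.exp (-∑ i ∈ Finset.range k, c (i + N))) atTop (𝓝 0) := by
    have := (Real.tendsto_exp_neg_atTop_nhds_zero.comp hsum).const_mul (z N)
    simpa using this
  obtain ⟨M, hM⟩ := eventually_atTop.1 (hlim.eventually (gt_mem_nhds (half_pos hη)))
  refine ⟨M + N, fun n hn => ?_⟩
  obtain ⟨k, rfl⟩ := Nat.exists_eq_add_of_le' (show N ≤ n by omega)
  have h1 := hM k (by omega)
  have h2 := key k
  rw [Real.dist_eq, sub_zero, abs_of_nonneg (hN (k + N) (Nat.le_add_left _ _)).1]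
  linarith

theorem not_summable_of_mul_tendsto {c : ℕ → ℝ} {a : ℝ} (ha : 0 < a)
    (hc : Tendsto (fun n : ℕ => c n * ((n : ℝ) + 1)) atTop (𝓝 a)) : ¬ Summable c := by
  intro hs
  have h1 : ∀ᶠ n : ℕ in atTop, a / 2 * (1 / ((n : ℝ) + 1)) ≤ c n := by
    filter_upwards [hc.eventually (lt_mem_nhds (half_lt_self ha))] with n hn
    have : (0 : ℝ) < n + 1 := by positivity
    rw [mul_one_div, div_le_iff₀ this]
    exact hn.le
  have h2 : Summable fun n : ℕ => a / 2 * (1 / ((n : ℝ) + 1)) := by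
    refine Summable.of_norm_bounded_eventually_nat hs ?_
    filter_upwards [h1] with n hn
    rwa [Real.norm_of_nonneg (by positivity)]
  rw [summable_mul_left_iff (by positivity)] at h2
  exact Real.not_summable_one_div_natCast ((summable_nat_add_iff 1).1 (by simpa using h2))

theorem tendsto_zero_of_mul_tendsto {c : ℕ → ℝ} {a : ℝ}
    (hc : Tendsto (fun n : ℕ => c n * ((n : ℝ) + 1)) atTop (𝓝 a)) : Tendsto c atTop (𝓝 0) := by
  have := hc.mul (tendsto_one_div_add_atTop_nhds_zero_nat (𝕜 := ℝ))
  rw [mul_zero] at this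
  refine this.congr fun n => ?_
  have : (0 : ℝ) < n + 1 := by positivity
  field_simp

/-- The contraction coefficients `c n` are of order `a / n`. -/
theorem tendsto_zero_of_le_contraction_of_mul_tendsto {z c ε : ℕ → ℝ} {a : ℝ} (ha : 0 < a)
    (hc : Tendsto (fun n : ℕ => c n * ((n : ℝ) + 1)) atTop (𝓝 a))
    (hz : ∀ᶠ n in atTop, 0 ≤ z n) (hε : Tendsto ε atTop (𝓝 0))
    (h : ∀ᶠ n in atTop, z (n + 1) ≤ (1 - c n) * z n + c n * ε n) :
    Tendsto z atTop (𝓝 0) := by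
  refine tendsto_zero_of_le_contraction hz ?_ ?_ (not_summable_of_mul_tendsto ha hc) hε h
  · filter_upwards [hc.eventually (lt_mem_nhds ha)] with n hn
    have : (0 : ℝ) < n + 1 := by positivity
    exact (pos_of_mul_pos_left hn this.le).le
  · exact ((tendsto_zero_of_mul_tendsto hc).eventually (gt_mem_nhds one_pos)).mono
      fun n hn => hn.le

/-- The series of `δ` may converge only conditionally, so absolute values cannot be taken termwise.
Adding its tail `t` to `y` absorbs `δ`: the sum `y + t` obeys the same contraction with forcing `t +
ε`, which vanishes in the limit. In the applications `δ` is the weighted martingale noise. -/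
theorem tendsto_zero_of_contraction_add_convergent {y c ε δ : ℕ → ℝ} {a l : ℝ} (ha : 0 < a)
    (hc : Tendsto (fun n : ℕ => c n * ((n : ℝ) + 1)) atTop (𝓝 a))
    (hε : Tendsto ε atTop (𝓝 0))
    (hδ : Tendsto (fun n => ∑ k ∈ Finset.range n, δ k) atTop (𝓝 l))
    (h : ∀ n, y (n + 1) = (1 - c n) * y n + c n * ε n + δ n) :
    Tendsto y atTop (𝓝 0) := by
  set t : ℕ → ℝ := fun n => l - ∑ k ∈ Finset.range n, δ k with ht
  have ht0 : Tendsto t atTop (𝓝 0) := by simpa using hδ.const_sub l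
  have hts : ∀ n, t (n + 1) = t n - δ n := fun n => by simp [ht, Finset.sum_range_succ]; ring
  have hz : Tendsto (fun n => |y n + t n|) atTop (𝓝 0) := by
    refine tendsto_zero_of_le_contraction_of_mul_tendsto ha hc (ε := fun n => |t n + ε n|)
      (Eventually.of_forall fun n => abs_nonneg _) (by simpa using (ht0.add hε).abs) ?_
    have hc1 := (tendsto_zero_of_mul_tendsto hc).eventually (gt_mem_nhds one_pos)
    filter_upwards [hc1, hc.eventually (lt_mem_nhds ha)] with n hn hn'
    have : (0 : ℝ) < n + 1 := by positivity
    have hc0 := (pos_of_mul_pos_left hn' this.le).le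
    have e : y (n + 1) + t (n + 1) = (1 - c n) * (y n + t n) + c n * (t n + ε n) := by
      rw [h, hts]; ring
    rw [e]
    refine (abs_add_le _ _).trans ?_
    rw [abs_mul, abs_mul, abs_of_nonneg hc0, abs_of_nonneg (by linarith : 0 ≤ 1 - c n)]
  have := ((tendsto_zero_iff_abs_tendsto_zero _).2 hz).sub ht0
  simpa using this

theorem tendsto_nat_div_add (x : ℝ) :
    Tendsto (fun n : ℕ => (n : ℝ) / (n + x)) atTop (𝓝 1) := tendsto_natCast_div_add_atTop x

theorem tendsto_add_div_nat_add (x y : ℝ) :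
    Tendsto (fun n : ℕ => ((n : ℝ) + y) / (n + x)) atTop (𝓝 1) := by
  have h1 := tendsto_nat_div_add x
  have h2 : Tendsto (fun n : ℕ => y / ((n : ℝ) + x)) atTop (𝓝 0) :=
    tendsto_const_nhds.div_atTop
      (tendsto_atTop_add_const_right _ _ tendsto_natCast_atTop_atTop)
  simpa [add_div] using h1.add h2

/-- `∏ (1 + h / (x + j))` over `j < n` is asymptotically `Γ(x) / Γ(x + h) * n ^ h`. -/
theorem tendsto_prod_one_add_div_div_rpow {x h : ℝ} (hx : 0 < x) (hxh : 0 < x + h) :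
    Tendsto (fun n : ℕ => (∏ j ∈ Finset.range n, (1 + h / (x + j))) / (n : ℝ) ^ h) atTop
      (𝓝 (Real.Gamma x / Real.Gamma (x + h))) := by
  -- The quotient of Euler's sequences for `Γ(x)` and `Γ(x + h)` is the required one, except that
  -- its product also contains the factor `j = n`; the correction `(n + x) / (n + x + h)` removes
  -- it.
  have h1 := (Real.GammaSeq_tendsto_Gamma x).div (Real.GammaSeq_tendsto_Gamma (x + h))
    (Real.Gamma_pos_of_pos hxh).ne'
  have h2 := h1.mul (tendsto_add_div_nat_add (x + h) x)
  rw [mul_one] at h2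
  refine h2.congr' ?_
  filter_upwards [eventually_gt_atTop 0] with n hn
  have hn' : (0 : ℝ) < n := by exact_mod_cast hn
  simp only [Real.GammaSeq, Pi.div_apply]
  have p1 : (0 : ℝ) < ∏ j ∈ Finset.range n, (x + j) :=
    Finset.prod_pos fun j _ => by positivity
  have p2 : (0 : ℝ) < ∏ j ∈ Finset.range n, (x + h + j) :=
    Finset.prod_pos fun j _ => by positivity
  have e : ∏ j ∈ Finset.range n, (1 + h / (x + j)) =
      (∏ j ∈ Finset.range n, (x + h + j)) / ∏ j ∈ Finset.range n, (x + (j : ℝ)) := by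
    rw [← Finset.prod_div_distrib]
    refine Finset.prod_congr rfl fun j _ => ?_
    have : (0 : ℝ) < x + j := by positivity
    field_simp; ring
  rw [e, Finset.prod_range_succ, Finset.prod_range_succ, Real.rpow_add hn']
  have q1 : (0 : ℝ) < (n : ℝ) ^ x := Real.rpow_pos_of_pos hn' _
  have q2 : (0 : ℝ) < (n : ℝ) ^ h := Real.rpow_pos_of_pos hn' _
  have q3 : (0 : ℝ) < (n.factorial : ℝ) := by exact_mod_cast n.factorial_pos
  have q4 : (0 : ℝ) < x + n := by positivity
  have q5 : (0 : ℝ) < x + h + n := by positivity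
  have q6 : (n : ℝ) + (x + h) ≠ 0 := by linarith
  field_simp
  ring

/-! ### The variance recursion of the embedded two-colour urn -/

/-- With `x = S₀ / s`, where `S₀` is the initial mass of the dominated pair, this is the approximate
variance of `x ⬝ᵥ ξ` after `n` embedded draws, in units of the limiting one-step variance `(s * lam)
^ 2 * (πQ ⬝ᵥ ξ ^ 2)`: the old variance is amplified by the squared drift factor and a unit is added.
-/
noncomputable def varianceSeq (lam x : ℝ) : ℕ → ℝ
  | 0 => 0
  | n + 1 => (1 + lam / (n + x)) ^ 2 * varianceSeq lam x n + 1

theorem varianceSeq_nonneg (lam x : ℝ) (n : ℕ) : 0 ≤ varianceSeq lam x n := by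
  induction n with
  | zero => simp [varianceSeq]
  | succ n ih => rw [varianceSeq]; positivity

theorem one_le_varianceSeq_succ (lam x : ℝ) (n : ℕ) : 1 ≤ varianceSeq lam x (n + 1) := by
  have := varianceSeq_nonneg lam x n
  rw [varianceSeq]
  have : 0 ≤ (1 + lam / (n + x)) ^ 2 * varianceSeq lam x n := by positivity
  linarith

theorem tendsto_natCast_add_atTop (x : ℝ) : Tendsto (fun n : ℕ => (n : ℝ) + x) atTop atTop :=
  tendsto_atTop_add_const_right _ _ tendsto_natCast_atTop_atTop

theorem tendsto_const_div_natCast_add (a x : ℝ) :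
    Tendsto (fun n : ℕ => a / ((n : ℝ) + x)) atTop (𝓝 0) :=
  tendsto_const_nhds.div_atTop (tendsto_natCast_add_atTop x)

theorem tendsto_varianceSeq_div {lam x : ℝ} (hx : 0 < x) (hlam : lam < 1 / 2) :
    Tendsto (fun n : ℕ => varianceSeq lam x n / n) atTop (𝓝 (1 / (1 - 2 * lam))) := by
  have hl : 0 < 1 - 2 * lam := by linarith
  set y : ℕ → ℝ := fun n => varianceSeq lam x n / (n + x) - 1 / (1 - 2 * lam) with hy
  -- Expanding the square, `varianceSeq / (n + x)` contracts towards `1 / (1 - 2 * lam)` at rate `(1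
  -- - 2 * lam) / n`; the term `lam ^ 2 / (n + x)` is a lower-order perturbation.
  set c : ℕ → ℝ := fun n => (1 - 2 * lam - lam ^ 2 / (n + x)) / (n + (x + 1)) with hc
  have hcm : Tendsto (fun n : ℕ => (1 - 2 * lam - lam ^ 2 / ((n : ℝ) + x))) atTop
      (𝓝 (1 - 2 * lam)) := by
    simpa using (tendsto_const_div_natCast_add (lam ^ 2) x).const_sub (1 - 2 * lam)
  have hcl : Tendsto (fun n : ℕ => c n * ((n : ℝ) + 1)) atTop (𝓝 (1 - 2 * lam)) := by
    have := hcm.mul (tendsto_add_div_nat_add (x + 1) 1)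
    rw [mul_one] at this
    refine this.congr fun n => ?_
    simp only [hc]; ring
  have hy0 : Tendsto y atTop (𝓝 0) := by
    rw [tendsto_zero_iff_abs_tendsto_zero]
    refine tendsto_zero_of_le_contraction_of_mul_tendsto hl hcl
      (ε := fun n => lam ^ 2 / (n + x) * (1 / (1 - 2 * lam)) /
        (1 - 2 * lam - lam ^ 2 / ((n : ℝ) + x)))
      (Eventually.of_forall fun n => abs_nonneg _) ?_ ?_
    · have := ((tendsto_const_div_natCast_add (lam ^ 2) x).mul_const (1 / (1 - 2 * lam))).div hcm
        hl.ne'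
      rw [zero_mul, zero_div] at this
      exact this
    · filter_upwards [hcm.eventually (lt_mem_nhds hl),
        (tendsto_zero_of_mul_tendsto hcl).eventually (gt_mem_nhds one_pos)] with n hn hn1
      have hN : (0 : ℝ) < n + x := by positivity
      have hN1 : (0 : ℝ) < n + (x + 1) := by positivity
      have hn' := hn.ne'
      have hcn : 0 ≤ c n := div_nonneg hn.le hN1.le
      have hce : c n * (lam ^ 2 / (n + x) * (1 / (1 - 2 * lam)) /
          (1 - 2 * lam - lam ^ 2 / ((n : ℝ) + x))) =
          lam ^ 2 / (n + x) * (1 / (1 - 2 * lam)) / (n + (x + 1)) := by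
        simp only [hc]
        generalize (1 - 2 * lam - lam ^ 2 / ((n : ℝ) + x)) = w at hn'
        field_simp
      have e : y (n + 1) = (1 - c n) * y n +
          lam ^ 2 / (n + x) * (1 / (1 - 2 * lam)) / (n + (x + 1)) := by
        simp only [hy, hc, varianceSeq]
        push_cast
        have h3 : (n : ℝ) + 1 + x ≠ 0 := by positivity
        have hr : 1 / (1 - 2 * lam) * (1 - 2 * lam) = 1 := one_div_mul_cancel hl.ne'
        generalize 1 / (1 - 2 * lam) = r at hr
        field_simp
        linear_combination (-((n : ℝ) + x) ^ 2 * (n + x + 1)) * hr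
      simp only [Function.comp_apply]
      rw [hce, e]
      refine (abs_add_le _ _).trans ?_
      rw [abs_mul, abs_of_nonneg (by linarith : 0 ≤ 1 - c n)]
      gcongr
      exact (abs_of_nonneg (by positivity)).le
  have h1 := (hy0.add_const (1 / (1 - 2 * lam))).mul (tendsto_add_div_nat_add 0 x)
  rw [zero_add, mul_one] at h1
  refine h1.congr' ?_
  filter_upwards [eventually_gt_atTop 0] with n hn
  have hn' : (0 : ℝ) < n := by exact_mod_cast hn
  simp only [hy, add_zero, sub_add_cancel]
  field_simp

/-- Increments equivalent to `1 / (n + 1)` sum to something equivalent to the harmonic sum, which is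
equivalent to `log n`. -/
theorem tendsto_div_log_of_mul_sub_tendsto {y : ℕ → ℝ}
    (h : Tendsto (fun n : ℕ => (y (n + 1) - y n) * ((n : ℝ) + 1)) atTop (𝓝 1)) :
    Tendsto (fun n : ℕ => y n / Real.log n) atTop (𝓝 1) := by
  have hlo : (fun n : ℕ => (y (n + 1) - y n) - 1 / ((n : ℝ) + 1)) =o[atTop]
      fun n : ℕ => 1 / ((n : ℝ) + 1) := by
    rw [Asymptotics.isLittleO_iff_tendsto' (Eventually.of_forall fun n hn => by
      have : (0 : ℝ) < n + 1 := by positivity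
      have := one_div_pos.2 this
      linarith)]
    have := h.sub_const 1
    rw [sub_self] at this
    refine this.congr fun n => ?_
    have : (0 : ℝ) < n + 1 := by positivity
    field_simp
  have hdiv : Tendsto (fun n => ∑ i ∈ Finset.range n, 1 / ((i : ℝ) + 1)) atTop atTop :=
    Real.tendsto_sum_range_one_div_nat_succ_atTop
  have hs := hlo.sum_range (fun n => by positivity) hdiv
  have hH : Tendsto (fun n : ℕ => (∑ i ∈ Finset.range n, 1 / ((i : ℝ) + 1)) / Real.log n) atTop
      (𝓝 1) := by
    have h1 := Real.tendsto_harmonic_sub_log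
    have h2 := h1.div_atTop (Real.tendsto_log_atTop.comp tendsto_natCast_atTop_atTop)
    have h3 := h2.add_const 1
    rw [zero_add] at h3
    refine h3.congr' ?_
    filter_upwards [eventually_gt_atTop 1] with n hn
    have : 0 < Real.log n := Real.log_pos (by exact_mod_cast hn)
    simp only [Function.comp_apply, harmonic]
    push_cast
    simp only [one_div]
    field_simp
    ring
  have h0 : ∀ᶠ n in atTop, (∑ i ∈ Finset.range n, 1 / ((i : ℝ) + 1)) ≠ 0 :=
    (hdiv.eventually_gt_atTop 0).mono fun n hn => hn.ne'
  have h4 := (hs.tendsto_div_nhds_zero.add_const 1).mul hH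
  rw [zero_add, one_mul] at h4
  have h5 : Tendsto (fun n : ℕ => y 0 / Real.log n) atTop (𝓝 0) :=
    tendsto_const_nhds.div_atTop (Real.tendsto_log_atTop.comp tendsto_natCast_atTop_atTop)
  have h6 := h4.add h5
  rw [add_zero] at h6
  refine h6.congr' ?_
  filter_upwards [h0, eventually_gt_atTop 1] with n hn hn1
  have : 0 < Real.log n := Real.log_pos (by exact_mod_cast hn1)
  rw [Finset.sum_sub_distrib, Finset.sum_range_sub]
  field_simp
  ring

theorem tendsto_varianceSeq_div_log {x : ℝ} (hx : 0 < x) :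
    Tendsto (fun n : ℕ => varianceSeq (1 / 2) x n / (n * Real.log n)) atTop (𝓝 1) := by
  set y : ℕ → ℝ := fun n => varianceSeq (1 / 2) x n / (n + x) with hy
  -- At `lam = 1 / 2` the contraction rate `1 - 2 * lam` vanishes, so `y` grows with increments
  -- close to `1 / n`. The extra term is negligible once `y n / n → 0` is known, which is what `hw`
  -- provides.
  have hrec : ∀ n, y (n + 1) = y n + y n / (n + x) * (1 / (4 * (n + (x + 1)))) +
      1 / (n + (x + 1)) := by
    intro n
    simp only [hy, varianceSeq]
    push_cast
    have hN : (0 : ℝ) < n + x := by positivity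
    have hN1 : (0 : ℝ) < n + (x + 1) := by positivity
    have hN2 : (0 : ℝ) < n + 1 + x := by positivity
    field_simp
    ring
  have hy0 : ∀ n, 0 ≤ y n := fun n => div_nonneg (varianceSeq_nonneg _ _ _) (by positivity)
  set c : ℕ → ℝ := fun n => (1 - 1 / 4 / (n + (x + 1))) / (n + (x + 1)) with hc
  have hcm : Tendsto (fun n : ℕ => (1 - 1 / 4 / ((n : ℝ) + (x + 1)))) atTop (𝓝 1) := by
    simpa only [sub_zero] using (tendsto_const_div_natCast_add (1 / 4) (x + 1)).const_sub 1
  have hcl : Tendsto (fun n : ℕ => c n * ((n : ℝ) + 1)) atTop (𝓝 1) := by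
    have := hcm.mul (tendsto_add_div_nat_add (x + 1) 1)
    rw [mul_one] at this
    refine this.congr fun n => ?_
    simp only [hc]; ring
  have hw : Tendsto (fun n : ℕ => y n / (n + x)) atTop (𝓝 0) := by
    refine tendsto_zero_of_le_contraction_of_mul_tendsto one_pos hcl
      (ε := fun n => 1 / (n + (x + 1)) / (1 - 1 / 4 / ((n : ℝ) + (x + 1))))
      (Eventually.of_forall fun n => div_nonneg (hy0 n) (by positivity)) ?_ ?_
    · have := (tendsto_const_div_natCast_add 1 (x + 1)).div hcm one_ne_zero
      rw [zero_div] at this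
      exact this
    · refine Eventually.of_forall fun n => le_of_eq ?_
      have hN : (0 : ℝ) < n + x := by positivity
      have hN1 : (0 : ℝ) < n + (x + 1) := by positivity
      have hw1 : 0 < 1 - 1 / 4 / ((n : ℝ) + (x + 1)) := by
        rw [sub_pos, div_lt_one hN1]
        have : (0 : ℝ) ≤ n := n.cast_nonneg
        linarith
      have hce : c n * (1 / (n + (x + 1)) / (1 - 1 / 4 / ((n : ℝ) + (x + 1)))) =
          1 / (n + (x + 1)) / (n + (x + 1)) := by
        simp only [hc]
        generalize 1 - 1 / 4 / ((n : ℝ) + (x + 1)) = w at hw1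
        field_simp
      rw [hce, hrec]
      simp only [hc]
      push_cast
      have hN2 : (0 : ℝ) < n + 1 + x := by positivity
      field_simp
      ring
  have hlog : Tendsto (fun n : ℕ => y n / Real.log n) atTop (𝓝 1) := by
    refine tendsto_div_log_of_mul_sub_tendsto ?_
    have h1 := (tendsto_add_div_nat_add (x + 1) 1).mul ((hw.mul_const (1 / 4)).add_const 1)
    rw [zero_mul, zero_add, one_mul] at h1
    refine h1.congr fun n => ?_
    rw [hrec]
    have hN : (0 : ℝ) < n + x := by positivity
    have hN1 : (0 : ℝ) < n + (x + 1) := by positivity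
    field_simp
    ring
  have h1 := hlog.mul (tendsto_add_div_nat_add 0 x)
  rw [mul_one] at h1
  refine h1.congr fun n => ?_
  simp only [hy, add_zero]
  rcases n.eq_zero_or_pos with rfl | hn
  · simp
  have hn' : (0 : ℝ) < n := by exact_mod_cast hn
  field_simp

theorem not_summable_one_div_mul_log :
    ¬ Summable fun n : ℕ => 1 / (((n : ℝ) + 2) * Real.log (n + 2)) := by
  have hl : ∀ n : ℕ, 0 < Real.log ((n : ℝ) + 2) := fun n => Real.log_pos (by
    have : (0 : ℝ) ≤ n := n.cast_nonneg
    linarith)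
  rw [not_summable_iff_tendsto_nat_atTop_of_nonneg fun n => by have := hl n; positivity]
  -- The partial sums dominate `log log`, by two uses of `log r ≤ r - 1`.
  have key : ∀ n : ℕ, Real.log (Real.log ((n : ℝ) + 2)) - Real.log (Real.log 2) ≤
      ∑ i ∈ Finset.range n, 1 / (((i : ℝ) + 2) * Real.log (i + 2)) := by
    intro n
    induction n with
    | zero => simp
    | succ n ih =>
      rw [Finset.sum_range_succ]
      have h1 := hl n
      have h2 := hl (n + 1)
      push_cast at h2 ⊢
      have hn : (0 : ℝ) < n + 2 := by positivity
      have hn1 : (0 : ℝ) < n + 1 + 2 := by positivity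
      have e1 : Real.log ((n : ℝ) + 1 + 2) - Real.log (n + 2) ≤ 1 / (n + 2) := by
        rw [← Real.log_div hn1.ne' hn.ne']
        refine (Real.log_le_sub_one_of_pos (by positivity)).trans (le_of_eq ?_)
        field_simp; ring
      have e2 : Real.log (Real.log ((n : ℝ) + 1 + 2)) - Real.log (Real.log (n + 2)) ≤
          1 / ((n + 2) * Real.log (n + 2)) := by
        rw [← Real.log_div h2.ne' h1.ne']
        refine (Real.log_le_sub_one_of_pos (by positivity)).trans ?_
        rw [div_sub_one h1.ne', ← div_div]
        gcongr
      linarith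
  refine tendsto_atTop_mono key (tendsto_atTop_add_const_right _ _ ?_)
  refine Real.tendsto_log_atTop.comp (Real.tendsto_log_atTop.comp ?_)
  exact tendsto_natCast_add_atTop 2

theorem not_summable_of_div_tendsto {b κ : ℕ → ℝ} {l : ℝ} (hl : 0 < l)
    (hκ : ¬ Summable fun n => 1 / κ n) (hκ0 : ∀ᶠ n in atTop, 0 < κ n)
    (h : Tendsto (fun n => b n / κ n) atTop (𝓝 l)) : ¬ Summable fun n => 1 / b n := by
  intro hs
  refine hκ (Summable.of_norm_bounded_eventually_nat (hs.mul_left (2 * l)) ?_)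
  filter_upwards [hκ0, h.eventually (gt_mem_nhds (by linarith : l < 2 * l)),
    h.eventually (lt_mem_nhds hl)] with n h0 h1 h2
  have hb : 0 < b n := by
    have := mul_pos h2 h0
    rwa [div_mul_cancel₀ _ h0.ne'] at this
  rw [Real.norm_of_nonneg (by positivity), mul_one_div, div_le_div_iff₀ h0 hb]
  rw [div_lt_iff₀ h0] at h1
  linarith

/-- The numbers `1 / varianceSeq lam x (n + 1)` are the contraction rates in the central limit
theorem for the embedded urn. Their sum diverges because the variance grows only like `n` or `n *
log n`; here `lam ≤ 1 / 2` is used. -/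
theorem not_summable_one_div_varianceSeq {lam x : ℝ} (hx : 0 < x) (hlam : lam ≤ 1 / 2) :
    ¬ Summable fun n => 1 / varianceSeq lam x (n + 1) := by
  rw [summable_nat_add_iff (f := fun n => 1 / varianceSeq lam x n)]
  rcases hlam.lt_or_eq with h | rfl
  · refine not_summable_of_div_tendsto (κ := fun n => (n : ℝ)) (by
      have : 0 < 1 - 2 * lam := by linarith
      positivity) Real.not_summable_one_div_natCast
      ((eventually_gt_atTop 0).mono fun n hn => by exact_mod_cast hn)
      (tendsto_varianceSeq_div hx h)
  · refine not_summable_of_div_tendsto (κ := fun n => (n : ℝ) * Real.log n) one_pos ?_ ?_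
      (tendsto_varianceSeq_div_log hx)
    · rw [← summable_nat_add_iff 2]
      have := not_summable_one_div_mul_log
      push_cast
      exact this
    · filter_upwards [eventually_gt_atTop 1] with n hn
      have : 0 < Real.log n := Real.log_pos (by exact_mod_cast hn)
      positivity

theorem tendsto_varianceSeq_atTop {lam x : ℝ} (hx : 0 < x) (hlam : lam ≤ 1 / 2) :
    Tendsto (varianceSeq lam x) atTop atTop := by
  rcases hlam.lt_or_eq with h | rfl
  · have h1 := (tendsto_varianceSeq_div hx h).pos_mul_atTop (by
      have : 0 < 1 - 2 * lam := by linarith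
      positivity) tendsto_natCast_atTop_atTop
    refine h1.congr' ?_
    filter_upwards [eventually_gt_atTop 0] with n hn
    have : (n : ℝ) ≠ 0 := by positivity
    field_simp
  · have h1 := (tendsto_varianceSeq_div_log hx).pos_mul_atTop one_pos
      (tendsto_natCast_atTop_atTop.atTop_mul_atTop₀
        (Real.tendsto_log_atTop.comp tendsto_natCast_atTop_atTop))
    refine h1.congr' ?_
    filter_upwards [eventually_gt_atTop 1] with n hn
    have : 0 < Real.log n := Real.log_pos (by exact_mod_cast hn)
    have : (n : ℝ) ≠ 0 := by positivity
    simp only [Function.comp_apply]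
    field_simp

/-! ### Generalities on urns -/

/-- At a fixed time the contents take finitely many values. Every function of them is therefore
simple, hence measurable, bounded and integrable, and test functions need no regularity. -/
theorem stronglyMeasurable_comp_of_finite_range {Ω α E : Type*} [MeasurableSpace Ω]
    [MeasurableSpace α] [MeasurableSingletonClass α] [TopologicalSpace E] {f : Ω → α}
    (hf : Measurable f) (hfin : (Set.range f).Finite) (F : α → E) :
    StronglyMeasurable fun ω => F (f ω) := by
  let g : SimpleFunc Ω E :=
    { toFun := fun ω => F (f ω)
      measurableSet_fiber' := fun y => by
        have : (fun ω => F (f ω)) ⁻¹' {y} = f ⁻¹' (F ⁻¹' {y} ∩ Set.range f) := by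
          ext ω; simp
        rw [this]
        exact hf (hfin.inter_of_right _).measurableSet
      finite_range' := by
        have : Set.range (fun ω => F (f ω)) = F '' Set.range f := by
          rw [← Set.range_comp]; rfl
        rw [this]
        exact hfin.image F }
  exact g.stronglyMeasurable

theorem comp_draw_eq_sum {Ω ι E : Type*} [NormedAddCommGroup E] [NormedSpace ℝ E]
    [Fintype ι] (C : ℕ → Ω → ι → ℝ) (draw : ℕ → Ω → ι) (n : ℕ) (F : (ι → ℝ) → ι → E) :
    (fun ω => F (C n ω) (draw n ω)) = ∑ i, (draw n ⁻¹' {i}).indicator (fun _ => (1 : ℝ)) •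
      fun ω => F (C n ω) i := by
  classical
  ext ω
  simp only [Finset.sum_apply, Pi.smul_apply', Set.indicator_apply, Set.mem_preimage,
    Set.mem_singleton_iff, ite_smul, one_smul, zero_smul, Finset.sum_ite_eq, Finset.mem_univ,
    if_true]

/-- The centred increment of `C n ⬝ᵥ v`. -/
noncomputable def urnNoise {Ω ι : Type*} [Fintype ι] (R : Matrix ι ι ℝ) (C : ℕ → Ω → ι → ℝ)
    (draw : ℕ → Ω → ι) (v : ι → ℝ) (n : ℕ) (ω : Ω) : ℝ :=
  R.mulVec v (draw n ω) - (C n ω ⬝ᵥ R.mulVec v) / ((n : ℝ) + 1)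

namespace IsUrn

variable {Ω ι : Type*} [MeasurableSpace Ω] [Fintype ι] {μ : Measure Ω}
  {R : Matrix ι ι ℝ} {c₀ : ι → ℝ} {C : ℕ → Ω → ι → ℝ} {draw : ℕ → Ω → ι}

/-- The natural filtration of the contents. -/
abbrev filtration (h : IsUrn μ R c₀ C draw) : Filtration ℕ ‹MeasurableSpace Ω› :=
  Filtration.natural C (fun k => (h.measurable_contents k).stronglyMeasurable)

theorem finite_range (h : IsUrn μ R c₀ C draw) (n : ℕ) : (Set.range (C n)).Finite := by
  induction n with
  | zero =>
    refine (Set.finite_singleton c₀).subset ?_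
    rintro _ ⟨ω, rfl⟩
    exact h.initial ω
  | succ n ih =>
    refine (Set.Finite.image2 (fun x y => x + y) ih (Set.finite_range R)).subset ?_
    rintro _ ⟨ω, rfl⟩
    exact ⟨C n ω, ⟨ω, rfl⟩, R (draw n ω), ⟨_, rfl⟩, (h.step n ω).symm⟩

theorem stronglyMeasurable_filtration (h : IsUrn μ R c₀ C draw) {E : Type*} [TopologicalSpace E]
    (n : ℕ) (F : (ι → ℝ) → E) : StronglyMeasurable[h.filtration n] fun ω => F (C n ω) := by
  have hm : Measurable[h.filtration n] (C n) :=
    (Filtration.stronglyAdapted_natural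
      (fun k => (h.measurable_contents k).stronglyMeasurable) n).measurable
  exact @stronglyMeasurable_comp_of_finite_range Ω (ι → ℝ) E (h.filtration n) _ _ _ _ hm
    (h.finite_range n) F

theorem stronglyMeasurable (h : IsUrn μ R c₀ C draw) {E : Type*} [TopologicalSpace E]
    (n : ℕ) (F : (ι → ℝ) → E) : StronglyMeasurable fun ω => F (C n ω) :=
  stronglyMeasurable_comp_of_finite_range (h.measurable_contents n) (h.finite_range n) F

theorem exists_norm_le (h : IsUrn μ R c₀ C draw) {E : Type*} [NormedAddCommGroup E]
    (n : ℕ) (F : (ι → ℝ) → E) : ∃ B, ∀ ω, ‖F (C n ω)‖ ≤ B := by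
  obtain ⟨B, hB⟩ := ((h.finite_range n).image fun x => ‖F x‖).bddAbove
  exact ⟨B, fun ω => hB ⟨C n ω, ⟨ω, rfl⟩, rfl⟩⟩

theorem integrable [IsProbabilityMeasure μ] (h : IsUrn μ R c₀ C draw) {E : Type*}
    [NormedAddCommGroup E] (n : ℕ) (F : (ι → ℝ) → E) : Integrable (fun ω => F (C n ω)) μ := by
  obtain ⟨B, hB⟩ := h.exists_norm_le n F
  exact Integrable.of_bound (h.stronglyMeasurable n F).aestronglyMeasurable B (ae_of_all _ hB)

theorem exists_norm_draw_le (h : IsUrn μ R c₀ C draw) {E : Type*} [NormedAddCommGroup E]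
    (n : ℕ) (F : (ι → ℝ) → ι → E) : ∃ B, ∀ ω, ‖F (C n ω) (draw n ω)‖ ≤ B := by
  choose B hB using fun i => h.exists_norm_le n fun x => F x i
  refine ⟨∑ i, |B i|, fun ω => (hB _ ω).trans ((le_abs_self _).trans ?_)⟩
  exact Finset.single_le_sum (f := fun i => |B i|) (fun i _ => abs_nonneg _)
    (Finset.mem_univ (draw n ω))

theorem stronglyMeasurable_draw (h : IsUrn μ R c₀ C draw) {E : Type*} [NormedAddCommGroup E]
    [NormedSpace ℝ E] (n : ℕ) (F : (ι → ℝ) → ι → E) :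
    StronglyMeasurable fun ω => F (C n ω) (draw n ω) := by
  rw [comp_draw_eq_sum]
  exact Finset.stronglyMeasurable_sum _ fun i _ => StronglyMeasurable.smul
    (stronglyMeasurable_const.indicator (h.measurableSet_draw n i))
    (h.stronglyMeasurable n fun x => F x i)

/-- Given the past, the drawn colour has law `C n / (n + 1)`, while each `F (C n) i` is known and
can be pulled out. All one-step computations are instances of this identity. -/
theorem condExp_draw [IsProbabilityMeasure μ] (h : IsUrn μ R c₀ C draw) {E : Type*}
    [NormedAddCommGroup E] [NormedSpace ℝ E] [CompleteSpace E] (n : ℕ) (F : (ι → ℝ) → ι → E) :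
    μ[fun ω => F (C n ω) (draw n ω) | h.filtration n] =ᵐ[μ]
      fun ω => ∑ i, (C n ω i / ((n : ℝ) + 1)) • F (C n ω) i := by
  rw [comp_draw_eq_sum]
  have hint : ∀ i, Integrable ((draw n ⁻¹' {i}).indicator (fun _ => (1 : ℝ)) •
      fun ω => F (C n ω) i) μ := by
    intro i
    obtain ⟨B, hB⟩ := h.exists_norm_le n fun x => F x i
    refine Integrable.of_bound (C := |B|) (StronglyMeasurable.smul
      (stronglyMeasurable_const.indicator (h.measurableSet_draw n i))
      (h.stronglyMeasurable n fun x => F x i)).aestronglyMeasurable (ae_of_all _ fun ω => ?_)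
    rw [Pi.smul_apply', norm_smul]
    have h1 : ‖(draw n ⁻¹' {i}).indicator (fun _ => (1 : ℝ)) ω‖ ≤ 1 :=
      (norm_indicator_le_norm_self _ _).trans (by simp)
    exact (mul_le_of_le_one_left (norm_nonneg _) h1).trans ((hB ω).trans (le_abs_self _))
  refine (condExp_finsetSum (fun i _ => hint i) _).trans ?_
  have hall : ∀ᵐ ω ∂μ, ∀ i, (μ[(draw n ⁻¹' {i}).indicator (fun _ => (1 : ℝ)) •
      fun ω => F (C n ω) i | h.filtration n]) ω = (C n ω i / ((n : ℝ) + 1)) • F (C n ω) i := by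
    rw [ae_all_iff]
    intro i
    have h1 := condExp_smul_of_aestronglyMeasurable_right (m := h.filtration n) (μ := μ)
      (f := (draw n ⁻¹' {i}).indicator (fun _ => (1 : ℝ))) (g := fun ω => F (C n ω) i)
      ((integrable_const _).indicator (h.measurableSet_draw n i)) (hint i)
      (h.stronglyMeasurable_filtration n fun x => F x i).aestronglyMeasurable
    filter_upwards [h1, h.condProb_draw n i] with ω h1 h2
    rw [h1, Pi.smul_apply', h2]
  filter_upwards [hall] with ω hω
  rw [Finset.sum_apply]
  exact Finset.sum_congr rfl fun i _ => hω i

/-- One step of the urn, in expectation. -/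
theorem integral_draw [IsProbabilityMeasure μ] (h : IsUrn μ R c₀ C draw) {E : Type*}
    [NormedAddCommGroup E] [NormedSpace ℝ E] [CompleteSpace E] (n : ℕ) (F : (ι → ℝ) → ι → E) :
    ∫ ω, F (C n ω) (draw n ω) ∂μ = ∫ ω, ∑ i, (C n ω i / ((n : ℝ) + 1)) • F (C n ω) i ∂μ := by
  rw [← integral_condExp (h.filtration.le n)]
  exact integral_congr_ae (h.condExp_draw n F)

theorem nonneg [DecidableEq ι] (h : IsUrn μ R c₀ C draw) (hR : R ∈ Matrix.rowStochastic ℝ ι)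
    (hc₀ : c₀ ∈ stdSimplex ℝ ι) (n : ℕ) (ω : Ω) (i : ι) : 0 ≤ C n ω i := by
  induction n with
  | zero => rw [h.initial]; exact hc₀.1 i
  | succ n ih =>
    rw [h.step, Pi.add_apply]
    exact add_nonneg ih (Matrix.nonneg_of_mem_rowStochastic hR)

theorem sum_eq [DecidableEq ι] (h : IsUrn μ R c₀ C draw) (hR : R ∈ Matrix.rowStochastic ℝ ι)
    (hc₀ : c₀ ∈ stdSimplex ℝ ι) (n : ℕ) (ω : Ω) : ∑ i, C n ω i = (n : ℝ) + 1 := by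
  induction n with
  | zero => rw [h.initial, hc₀.2]; simp
  | succ n ih =>
    rw [h.step]
    simp only [Pi.add_apply, Finset.sum_add_distrib, ih, Matrix.sum_row_of_mem_rowStochastic hR]
    push_cast; ring

theorem dotProduct_succ (h : IsUrn μ R c₀ C draw) (v : ι → ℝ) (n : ℕ) (ω : Ω) :
    C (n + 1) ω ⬝ᵥ v = C n ω ⬝ᵥ v + R.mulVec v (draw n ω) := by
  rw [h.step, add_dotProduct]; rfl

theorem dotProduct_succ_noise (h : IsUrn μ R c₀ C draw) (v : ι → ℝ) (n : ℕ) (ω : Ω) :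
    C (n + 1) ω ⬝ᵥ v = C n ω ⬝ᵥ v + (C n ω ⬝ᵥ R.mulVec v) / ((n : ℝ) + 1) +
      urnNoise R C draw v n ω := by
  rw [h.dotProduct_succ, urnNoise]; ring

theorem urnNoise_eq (h : IsUrn μ R c₀ C draw) (v : ι → ℝ) (n : ℕ) (ω : Ω) :
    urnNoise R C draw v n ω =
      C (n + 1) ω ⬝ᵥ v - (C n ω ⬝ᵥ v + (C n ω ⬝ᵥ R.mulVec v) / ((n : ℝ) + 1)) := by
  rw [h.dotProduct_succ_noise]; ring

theorem memLp_urnNoise [IsProbabilityMeasure μ] (h : IsUrn μ R c₀ C draw) (v : ι → ℝ) (n : ℕ)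
    (p : ENNReal) : MemLp (urnNoise R C draw v n) p μ := by
  let F : (ι → ℝ) → ι → ℝ := fun x i => R.mulVec v i - (x ⬝ᵥ R.mulVec v) / ((n : ℝ) + 1)
  obtain ⟨B, hB⟩ := h.exists_norm_draw_le n F
  exact MemLp.of_bound (h.stronglyMeasurable_draw n F).aestronglyMeasurable B (ae_of_all _ hB)

theorem stronglyMeasurable_urnNoise (h : IsUrn μ R c₀ C draw) (v : ι → ℝ) (n : ℕ) :
    StronglyMeasurable[h.filtration (n + 1)] (urnNoise R C draw v n) := by
  have h1 := h.stronglyMeasurable_filtration (n + 1) (fun x => x ⬝ᵥ v)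
  have h2 := (h.stronglyMeasurable_filtration n
    (fun x => x ⬝ᵥ v + (x ⬝ᵥ R.mulVec v) / ((n : ℝ) + 1))).mono (h.filtration.mono n.le_succ)
  exact (funext fun ω => h.urnNoise_eq v n ω) ▸ h1.sub h2

theorem condExp_urnNoise [DecidableEq ι] [IsProbabilityMeasure μ] (h : IsUrn μ R c₀ C draw)
    (hR : R ∈ Matrix.rowStochastic ℝ ι) (hc₀ : c₀ ∈ stdSimplex ℝ ι) (v : ι → ℝ) (n : ℕ) :
    μ[urnNoise R C draw v n | h.filtration n] =ᵐ[μ] 0 := by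
  let F : (ι → ℝ) → ι → ℝ := fun x i => R.mulVec v i - (x ⬝ᵥ R.mulVec v) / ((n : ℝ) + 1)
  refine (h.condExp_draw n F).trans (ae_of_all _ fun ω => ?_)
  have hn : (n : ℝ) + 1 ≠ 0 := by positivity
  simp only [F, smul_eq_mul, mul_sub, Finset.sum_sub_distrib, ← Finset.sum_mul, ← Finset.sum_div,
    h.sum_eq hR hc₀, dotProduct, Pi.zero_apply]
  rw [div_self hn, one_mul, Finset.sum_div]
  simp only [div_mul_eq_mul_div, sub_self]

/-- The conditional variance of the increment: its second moment minus the square of its mean, under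
the weights `C n i / (n + 1)`, which sum to one. -/
theorem integral_urnNoise_sq [DecidableEq ι] [IsProbabilityMeasure μ] (h : IsUrn μ R c₀ C draw)
    (hR : R ∈ Matrix.rowStochastic ℝ ι) (hc₀ : c₀ ∈ stdSimplex ℝ ι) (v : ι → ℝ) (n : ℕ) :
    ∫ ω, urnNoise R C draw v n ω ^ 2 ∂μ = ∫ ω, ((C n ω ⬝ᵥ (R.mulVec v) ^ 2) / ((n : ℝ) + 1) -
      ((C n ω ⬝ᵥ R.mulVec v) / ((n : ℝ) + 1)) ^ 2) ∂μ := by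
  have := h.integral_draw n
    (fun x i => (R.mulVec v i - (x ⬝ᵥ R.mulVec v) / ((n : ℝ) + 1)) ^ 2)
  refine this.trans (integral_congr_ae (ae_of_all _ fun ω => ?_))
  have hn : (n : ℝ) + 1 ≠ 0 := by positivity
  simp only [smul_eq_mul]
  have hs := h.sum_eq hR hc₀ n ω
  set a := (C n ω ⬝ᵥ R.mulVec v) / ((n : ℝ) + 1) with ha
  have e : ∀ i, C n ω i / ((n : ℝ) + 1) * (R.mulVec v i - a) ^ 2 =
      C n ω i * (R.mulVec v i) ^ 2 / (n + 1) - 2 * a * (C n ω i * R.mulVec v i / (n + 1)) +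
        a ^ 2 * (C n ω i / (n + 1)) := fun i => by ring
  simp only [e, Finset.sum_add_distrib, Finset.sum_sub_distrib, ← Finset.mul_sum,
    ← Finset.sum_div, hs]
  rw [div_self hn]
  have e1 : ∑ i, C n ω i * R.mulVec v i = C n ω ⬝ᵥ R.mulVec v := rfl
  have e2 : ∑ i, C n ω i * R.mulVec v i ^ 2 = C n ω ⬝ᵥ (R.mulVec v) ^ 2 := rfl
  rw [e1, e2, ← ha]
  ring

end IsUrn

/-! ### Square integrable martingales -/

theorem eLpNorm_two_eq_ofReal_sqrt {Ω : Type*} [MeasurableSpace Ω] {μ : Measure Ω} {f : Ω → ℝ}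
    (hf : MemLp f 2 μ) : eLpNorm f 2 μ = ENNReal.ofReal √(∫ ω, f ω ^ 2 ∂μ) := by
  rw [hf.eLpNorm_eq_integral_rpow_norm two_ne_zero ENNReal.ofNat_ne_top, Real.sqrt_eq_rpow]
  simp

section Martingale

variable {Ω : Type*} [MeasurableSpace Ω] {μ : Measure Ω} [IsProbabilityMeasure μ]
  {ℱ : Filtration ℕ ‹MeasurableSpace Ω›} {f : ℕ → Ω → ℝ}

theorem MeasureTheory.Martingale.integral_sub_sq_succ (hf : Martingale f ℱ μ)
    (hL : ∀ n, MemLp (f n) 2 μ)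
    {n m : ℕ} (hnm : n ≤ m) :
    ∫ ω, (f (m + 1) ω - f n ω) ^ 2 ∂μ =
      ∫ ω, (f m ω - f n ω) ^ 2 ∂μ + ∫ ω, (f (m + 1) ω - f m ω) ^ 2 ∂μ := by
  have hX : MemLp (f m - f n) 2 μ := (hL m).sub (hL n)
  have hD : MemLp (f (m + 1) - f m) 2 μ := (hL (m + 1)).sub (hL m)
  have hXD : Integrable ((f m - f n) * (f (m + 1) - f m)) μ := hX.integrable_mul hD
  have hXm : StronglyMeasurable[ℱ m] (f m - f n) :=
    (hf.stronglyMeasurable m).sub ((hf.stronglyMeasurable n).mono (ℱ.mono hnm))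
  have hD0 : μ[f (m + 1) - f m | ℱ m] =ᵐ[μ] 0 := by
    refine (condExp_sub (hf.integrable _) (hf.integrable _) _).trans ?_
    have h1 := hf.condExp_ae_eq m.le_succ
    have h2 := hf.condExp_ae_eq (le_refl m)
    filter_upwards [h1, h2] with ω h1 h2
    simp [h1, h2]
  -- Martingale increments are orthogonal to everything known before them.
  have hcross : ∫ ω, ((f m - f n) * (f (m + 1) - f m)) ω ∂μ = 0 := by
    rw [← integral_condExp (ℱ.le m)]
    have := condExp_mul_of_stronglyMeasurable_left hXm hXD (hD.integrable one_le_two)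
    rw [integral_congr_ae (this.trans (hD0.mono fun ω hω => by
      rw [Pi.mul_apply, hω, Pi.zero_apply, mul_zero]))]
    exact integral_zero _ _
  have e : ∀ ω, (f (m + 1) ω - f n ω) ^ 2 = (f m ω - f n ω) ^ 2 + (f (m + 1) ω - f m ω) ^ 2 +
      2 * ((f m - f n) * (f (m + 1) - f m)) ω := fun ω => by
    simp only [Pi.mul_apply, Pi.sub_apply]; ring
  have i1 : Integrable (fun ω => (f m ω - f n ω) ^ 2) μ := hX.integrable_sq
  have i2 : Integrable (fun ω => (f (m + 1) ω - f m ω) ^ 2) μ := hD.integrable_sq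
  simp only [e]
  have i3 : Integrable (fun ω => (f m ω - f n ω) ^ 2 + (f (m + 1) ω - f m ω) ^ 2) μ := i1.add i2
  rw [integral_add i3 (hXD.const_mul 2), integral_add i1 i2, integral_const_mul, hcross,
    mul_zero, add_zero]

theorem MeasureTheory.Martingale.integral_sub_sq_le (hf : Martingale f ℱ μ)
    (hL : ∀ n, MemLp (f n) 2 μ)
    {v : ℕ → ℝ} (hfv : ∀ n, ∫ ω, (f (n + 1) ω - f n ω) ^ 2 ∂μ ≤ v n) (n k : ℕ) :
    ∫ ω, (f (n + k) ω - f n ω) ^ 2 ∂μ ≤ ∑ i ∈ Finset.range k, v (i + n) := by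
  induction k with
  | zero => simp
  | succ k ih =>
    rw [← add_assoc, hf.integral_sub_sq_succ hL (Nat.le_add_right n k), Finset.sum_range_succ]
    have := hfv (n + k)
    rw [add_comm k n]
    exact add_le_add ih this

/-- Orthogonality bounds `f` in `L²`, so it converges almost surely. Fatou's lemma for the norm then
bounds the distance to the limit by the tail of `∑ v`. -/
theorem MeasureTheory.Martingale.exists_tendstoAEAndL2 (hf : Martingale f ℱ μ)
    (hL : ∀ n, MemLp (f n) 2 μ)
    {v : ℕ → ℝ} (hv : Summable v) (hfv : ∀ n, ∫ ω, (f (n + 1) ω - f n ω) ^ 2 ∂μ ≤ v n) :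
    ∃ g : Ω → ℝ, Measurable g ∧ TendstoAEAndL2 μ f g := by
  have hv0 : ∀ n, 0 ≤ v n := fun n => (integral_nonneg fun ω => sq_nonneg _).trans (hfv n)
  have hbd : ∀ n k, eLpNorm (f (n + k) - f n) 2 μ ≤ ENNReal.ofReal √(∑' i, v (i + n)) := by
    intro n k
    rw [eLpNorm_two_eq_ofReal_sqrt ((hL _).sub (hL _))]
    refine ENNReal.ofReal_le_ofReal (Real.sqrt_le_sqrt ?_)
    refine (hf.integral_sub_sq_le hL hfv n k).trans ?_
    exact ((summable_nat_add_iff n).2 hv).sum_le_tsum _ fun i _ => hv0 _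
  set R : ENNReal := eLpNorm (f 0) 2 μ + ENNReal.ofReal √(∑' i, v (i + 0)) with hR
  have hRtop : R ≠ ⊤ := ENNReal.add_ne_top.2 ⟨(hL 0).eLpNorm_ne_top, ENNReal.ofReal_ne_top⟩
  have hbd2 : ∀ n, eLpNorm (f n) 2 μ ≤ R := by
    intro n
    have h1 := hbd 0 n
    rw [zero_add] at h1
    have h2 : f n = f 0 + (f n - f 0) := by abel
    rw [h2]
    exact (eLpNorm_add_le (hL 0).1 ((hL n).sub (hL 0)).1 one_le_two).trans (add_le_add_right h1 _)
  have hbd1 : ∀ n, eLpNorm (f n) 1 μ ≤ R.toNNReal := by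
    intro n
    rw [ENNReal.coe_toNNReal hRtop]
    exact (eLpNorm_le_eLpNorm_of_exponent_le one_le_two (hL n).1).trans (hbd2 n)
  have hbd2' : ∀ n, eLpNorm (f n) 2 μ ≤ R.toNNReal := by
    intro n
    rw [ENNReal.coe_toNNReal hRtop]
    exact hbd2 n
  obtain ⟨g, hgL, hae, hg⟩ :
      ∃ g, MemLp g 2 μ ∧ (∀ᵐ ω ∂μ, Tendsto (f · ω) atTop (𝓝 (g ω))) ∧ Measurable g :=
    ⟨_, hf.submartingale.memLp_limitProcess hbd2', hf.submartingale.ae_tendsto_limitProcess hbd1,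
      Filtration.stronglyMeasurable_limit_process'.measurable⟩
  refine ⟨g, hg, hL, hgL, hae, ?_⟩
  have htail : Tendsto (fun n => ENNReal.ofReal √(∑' i, v (i + n))) atTop (𝓝 0) := by
    have h1 := (tendsto_sum_nat_add v).sqrt
    rw [Real.sqrt_zero] at h1
    have h2 := (ENNReal.continuous_ofReal.tendsto 0).comp h1
    rw [ENNReal.ofReal_zero] at h2
    exact h2
  refine tendsto_of_tendsto_of_tendsto_of_le_of_le tendsto_const_nhds htail
    (fun n => zero_le) fun n => ?_
  have h1 := Lp.eLpNorm_lim_le_liminf_eLpNorm (f := fun m => f m - f n) (p := 2) (μ := μ)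
    (fun m => ((hL m).sub (hL n)).1) (g - f n) (hae.mono fun ω hω => by
      simpa using hω.sub_const (f n ω))
  have h2 : eLpNorm (fun ω => f n ω - g ω) 2 μ =
      eLpNorm (g - f n) 2 μ := eLpNorm_sub_comm _ _ _ _
  simp only
  rw [h2]
  refine h1.trans ?_
  refine liminf_le_of_frequently_le' (Eventually.frequently ?_)
  filter_upwards [eventually_ge_atTop n] with m hm
  obtain ⟨k, rfl⟩ := Nat.exists_eq_add_of_le hm
  exact hbd n k

/-- The martingale has mean zero and nondecreasing second moments, so its `L²` distance to any
constant is bounded below by `√δ > 0` after time `m`. A constant limit is thus impossible. -/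
theorem MeasureTheory.Martingale.isNondegenerate_of_tendsto (hf : Martingale f ℱ μ)
    (hL : ∀ n, MemLp (f n) 2 μ)
    (h0 : f 0 = 0) {m : ℕ} (hm : 0 < ∫ ω, (f (m + 1) ω - f m ω) ^ 2 ∂μ) {g : Ω → ℝ}
    (hg : TendstoAEAndL2 μ f g) : IsNondegenerate μ g := by
  rintro ⟨c, hc⟩
  set δ := ∫ ω, (f (m + 1) ω - f m ω) ^ 2 ∂μ with hδ
  have hsucc : ∀ n, ∫ ω, f (n + 1) ω ^ 2 ∂μ =
      ∫ ω, f n ω ^ 2 ∂μ + ∫ ω, (f (n + 1) ω - f n ω) ^ 2 ∂μ := by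
    intro n
    simpa [h0] using hf.integral_sub_sq_succ hL n.zero_le
  have hmono : ∀ k, δ ≤ ∫ ω, f (m + 1 + k) ω ^ 2 ∂μ := by
    intro k
    induction k with
    | zero =>
      rw [add_zero, hsucc]
      have : 0 ≤ ∫ ω, f m ω ^ 2 ∂μ := integral_nonneg fun ω => sq_nonneg _
      linarith
    | succ k ih =>
      rw [← add_assoc, hsucc]
      have : 0 ≤ ∫ ω, (f (m + 1 + k + 1) ω - f (m + 1 + k) ω) ^ 2 ∂μ :=
        integral_nonneg fun ω => sq_nonneg _
      linarith
  have hmean : ∀ n, ∫ ω, f n ω ∂μ = 0 := by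
    intro n
    have h1 := integral_condExp (μ := μ) (f := f n) (ℱ.le 0)
    rw [← h1, integral_congr_ae (hf.condExp_ae_eq n.zero_le), h0]
    simp
  have hlow : ∀ k, ENNReal.ofReal √δ ≤ eLpNorm (fun ω => f (k + (m + 1)) ω - g ω) 2 μ := by
    intro k
    have e : (fun ω => f (k + (m + 1)) ω - g ω) =ᵐ[μ] fun ω => f (k + (m + 1)) ω - c :=
      hc.mono fun ω hω => by simp only [hω]
    rw [eLpNorm_congr_ae e]
    have hk := hL (k + (m + 1))
    rw [eLpNorm_two_eq_ofReal_sqrt (f := fun ω => f (k + (m + 1)) ω - c)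
      (hk.sub (memLp_const c))]
    refine ENNReal.ofReal_le_ofReal (Real.sqrt_le_sqrt ?_)
    have e2 : ∀ ω, (f (k + (m + 1)) ω - c) ^ 2 =
        f (k + (m + 1)) ω ^ 2 - 2 * c * f (k + (m + 1)) ω + c ^ 2 := fun ω => by ring
    have i1 := hk.integrable_sq
    simp only [e2]
    have i2 : Integrable (fun ω => f (k + (m + 1)) ω ^ 2 - 2 * c * f (k + (m + 1)) ω) μ :=
      i1.sub ((hk.integrable one_le_two).const_mul _)
    rw [integral_add i2 (integrable_const _), integral_sub i1
      ((hk.integrable one_le_two).const_mul _), integral_const_mul, hmean]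
    have := hmono k
    rw [add_comm (m + 1) k] at this
    simp only [mul_zero, sub_zero, integral_const, probReal_univ, smul_eq_mul, one_mul]
    nlinarith [sq_nonneg c]
  have h1 := hg.2.2.2.comp (tendsto_add_atTop_nat (m + 1))
  have h2 := ge_of_tendsto' h1 hlow
  rw [nonpos_iff_eq_zero, ENNReal.ofReal_eq_zero] at h2
  have := Real.sqrt_pos.2 hm
  linarith

end Martingale

theorem TendstoAEAndL2.mul_of_tendsto {Ω : Type*} [MeasurableSpace Ω] {μ : Measure Ω}
    {X : ℕ → Ω → ℝ} {Y : Ω → ℝ} (h : TendstoAEAndL2 μ X Y) {c : ℕ → ℝ} {l : ℝ}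
    (hc : Tendsto c atTop (𝓝 l)) :
    TendstoAEAndL2 μ (fun n ω => c n * X n ω) (fun ω => l * Y ω) := by
  obtain ⟨h1, h2, h3, h4⟩ := h
  refine ⟨fun n => (h1 n).const_mul _, h2.const_mul _,
    h3.mono fun ω hω => hc.mul hω, ?_⟩
  have e : ∀ n, eLpNorm (fun ω => c n * X n ω - l * Y ω) 2 μ ≤
      ENNReal.ofReal |c n| * eLpNorm (fun ω => X n ω - Y ω) 2 μ +
        ENNReal.ofReal |c n - l| * eLpNorm Y 2 μ := by
    intro n
    have : (fun ω => c n * X n ω - l * Y ω) =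
        (c n • fun ω => X n ω - Y ω) + ((c n - l) • Y) := by
      ext ω; simp; ring
    rw [this]
    refine (eLpNorm_add_le (((h1 n).sub h2).const_smul _).1 (h2.const_smul _).1
      one_le_two).trans ?_
    rw [eLpNorm_const_smul, eLpNorm_const_smul, ← ofReal_norm, ← ofReal_norm]
    rfl
  refine tendsto_of_tendsto_of_tendsto_of_le_of_le tendsto_const_nhds ?_ (fun n => zero_le) e
  have l1 : Tendsto (fun n => ENNReal.ofReal |c n|) atTop (𝓝 (ENNReal.ofReal |l|)) :=
    (ENNReal.continuous_ofReal.tendsto _).comp hc.abs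
  have l2 : Tendsto (fun n => ENNReal.ofReal |c n - l|) atTop (𝓝 0) := by
    have := (ENNReal.continuous_ofReal.tendsto _).comp (hc.sub_const l).abs
    rw [sub_self, abs_zero, ENNReal.ofReal_zero] at this
    exact this
  have m1 := ENNReal.Tendsto.mul l1 (Or.inr ENNReal.zero_ne_top) h4
    (Or.inr ENNReal.ofReal_ne_top)
  have m2 := ENNReal.Tendsto.mul_const l2 (b := eLpNorm Y 2 μ) (Or.inr h2.eLpNorm_ne_top)
  simpa using m1.add m2

theorem integral_sum_urnNoise_sub_sq {Ω ι : Type*} [MeasurableSpace Ω] [Fintype ι] {μ : Measure Ω}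
    {R : Matrix ι ι ℝ} {C : ℕ → Ω → ι → ℝ} {draw : ℕ → Ω → ι} (w : ℕ → ℝ) (v : ι → ℝ) (n : ℕ) :
    ∫ ω, (∑ k ∈ Finset.range (n + 1), w k * urnNoise R C draw v k ω -
      ∑ k ∈ Finset.range n, w k * urnNoise R C draw v k ω) ^ 2 ∂μ =
    w n ^ 2 * ∫ ω, urnNoise R C draw v n ω ^ 2 ∂μ := by
  rw [← integral_const_mul]
  refine integral_congr_ae (ae_of_all _ fun ω => ?_)
  simp only [Finset.sum_range_succ, add_sub_cancel_left, mul_pow]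

/-! ### Martingales built from weighted urn noise -/

namespace IsUrn

variable {Ω ι : Type*} [MeasurableSpace Ω] [Fintype ι] {μ : Measure Ω} [IsProbabilityMeasure μ]
  {R : Matrix ι ι ℝ} {c₀ : ι → ℝ} {C : ℕ → Ω → ι → ℝ} {draw : ℕ → Ω → ι}

theorem memLp_sum_urnNoise (h : IsUrn μ R c₀ C draw) (v : ι → ℝ) (w : ℕ → ℝ) (n : ℕ) :
    MemLp (fun ω => ∑ k ∈ Finset.range n, w k * urnNoise R C draw v k ω) 2 μ :=
  memLp_finsetSum _ fun k _ => (h.memLp_urnNoise v k 2).const_mul _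

theorem martingale_sum_urnNoise [DecidableEq ι] (h : IsUrn μ R c₀ C draw)
    (hR : R ∈ Matrix.rowStochastic ℝ ι) (hc₀ : c₀ ∈ stdSimplex ℝ ι) (v : ι → ℝ) (w : ℕ → ℝ) :
    Martingale (fun n ω => ∑ k ∈ Finset.range n, w k * urnNoise R C draw v k ω)
      h.filtration μ := by
  refine martingale_of_condExp_sub_eq_zero_nat (fun n => ?_)
    (fun n => (h.memLp_sum_urnNoise v w n).integrable one_le_two) fun n => ?_
  · refine Finset.stronglyMeasurable_fun_sum _ fun k hk => ?_
    exact ((h.stronglyMeasurable_urnNoise v k).mono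
      (h.filtration.mono (Finset.mem_range.1 hk))).const_mul _
  · have e : (fun ω => ∑ k ∈ Finset.range (n + 1), w k * urnNoise R C draw v k ω) -
        (fun ω => ∑ k ∈ Finset.range n, w k * urnNoise R C draw v k ω) =
        w n • urnNoise R C draw v n := by
      ext ω; simp [Finset.sum_range_succ]
    rw [e]
    refine (condExp_smul (w n) _ _).trans ((h.condExp_urnNoise hR hc₀ v n).mono fun ω hω => ?_)
    rw [Pi.smul_apply, hω]; simp

theorem exists_sum_urnNoise_tendsto [DecidableEq ι] (h : IsUrn μ R c₀ C draw)
    (hR : R ∈ Matrix.rowStochastic ℝ ι) (hc₀ : c₀ ∈ stdSimplex ℝ ι) (v : ι → ℝ) (w : ℕ → ℝ)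
    {b : ℕ → ℝ} (hb : ∀ n, ∫ ω, urnNoise R C draw v n ω ^ 2 ∂μ ≤ b n)
    (hs : Summable fun n => w n ^ 2 * b n) :
    ∃ g : Ω → ℝ, Measurable g ∧ TendstoAEAndL2 μ
      (fun n ω => ∑ k ∈ Finset.range n, w k * urnNoise R C draw v k ω) g :=
  (h.martingale_sum_urnNoise hR hc₀ v w).exists_tendstoAEAndL2 (h.memLp_sum_urnNoise v w) hs
    fun n => by
      rw [integral_sum_urnNoise_sub_sq]
      exact mul_le_mul_of_nonneg_left (hb n) (sq_nonneg _)

end IsUrn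

/-! ### Urns with a dominated pair of colours -/

/-- The expectation of `F` under the law, after `n` draws, of the dominated pair of colours. -/
noncomputable def pairExpectation {E : Type*} [AddCommGroup E] [Module ℝ E] (s : ℝ)
    (Q : Matrix (Fin 2) (Fin 2) ℝ) (x₀ : Fin 2 → ℝ) : ℕ → ((Fin 2 → ℝ) → E) → E
  | 0, F => F x₀
  | n + 1, F => pairExpectation s Q x₀ n fun x =>
      (1 - (x ⬝ᵥ 1) / ((n : ℝ) + 1)) • F x + ∑ i, (x i / ((n : ℝ) + 1)) • F (x + s • Q i)

/-- The number of draws of a dominated colour among the first `n` draws. -/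
def dominatedCount {Ω κ : Type*} (draw : ℕ → Ω → Fin 2 ⊕ κ) (n : ℕ) (ω : Ω) : ℕ :=
  ∑ k ∈ Finset.range n, if (draw k ω).isLeft then 1 else 0

theorem dominatedCount_succ {Ω κ : Type*} (draw : ℕ → Ω → Fin 2 ⊕ κ) (n : ℕ) (ω : Ω) :
    dominatedCount draw (n + 1) ω =
      dominatedCount draw n ω + if (draw n ω).isLeft then 1 else 0 :=
  Finset.sum_range_succ _ _

theorem dotProduct_sumElim_zero {κ : Type*} [Fintype κ] (x : Fin 2 ⊕ κ → ℝ) (ζ : Fin 2 → ℝ) :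
    x ⬝ᵥ Sum.elim ζ 0 = (fun i => x (Sum.inl i)) ⬝ᵥ ζ := by
  simp [dotProduct]

/-- The zero block below `s • Q` is what lets eigenvectors of `Q` extend by zero; every functional
of the dominated pair used below is of this kind. -/
theorem fromBlocks_mulVec_sumElim {κ : Type*} [Fintype κ] {s : ℝ}
    {Q : Matrix (Fin 2) (Fin 2) ℝ} {E : Matrix (Fin 2) κ ℝ} {P : Matrix κ κ ℝ} {ν : ℝ}
    {ζ : Fin 2 → ℝ} (hζ : Q.mulVec ζ = ν • ζ) :
    (Matrix.fromBlocks (s • Q) E 0 P).mulVec (Sum.elim ζ 0) = (s * ν) • Sum.elim ζ 0 := by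
  rw [Matrix.fromBlocks_mulVec]
  ext (i | i)
  · simp [Matrix.smul_mulVec, hζ, mul_assoc]
  · simp

namespace IsUrn

variable {Ω κ : Type*} [MeasurableSpace Ω] [Fintype κ] {μ : Measure Ω}
  {s : ℝ} {Q : Matrix (Fin 2) (Fin 2) ℝ} {E : Matrix (Fin 2) κ ℝ} {P : Matrix κ κ ℝ}
  {c₀ : Fin 2 ⊕ κ → ℝ} {C : ℕ → Ω → Fin 2 ⊕ κ → ℝ} {draw : ℕ → Ω → Fin 2 ⊕ κ}

/-- Rows of `Q` sum to one, so each dominated draw adds exactly `s` to the dominated mass and each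
other draw adds nothing. The mass and the number of draws thus determine each other. -/
theorem dominated_eq (h : IsUrn μ (Matrix.fromBlocks (s • Q) E 0 P) c₀ C draw)
    (hQ : Q ∈ Matrix.rowStochastic ℝ (Fin 2)) (n : ℕ) (ω : Ω) :
    C n ω ⬝ᵥ Sum.elim 1 0 = c₀ ⬝ᵥ Sum.elim 1 0 + s * dominatedCount draw n ω := by
  have h1 : Q.mulVec 1 = (1 : ℝ) • 1 := by
    rw [Matrix.one_vecMul_of_mem_rowStochastic hQ, one_smul]
  induction n with
  | zero => rw [h.initial]; simp [dominatedCount]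
  | succ n ih =>
    rw [h.dotProduct_succ, ih, fromBlocks_mulVec_sumElim h1, dominatedCount_succ]
    rcases draw n ω with i | i <;> simp
    ring

theorem contents_inl_succ (h : IsUrn μ (Matrix.fromBlocks (s • Q) E 0 P) c₀ C draw)
    (n : ℕ) (ω : Ω) :
    (fun i => C (n + 1) ω (Sum.inl i)) = (fun i => C n ω (Sum.inl i)) +
      Sum.elim (fun i => s • Q i) (fun _ => 0) (draw n ω) := by
  ext i
  rw [h.step]
  rcases draw n ω with j | j <;> simp

/-- One step of the dominated pair of colours, in expectation. -/
theorem integral_dominated_succ [DecidableEq κ] [IsProbabilityMeasure μ]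
    (h : IsUrn μ (Matrix.fromBlocks (s • Q) E 0 P) c₀ C draw) (hs : s ≠ 0)
    (hQ : Q ∈ Matrix.rowStochastic ℝ (Fin 2))
    (hR : Matrix.fromBlocks (s • Q) E 0 P ∈ Matrix.rowStochastic ℝ (Fin 2 ⊕ κ))
    (hc₀ : c₀ ∈ stdSimplex ℝ (Fin 2 ⊕ κ)) {V : Type*} [NormedAddCommGroup V] [NormedSpace ℝ V]
    [CompleteSpace V] (n : ℕ) (F : ℕ → (Fin 2 → ℝ) → V) :
    ∫ ω, F (dominatedCount draw (n + 1) ω) (fun i => C (n + 1) ω (Sum.inl i)) ∂μ =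
      ∫ ω, ((1 - (C n ω ⬝ᵥ Sum.elim 1 0) / ((n : ℝ) + 1)) •
          F (dominatedCount draw n ω) (fun i => C n ω (Sum.inl i)) +
        ∑ i, (C n ω (Sum.inl i) / ((n : ℝ) + 1)) •
          F (dominatedCount draw n ω + 1) ((fun i => C n ω (Sum.inl i)) + s • Q i)) ∂μ := by
  -- The count is recovered from the contents, so that the integrand is a function of `C n` and
  -- `draw n` only and `integral_draw` applies.
  let k : (Fin 2 ⊕ κ → ℝ) → ℕ := fun x =>
    ⌊(x ⬝ᵥ Sum.elim 1 0 - c₀ ⬝ᵥ Sum.elim 1 0) / s⌋₊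
  have hk : ∀ ω, k (C n ω) = dominatedCount draw n ω := by
    intro ω
    simp only [k, h.dominated_eq hQ, add_sub_cancel_left, mul_div_cancel_left₀ _ hs,
      Nat.floor_natCast]
  let G : (Fin 2 ⊕ κ → ℝ) → Fin 2 ⊕ κ → V := fun x j =>
    F (k x + if j.isLeft then 1 else 0) ((fun i => x (Sum.inl i)) +
      Sum.elim (fun i => s • Q i) (fun _ => 0) j)
  have e : ∀ ω, F (dominatedCount draw (n + 1) ω) (fun i => C (n + 1) ω (Sum.inl i)) =
      G (C n ω) (draw n ω) := by
    intro ω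
    simp only [G, hk, h.contents_inl_succ, dominatedCount_succ]
  simp only [e]
  rw [h.integral_draw n G]
  refine integral_congr_ae (ae_of_all _ fun ω => ?_)
  have hn : (n : ℝ) + 1 ≠ 0 := by positivity
  have hsum := h.sum_eq hR hc₀ n ω
  rw [Fintype.sum_sum_type] at hsum
  have hdot : C n ω ⬝ᵥ Sum.elim 1 0 = ∑ i, C n ω (Sum.inl i) := by simp [dotProduct]
  have hp : 1 - (C n ω ⬝ᵥ Sum.elim 1 0) / ((n : ℝ) + 1) =
      ∑ i, C n ω (Sum.inr i) / ((n : ℝ) + 1) := by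
    rw [← Finset.sum_div, hdot, eq_div_iff hn, sub_mul, div_mul_cancel₀ _ hn]
    linarith
  simp only [Fintype.sum_sum_type, G, hk, Sum.isLeft_inl, Sum.isLeft_inr, Sum.elim_inl,
    Sum.elim_inr, if_true, hp, add_zero]
  rw [add_comm, Finset.sum_smul]
  simp only [Bool.false_eq_true, if_false, add_zero]

/-- The right-hand side does not mention `E` or `P`. This is what identifies the laws of the limits
in the three-colour and four-colour urns. -/
theorem integral_dominated_eq_pairExpectation [DecidableEq κ] [IsProbabilityMeasure μ]
    (h : IsUrn μ (Matrix.fromBlocks (s • Q) E 0 P) c₀ C draw) (hs : s ≠ 0)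
    (hQ : Q ∈ Matrix.rowStochastic ℝ (Fin 2))
    (hR : Matrix.fromBlocks (s • Q) E 0 P ∈ Matrix.rowStochastic ℝ (Fin 2 ⊕ κ))
    (hc₀ : c₀ ∈ stdSimplex ℝ (Fin 2 ⊕ κ)) {V : Type*} [NormedAddCommGroup V] [NormedSpace ℝ V]
    [CompleteSpace V] (n : ℕ) (F : (Fin 2 → ℝ) → V) :
    ∫ ω, F (fun i => C n ω (Sum.inl i)) ∂μ =
      pairExpectation s Q (fun i => c₀ (Sum.inl i)) n F := by
  induction n generalizing F with
  | zero => simp [h.initial, pairExpectation]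
  | succ n ih =>
    rw [pairExpectation, ← ih, h.integral_dominated_succ hs hQ hR hc₀ n fun _ x => F x]
    simp only [dotProduct_sumElim_zero]

theorem dominated_pos_of_pos
    (h : IsUrn μ (Matrix.fromBlocks (s • Q) E 0 P) c₀ C draw) (hs : 0 < s)
    (hQ : Q ∈ Matrix.rowStochastic ℝ (Fin 2)) (hpos : 0 < c₀ ⬝ᵥ Sum.elim 1 0) (n : ℕ) (ω : Ω) :
    0 < C n ω ⬝ᵥ Sum.elim 1 0 := by
  rw [h.dominated_eq hQ]
  positivity

theorem integral_dominated [DecidableEq κ] [IsProbabilityMeasure μ]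
    (h : IsUrn μ (Matrix.fromBlocks (s • Q) E 0 P) c₀ C draw)
    (hQ : Q ∈ Matrix.rowStochastic ℝ (Fin 2))
    (hR : Matrix.fromBlocks (s • Q) E 0 P ∈ Matrix.rowStochastic ℝ (Fin 2 ⊕ κ))
    (hc₀ : c₀ ∈ stdSimplex ℝ (Fin 2 ⊕ κ)) (n : ℕ) :
    ∫ ω, C n ω ⬝ᵥ Sum.elim 1 0 ∂μ =
      c₀ ⬝ᵥ Sum.elim 1 0 * ∏ j ∈ Finset.range n, (1 + s / (1 + (j : ℝ))) := by
  have h1 : Q.mulVec 1 = (1 : ℝ) • 1 := by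
    rw [Matrix.one_vecMul_of_mem_rowStochastic hQ, one_smul]
  induction n with
  | zero => simp [h.initial]
  | succ n ih =>
    have e : ∀ ω, C (n + 1) ω ⬝ᵥ Sum.elim 1 0 = (1 + s / (1 + n)) * (C n ω ⬝ᵥ Sum.elim 1 0) +
        urnNoise (Matrix.fromBlocks (s • Q) E 0 P) C draw (Sum.elim 1 0) n ω := by
      intro ω
      rw [h.dotProduct_succ_noise, fromBlocks_mulVec_sumElim h1, dotProduct_smul]
      simp only [smul_eq_mul]
      ring
    simp only [e]
    have i1 := h.integrable n fun x => x ⬝ᵥ Sum.elim 1 0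
    have i2 := (h.memLp_urnNoise (Sum.elim 1 0) n 1).integrable le_rfl
    have i3 : ∫ ω, urnNoise (Matrix.fromBlocks (s • Q) E 0 P) C draw (Sum.elim 1 0) n ω ∂μ = 0 := by
      rw [← integral_condExp (h.filtration.le n),
        integral_congr_ae (h.condExp_urnNoise hR hc₀ _ n)]
      simp
    rw [integral_add (i1.const_mul _) i2, i3, integral_const_mul, ih, Finset.prod_range_succ]
    ring

theorem integral_urnNoise_sq_le [DecidableEq κ] [IsProbabilityMeasure μ]
    (h : IsUrn μ (Matrix.fromBlocks (s • Q) E 0 P) c₀ C draw) (hs : 0 < s)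
    (hQ : Q ∈ Matrix.rowStochastic ℝ (Fin 2))
    (hR : Matrix.fromBlocks (s • Q) E 0 P ∈ Matrix.rowStochastic ℝ (Fin 2 ⊕ κ))
    (hc₀ : c₀ ∈ stdSimplex ℝ (Fin 2 ⊕ κ)) {ν : ℝ} {ζ : Fin 2 → ℝ} (hζ : Q.mulVec ζ = ν • ζ)
    (n : ℕ) :
    ∫ ω, urnNoise (Matrix.fromBlocks (s • Q) E 0 P) C draw (Sum.elim ζ 0) n ω ^ 2 ∂μ ≤
      (s * ν) ^ 2 * (ζ 0 ^ 2 + ζ 1 ^ 2) * (c₀ ⬝ᵥ Sum.elim 1 0) *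
        ((∏ j ∈ Finset.range (n + 1), (1 + s / (1 + (j : ℝ)))) / ((n : ℝ) + 1)) := by
  set K := (s * ν) ^ 2 * (ζ 0 ^ 2 + ζ 1 ^ 2) with hK
  have hK0 : 0 ≤ K := by positivity
  have hS0 : 0 ≤ c₀ ⬝ᵥ Sum.elim 1 0 := by
    simp only [dotProduct, Fintype.sum_sum_type, Fin.sum_univ_two, Sum.elim_inl, Sum.elim_inr,
      Pi.one_apply, Pi.zero_apply, mul_one, mul_zero, Finset.sum_const_zero, add_zero]
    exact add_nonneg (hc₀.1 _) (hc₀.1 _)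
  rw [h.integral_urnNoise_sq hR hc₀]
  have hle : ∫ ω, ((C n ω ⬝ᵥ ((Matrix.fromBlocks (s • Q) E 0 P).mulVec (Sum.elim ζ 0)) ^ 2) /
      ((n : ℝ) + 1) - ((C n ω ⬝ᵥ (Matrix.fromBlocks (s • Q) E 0 P).mulVec (Sum.elim ζ 0)) /
      ((n : ℝ) + 1)) ^ 2) ∂μ ≤ ∫ ω, K / ((n : ℝ) + 1) * (C n ω ⬝ᵥ Sum.elim 1 0) ∂μ := by
    refine integral_mono (h.integrable n fun x =>
      ((x ⬝ᵥ ((Matrix.fromBlocks (s • Q) E 0 P).mulVec (Sum.elim ζ 0)) ^ 2) / ((n : ℝ) + 1) -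
      ((x ⬝ᵥ (Matrix.fromBlocks (s • Q) E 0 P).mulVec (Sum.elim ζ 0)) / ((n : ℝ) + 1)) ^ 2))
      ((h.integrable n fun x => x ⬝ᵥ Sum.elim 1 0).const_mul _) fun ω => ?_
    have hW := h.nonneg hR hc₀ n ω (Sum.inl 0)
    have hB := h.nonneg hR hc₀ n ω (Sum.inl 1)
    -- Only dominated colours contribute to the noise, so its conditional variance is bounded by a
    -- multiple of the dominated mass over `n + 1`, and the mean of that mass is explicit.
    have e1 : C n ω ⬝ᵥ ((Matrix.fromBlocks (s • Q) E 0 P).mulVec (Sum.elim ζ 0)) ^ 2 ≤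
        K * (C n ω ⬝ᵥ Sum.elim 1 0) := by
      rw [fromBlocks_mulVec_sumElim hζ]
      simp only [dotProduct, Fintype.sum_sum_type, Fin.sum_univ_two, Pi.pow_apply, Pi.smul_apply,
        Sum.elim_inl, Sum.elim_inr, Pi.zero_apply, smul_eq_mul, mul_zero, Finset.sum_const_zero,
        add_zero, Pi.one_apply, mul_one, ne_eq, OfNat.ofNat_ne_zero, not_false_eq_true, zero_pow,
        hK]
      have q1 := mul_nonneg hW (mul_nonneg (sq_nonneg (s * ν)) (sq_nonneg (ζ 1)))
      have q2 := mul_nonneg hB (mul_nonneg (sq_nonneg (s * ν)) (sq_nonneg (ζ 0)))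
      nlinarith
    have hn : (0 : ℝ) < (n : ℝ) + 1 := by positivity
    simp only
    rw [div_mul_eq_mul_div]
    refine (sub_le_self _ (sq_nonneg _)).trans ?_
    gcongr
  refine hle.trans ?_
  rw [integral_const_mul, h.integral_dominated hQ hR hc₀, Finset.prod_range_succ]
  have hp : 0 ≤ ∏ j ∈ Finset.range n, (1 + s / (1 + (j : ℝ))) :=
    Finset.prod_nonneg fun j _ => by positivity
  -- The product is lengthened by one factor, at least one, to match the index in
  -- `summable_urnGrowth`.
  have h1 : 1 ≤ 1 + s / (1 + (n : ℝ)) := le_add_of_nonneg_right (by positivity)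
  calc K / ((n : ℝ) + 1) * (c₀ ⬝ᵥ Sum.elim 1 0 * ∏ j ∈ Finset.range n, (1 + s / (1 + (j : ℝ))))
      = K * (c₀ ⬝ᵥ Sum.elim 1 0) *
        (((∏ j ∈ Finset.range n, (1 + s / (1 + (j : ℝ)))) * 1) / ((n : ℝ) + 1)) := by ring
    _ ≤ _ := by gcongr

end IsUrn

/-- The normalisation `∏ (1 + c / (j + 1))` over `j < n`, which is of order `n ^ c`. -/
noncomputable def urnGrowth (c : ℝ) (n : ℕ) : ℝ :=
  ∏ j ∈ Finset.range n, (1 + c / (1 + (j : ℝ)))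

theorem urnGrowth_succ (c : ℝ) (n : ℕ) :
    urnGrowth c (n + 1) = urnGrowth c n * (1 + c / (1 + (n : ℝ))) :=
  Finset.prod_range_succ _ _

theorem urnGrowth_pos {c : ℝ} (hc : -1 < c) (n : ℕ) : 0 < urnGrowth c n := by
  refine Finset.prod_pos fun j _ => ?_
  have hj : (0 : ℝ) < 1 + j := by positivity
  have : 0 < (1 + (j : ℝ) + c) / (1 + j) := by
    refine div_pos ?_ hj
    have : (0 : ℝ) ≤ j := j.cast_nonneg
    linarith
  rwa [add_div, div_self hj.ne'] at this

theorem tendsto_urnGrowth_div_rpow {c : ℝ} (hc : -1 < c) :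
    Tendsto (fun n : ℕ => urnGrowth c n / (n : ℝ) ^ c) atTop (𝓝 (Real.Gamma (1 + c))⁻¹) := by
  have := tendsto_prod_one_add_div_div_rpow (x := 1) (h := c) one_pos (by linarith)
  rwa [Real.Gamma_one, one_div] at this

/-- The terms are of order `n ^ (s - 1 - 2 * c)`. With `c = s * ν` the condition says `ν > 1 / 2`;
with `c = s` it always holds. -/
theorem summable_urnGrowth {s c : ℝ} (hs : 0 < s) (hc : s < 2 * c) (K : ℝ) :
    Summable fun n : ℕ => (1 / urnGrowth c (n + 1)) ^ 2 *
      (K * (urnGrowth s (n + 1) / ((n : ℝ) + 1))) := by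
  have hc0 : 0 < c := by linarith
  have key : Summable fun n : ℕ => (1 / urnGrowth c n) ^ 2 * (K * (urnGrowth s n / (n : ℝ))) := by
    refine summable_of_isBigO_nat (Real.summable_nat_rpow.2 (by linarith : s - 1 - 2 * c < -1)) ?_
    have h1 := tendsto_urnGrowth_div_rpow (show -1 < s by linarith)
    have h2 := tendsto_urnGrowth_div_rpow (show -1 < c by linarith)
    have hΓ : (Real.Gamma (1 + c))⁻¹ ≠ 0 := inv_ne_zero (Real.Gamma_pos_of_pos (by linarith)).ne'
    have h3 := (h1.mul ((h2.inv₀ hΓ).pow 2)).const_mul K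
    refine Asymptotics.isBigO_of_div_tendsto_nhds ?_ _ (h3.congr' ?_)
    · filter_upwards [eventually_gt_atTop 0] with n hn h0
      exact absurd h0 (Real.rpow_pos_of_pos (by exact_mod_cast hn) _).ne'
    · filter_upwards [eventually_gt_atTop 0] with n hn
      have hn' : (0 : ℝ) < n := by exact_mod_cast hn
      have g1 := urnGrowth_pos (show -1 < c by linarith) n
      have g2 := Real.rpow_pos_of_pos hn' s
      have g3 := Real.rpow_pos_of_pos hn' c
      have e : (n : ℝ) ^ (s - 1 - 2 * c) = (n : ℝ) ^ s / n / ((n : ℝ) ^ c) ^ 2 := by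
        rw [Real.rpow_sub hn', Real.rpow_sub hn', Real.rpow_one, mul_comm 2 c,
          Real.rpow_mul hn'.le, Real.rpow_two]
      simp only [Pi.div_apply]
      rw [e]
      field_simp
  have := (summable_nat_add_iff 1).2 key
  push_cast at this
  exact this

theorem TendstoAEAndL2.const_add {Ω : Type*} [MeasurableSpace Ω] {μ : Measure Ω}
    [IsFiniteMeasure μ] {X : ℕ → Ω → ℝ} {Y : Ω → ℝ} (h : TendstoAEAndL2 μ X Y) (c : ℝ) :
    TendstoAEAndL2 μ (fun n ω => c + X n ω) (fun ω => c + Y ω) := by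
  obtain ⟨h1, h2, h3, h4⟩ := h
  refine ⟨fun n => (memLp_const c).add (h1 n), (memLp_const c).add h2,
    h3.mono fun ω hω => hω.const_add c, ?_⟩
  simpa only [add_sub_add_left_eq_sub] using h4

theorem IsNondegenerate.const_add {Ω : Type*} [MeasurableSpace Ω] {μ : Measure Ω} {Y : Ω → ℝ}
    (h : IsNondegenerate μ Y) (c : ℝ) : IsNondegenerate μ fun ω => c + Y ω := by
  rintro ⟨d, hd⟩
  exact h ⟨d - c, hd.mono fun ω hω => by linarith⟩

theorem IsNondegenerate.const_mul {Ω : Type*} [MeasurableSpace Ω] {μ : Measure Ω} {Y : Ω → ℝ}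
    (h : IsNondegenerate μ Y) {c : ℝ} (hc : c ≠ 0) : IsNondegenerate μ fun ω => c * Y ω := by
  rintro ⟨d, hd⟩
  refine h ⟨d / c, hd.mono fun ω hω => ?_⟩
  rw [eq_div_iff hc, mul_comm]; exact hω

/-! ### Almost sure and square-mean limits of eigenvector functionals -/

namespace IsUrn

variable {Ω κ : Type*} [MeasurableSpace Ω] [Fintype κ] {μ : Measure Ω}
  {s : ℝ} {Q : Matrix (Fin 2) (Fin 2) ℝ} {E : Matrix (Fin 2) κ ℝ} {P : Matrix κ κ ℝ}
  {c₀ : Fin 2 ⊕ κ → ℝ} {C : ℕ → Ω → Fin 2 ⊕ κ → ℝ} {draw : ℕ → Ω → Fin 2 ⊕ κ}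

theorem dotProduct_succ_eigenvector (h : IsUrn μ (Matrix.fromBlocks (s • Q) E 0 P) c₀ C draw)
    {ν : ℝ} {ζ : Fin 2 → ℝ} (hζ : Q.mulVec ζ = ν • ζ) (n : ℕ) (ω : Ω) :
    C (n + 1) ω ⬝ᵥ Sum.elim ζ 0 = C n ω ⬝ᵥ Sum.elim ζ 0 * (1 + s * ν / (1 + (n : ℝ))) +
      urnNoise (Matrix.fromBlocks (s • Q) E 0 P) C draw (Sum.elim ζ 0) n ω := by
  rw [h.dotProduct_succ_noise, fromBlocks_mulVec_sumElim hζ, dotProduct_smul]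
  simp only [smul_eq_mul]
  ring

/-- Dividing the linear recursion by its accumulated factors leaves only the weighted noise. The
condition `-1 < s * ν` keeps all factors positive. -/
theorem dotProduct_div_urnGrowth (h : IsUrn μ (Matrix.fromBlocks (s • Q) E 0 P) c₀ C draw)
    {ν : ℝ} {ζ : Fin 2 → ℝ} (hζ : Q.mulVec ζ = ν • ζ) (hν : -1 < s * ν) (n : ℕ) (ω : Ω) :
    C n ω ⬝ᵥ Sum.elim ζ 0 / urnGrowth (s * ν) n = c₀ ⬝ᵥ Sum.elim ζ 0 +
      ∑ k ∈ Finset.range n, 1 / urnGrowth (s * ν) (k + 1) *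
        urnNoise (Matrix.fromBlocks (s • Q) E 0 P) C draw (Sum.elim ζ 0) k ω := by
  induction n with
  | zero => simp [h.initial, urnGrowth]
  | succ n ih =>
    rw [Finset.sum_range_succ, ← add_assoc, ← ih, h.dotProduct_succ_eigenvector hζ]
    have g1 := urnGrowth_pos hν n
    have g2 := urnGrowth_pos hν (n + 1)
    have g3 : 1 + s * ν / (1 + (n : ℝ)) ≠ 0 := by
      rw [urnGrowth_succ] at g2
      exact (pos_of_mul_pos_right g2 g1.le).ne'
    rw [urnGrowth_succ, add_div, mul_div_mul_right _ _ g3]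
    ring

theorem dominated_one_le (h : IsUrn μ (Matrix.fromBlocks (s • Q) E 0 P) c₀ C draw) [DecidableEq κ]
    (hs : 0 < s) (hQ : Q ∈ Matrix.rowStochastic ℝ (Fin 2)) (hc₀ : c₀ ∈ stdSimplex ℝ (Fin 2 ⊕ κ))
    (ω : Ω) : c₀ ⬝ᵥ Sum.elim 1 0 ≤ C 1 ω ⬝ᵥ Sum.elim 1 0 ∧ C 1 ω ⬝ᵥ Sum.elim 1 0 ≤ 1 + s := by
  have h1 : c₀ ⬝ᵥ Sum.elim 1 0 ≤ 1 := by
    rw [← hc₀.2, dotProduct]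
    refine Finset.sum_le_sum fun i _ => ?_
    rcases i with i | i
    · simp
    · simpa using hc₀.1 (Sum.inr i)
  rw [h.dominated_eq hQ, dominatedCount_succ]
  have h2 : ((dominatedCount draw 0 ω + if (draw 0 ω).isLeft then 1 else 0 : ℕ) : ℝ) ≤ 1 := by
    simp only [dominatedCount, Finset.range_zero, Finset.sum_empty, zero_add]
    split_ifs <;> simp
  have h3 : (0 : ℝ) ≤ ((dominatedCount draw 0 ω + if (draw 0 ω).isLeft then 1 else 0 : ℕ) : ℝ) :=
    Nat.cast_nonneg _
  constructor <;> nlinarith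

/-- Step `1` is used because step `0` may carry no noise: if the urn starts without dominant colours
and `ζ = 1`, the first draw is irrelevant. After one draw the dominated mass is at most `1 + s < 2`,
so the other colours are present. With `A = W * ζ 0 ^ 2 + B * ζ 1 ^ 2`, Cauchy-Schwarz gives
variance at least `(s * ν) ^ 2 * (A / 2 - (1 + s) * A / 4)`, whence the factor `(1 - s) / 4`. -/
theorem integral_urnNoise_one_sq_pos [DecidableEq κ] [IsProbabilityMeasure μ]
    (h : IsUrn μ (Matrix.fromBlocks (s • Q) E 0 P) c₀ C draw) (hs : 0 < s) (hs1 : s < 1)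
    (hQ : Q ∈ Matrix.rowStochastic ℝ (Fin 2))
    (hR : Matrix.fromBlocks (s • Q) E 0 P ∈ Matrix.rowStochastic ℝ (Fin 2 ⊕ κ))
    (hc₀ : c₀ ∈ stdSimplex ℝ (Fin 2 ⊕ κ)) (hpos : 0 < c₀ ⬝ᵥ Sum.elim 1 0)
    {ν : ℝ} {ζ : Fin 2 → ℝ} (hζ : Q.mulVec ζ = ν • ζ) (hν : ν ≠ 0) (h0 : ζ 0 ≠ 0) (h1 : ζ 1 ≠ 0) :
    0 < ∫ ω, urnNoise (Matrix.fromBlocks (s • Q) E 0 P) C draw (Sum.elim ζ 0) 1 ω ^ 2 ∂μ := by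
  rw [h.integral_urnNoise_sq hR hc₀]
  set m := min (ζ 0 ^ 2) (ζ 1 ^ 2) with hm
  have hm0 : 0 < m := lt_min (by positivity) (by positivity)
  set δ := (s * ν) ^ 2 * (m * (c₀ ⬝ᵥ Sum.elim 1 0) * (1 - s) / 4) with hδ
  have hδ0 : 0 < δ := by
    have : 0 < 1 - s := by linarith
    have : 0 < (s * ν) ^ 2 := by positivity
    positivity
  have hle : ∫ _, δ ∂μ ≤ ∫ ω, ((C 1 ω ⬝ᵥ ((Matrix.fromBlocks (s • Q) E 0 P).mulVec
      (Sum.elim ζ 0)) ^ 2) / (((1 : ℕ) : ℝ) + 1) -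
      ((C 1 ω ⬝ᵥ (Matrix.fromBlocks (s • Q) E 0 P).mulVec (Sum.elim ζ 0)) /
      (((1 : ℕ) : ℝ) + 1)) ^ 2) ∂μ := by
    refine integral_mono (integrable_const _) (h.integrable 1 fun x =>
      ((x ⬝ᵥ ((Matrix.fromBlocks (s • Q) E 0 P).mulVec (Sum.elim ζ 0)) ^ 2) /
        (((1 : ℕ) : ℝ) + 1) -
      ((x ⬝ᵥ (Matrix.fromBlocks (s • Q) E 0 P).mulVec (Sum.elim ζ 0)) /
        (((1 : ℕ) : ℝ) + 1)) ^ 2)) fun ω => ?_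
    have hW := h.nonneg hR hc₀ 1 ω (Sum.inl 0)
    have hB := h.nonneg hR hc₀ 1 ω (Sum.inl 1)
    obtain ⟨hS1, hS2⟩ := h.dominated_one_le hs hQ hc₀ ω
    rw [fromBlocks_mulVec_sumElim hζ]
    have eS : C 1 ω ⬝ᵥ Sum.elim 1 0 = C 1 ω (Sum.inl 0) + C 1 ω (Sum.inl 1) := by
      simp [dotProduct]
    rw [eS] at hS1 hS2
    have e1 : C 1 ω ⬝ᵥ ((s * ν) • Sum.elim ζ (0 : κ → ℝ)) ^ 2 =
        (s * ν) ^ 2 * (C 1 ω (Sum.inl 0) * ζ 0 ^ 2 + C 1 ω (Sum.inl 1) * ζ 1 ^ 2) := by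
      simp [dotProduct]; ring
    have e2 : C 1 ω ⬝ᵥ ((s * ν) • Sum.elim ζ (0 : κ → ℝ)) =
        (s * ν) * (C 1 ω (Sum.inl 0) * ζ 0 + C 1 ω (Sum.inl 1) * ζ 1) := by
      simp [dotProduct]; ring
    simp only
    rw [e1, e2, hδ]
    generalize C 1 ω (Sum.inl 0) = W at *
    generalize C 1 ω (Sum.inl 1) = B at *
    generalize c₀ ⬝ᵥ Sum.elim 1 0 = S₀ at *
    have m0 : m ≤ ζ 0 ^ 2 := min_le_left _ _
    have m1 : m ≤ ζ 1 ^ 2 := min_le_right _ _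
    set A := W * ζ 0 ^ 2 + B * ζ 1 ^ 2 with hA
    have hAm : m * (W + B) ≤ A := by
      have := mul_le_mul_of_nonneg_left m0 hW
      have := mul_le_mul_of_nonneg_left m1 hB
      linarith
    have hA0 : m * S₀ ≤ A := (mul_le_mul_of_nonneg_left hS1 hm0.le).trans hAm
    have hcs : (W * ζ 0 + B * ζ 1) ^ 2 ≤ (W + B) * A := by
      have := mul_nonneg (mul_nonneg hW hB) (sq_nonneg (ζ 0 - ζ 1))
      rw [hA]; nlinarith
    have hAS : (W + B) * A ≤ (1 + s) * A :=
      mul_le_mul_of_nonneg_right hS2 ((mul_pos hm0 hpos).le.trans hA0)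
    have hA1 : m * S₀ * (1 - s) ≤ A * (1 - s) := mul_le_mul_of_nonneg_right hA0 (by linarith)
    have e3 : (s * ν) ^ 2 * A / (((1 : ℕ) : ℝ) + 1) -
        (s * ν * (W * ζ 0 + B * ζ 1) / (((1 : ℕ) : ℝ) + 1)) ^ 2 =
        (s * ν) ^ 2 * (A / 2 - (W * ζ 0 + B * ζ 1) ^ 2 / 4) := by push_cast; ring
    rw [e3]
    refine mul_le_mul_of_nonneg_left ?_ (sq_nonneg _)
    linarith
  rw [integral_const, probReal_univ, one_smul] at hle
  exact hδ0.trans_le hle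

theorem exists_tendsto_div_urnGrowth [DecidableEq κ] [IsProbabilityMeasure μ]
    (h : IsUrn μ (Matrix.fromBlocks (s • Q) E 0 P) c₀ C draw) (hs : 0 < s) (hs1 : s < 1)
    (hQ : Q ∈ Matrix.rowStochastic ℝ (Fin 2))
    (hR : Matrix.fromBlocks (s • Q) E 0 P ∈ Matrix.rowStochastic ℝ (Fin 2 ⊕ κ))
    (hc₀ : c₀ ∈ stdSimplex ℝ (Fin 2 ⊕ κ)) (hpos : 0 < c₀ ⬝ᵥ Sum.elim 1 0)
    {ν : ℝ} {ζ : Fin 2 → ℝ} (hζ : Q.mulVec ζ = ν • ζ) (hν : 1 / 2 < ν) :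
    ∃ g : Ω → ℝ, Measurable g ∧
      TendstoAEAndL2 μ (fun n ω => C n ω ⬝ᵥ Sum.elim ζ 0 / urnGrowth (s * ν) n) g ∧
      (ζ 0 ≠ 0 → ζ 1 ≠ 0 → IsNondegenerate μ g) := by
  have hsν : -1 < s * ν := by nlinarith
  obtain ⟨g, hg, hlim⟩ := h.exists_sum_urnNoise_tendsto hR hc₀ (Sum.elim ζ 0)
    (fun n => 1 / urnGrowth (s * ν) (n + 1)) (h.integral_urnNoise_sq_le hs hQ hR hc₀ hζ)
    (summable_urnGrowth hs (by nlinarith) _)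
  refine ⟨fun ω => c₀ ⬝ᵥ Sum.elim ζ 0 + g ω, hg.const_add _, ?_, fun h0 h1 => ?_⟩
  · simp only [h.dotProduct_div_urnGrowth hζ hsν]
    exact hlim.const_add _
  · refine IsNondegenerate.const_add ?_ _
    refine (h.martingale_sum_urnNoise hR hc₀ (Sum.elim ζ 0) _).isNondegenerate_of_tendsto
      (h.memLp_sum_urnNoise _ _) (by ext ω; simp) (m := 1) ?_ hlim
    rw [integral_sum_urnNoise_sub_sq]
    refine mul_pos ?_ (h.integral_urnNoise_one_sq_pos hs hs1 hQ hR hc₀ hpos hζ (by linarith) h0 h1)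
    have := urnGrowth_pos hsν (1 + 1)
    positivity

theorem exists_tendsto_div_rpow [DecidableEq κ] [IsProbabilityMeasure μ]
    (h : IsUrn μ (Matrix.fromBlocks (s • Q) E 0 P) c₀ C draw) (hs : 0 < s) (hs1 : s < 1)
    (hQ : Q ∈ Matrix.rowStochastic ℝ (Fin 2))
    (hR : Matrix.fromBlocks (s • Q) E 0 P ∈ Matrix.rowStochastic ℝ (Fin 2 ⊕ κ))
    (hc₀ : c₀ ∈ stdSimplex ℝ (Fin 2 ⊕ κ)) (hpos : 0 < c₀ ⬝ᵥ Sum.elim 1 0)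
    {ν : ℝ} {ζ : Fin 2 → ℝ} (hζ : Q.mulVec ζ = ν • ζ) (hν : 1 / 2 < ν) :
    ∃ g : Ω → ℝ, Measurable g ∧
      TendstoAEAndL2 μ (fun n ω => C n ω ⬝ᵥ Sum.elim ζ 0 / (n : ℝ) ^ (s * ν)) g ∧
      TendstoAEAndL2 μ (fun n ω => C n ω ⬝ᵥ Sum.elim ζ 0 / ((n : ℝ) + 1) ^ (s * ν)) g ∧
      (ζ 0 ≠ 0 → ζ 1 ≠ 0 → IsNondegenerate μ g) := by
  obtain ⟨g, hg, hlim, hnd⟩ := h.exists_tendsto_div_urnGrowth hs hs1 hQ hR hc₀ hpos hζ hν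
  have hsν : -1 < s * ν := by nlinarith
  have hsν0 : 0 < s * ν := by nlinarith
  have hΓ := Real.Gamma_pos_of_pos (show 0 < 1 + s * ν by linarith)
  have hgr := tendsto_urnGrowth_div_rpow hsν
  refine ⟨fun ω => (Real.Gamma (1 + s * ν))⁻¹ * g ω, hg.const_mul _, ?_, ?_,
    fun h0 h1 => (hnd h0 h1).const_mul (inv_ne_zero hΓ.ne')⟩
  · have := hlim.mul_of_tendsto hgr
    refine (congrArg (fun X => TendstoAEAndL2 μ X _) ?_).mp this
    funext n ω
    have := (urnGrowth_pos hsν n).ne'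
    field_simp
  · have hgr1 : Tendsto (fun n : ℕ => urnGrowth (s * ν) n / ((n : ℝ) + 1) ^ (s * ν)) atTop
        (𝓝 (Real.Gamma (1 + s * ν))⁻¹) := by
      have h1 := (tendsto_nat_div_add 1).rpow_const (p := s * ν) (Or.inr hsν0.le)
      rw [Real.one_rpow] at h1
      have h2 := hgr.mul h1
      rw [mul_one] at h2
      refine h2.congr' ?_
      filter_upwards [eventually_gt_atTop 0] with n hn
      have hn' : (0 : ℝ) < n := by exact_mod_cast hn
      have := Real.rpow_pos_of_pos hn' (s * ν)
      rw [Real.div_rpow hn'.le (by positivity)]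
      field_simp
    have := hlim.mul_of_tendsto hgr1
    refine (congrArg (fun X => TendstoAEAndL2 μ X _) ?_).mp this
    funext n ω
    have := (urnGrowth_pos hsν n).ne'
    field_simp

/-- Normalising by `urnGrowth s`, rather than `urnGrowth (s * ν)`, makes the noise series converge
for every `ν`, and leaves a drift contracting at rate `s * (1 - ν) / n`. No comparison of `ν` with
`1 / 2` is needed. -/
theorem ae_tendsto_eigenvector_div_rpow [DecidableEq κ] [IsProbabilityMeasure μ]
    (h : IsUrn μ (Matrix.fromBlocks (s • Q) E 0 P) c₀ C draw) (hs : 0 < s)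
    (hQ : Q ∈ Matrix.rowStochastic ℝ (Fin 2))
    (hR : Matrix.fromBlocks (s • Q) E 0 P ∈ Matrix.rowStochastic ℝ (Fin 2 ⊕ κ))
    (hc₀ : c₀ ∈ stdSimplex ℝ (Fin 2 ⊕ κ))
    {ν : ℝ} {ζ : Fin 2 → ℝ} (hζ : Q.mulVec ζ = ν • ζ) (hν : ν < 1) :
    ∀ᵐ ω ∂μ, Tendsto (fun n : ℕ => C n ω ⬝ᵥ Sum.elim ζ 0 / (n : ℝ) ^ s) atTop (𝓝 0) := by
  have hs' : -1 < s := by linarith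
  obtain ⟨g, -, hlim⟩ := h.exists_sum_urnNoise_tendsto hR hc₀ (Sum.elim ζ 0)
    (fun n => 1 / urnGrowth s (n + 1)) (h.integral_urnNoise_sq_le hs hQ hR hc₀ hζ)
    (summable_urnGrowth hs (by linarith) _)
  filter_upwards [hlim.2.2.1] with ω hω
  have hy : Tendsto (fun n => C n ω ⬝ᵥ Sum.elim ζ 0 / urnGrowth s n) atTop (𝓝 0) := by
    refine tendsto_zero_of_contraction_add_convergent (a := s * (1 - ν))
      (c := fun n => s * (1 - ν) / (n + (1 + s))) (ε := fun _ => 0)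
      (mul_pos hs (by linarith)) ?_ tendsto_const_nhds hω fun n => ?_
    · have := (tendsto_add_div_nat_add (1 + s) 1).const_mul (s * (1 - ν))
      rw [mul_one] at this
      refine this.congr fun n => ?_
      ring
    · rw [h.dotProduct_succ_eigenvector hζ, urnGrowth_succ]
      have g1 := urnGrowth_pos hs' n
      have hn : (0 : ℝ) < 1 + n := by positivity
      have hn2 : (0 : ℝ) < n + (1 + s) := by positivity
      have hn3 : (0 : ℝ) < 1 + n + s := by positivity
      field_simp
      ring
  have := hy.mul (tendsto_urnGrowth_div_rpow hs')
  rw [zero_mul] at this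
  refine this.congr fun n => ?_
  have := (urnGrowth_pos hs' n).ne'
  field_simp

end IsUrn

theorem exists_pos_forall_le_of_tendsto {u : ℕ → ℝ} {l : ℝ} (hu : ∀ n, 0 < u n) (hl : 0 < l)
    (h : Tendsto u atTop (𝓝 l)) : ∃ c, 0 < c ∧ ∀ n, c ≤ u n := by
  obtain ⟨N, hN⟩ := eventually_atTop.1 (h.eventually (lt_mem_nhds (half_lt_self hl)))
  obtain ⟨m, -, hm⟩ := Finset.exists_min_image (Finset.range (N + 1)) u ⟨0, by simp⟩
  refine ⟨min (u m) (l / 2), lt_min (hu m) (by positivity), fun n => ?_⟩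
  rcases lt_or_ge n (N + 1) with hn | hn
  · exact (min_le_left _ _).trans (hm n (Finset.mem_range.2 hn))
  · exact (min_le_right _ _).trans (hN n (by omega)).le

/-! ### Positivity of the limit, and behaviour on the linear scale -/

namespace IsUrn

variable {Ω κ : Type*} [MeasurableSpace Ω] [Fintype κ] {μ : Measure Ω}
  {s : ℝ} {Q : Matrix (Fin 2) (Fin 2) ℝ} {E : Matrix (Fin 2) κ ℝ} {P : Matrix κ κ ℝ}
  {c₀ : Fin 2 ⊕ κ → ℝ} {C : ℕ → Ω → Fin 2 ⊕ κ → ℝ} {draw : ℕ → Ω → Fin 2 ⊕ κ}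

/-- Negative moments of the number of dominated draws, in product form. -/
theorem integral_prod_dominatedCount [DecidableEq κ] [IsProbabilityMeasure μ]
    (h : IsUrn μ (Matrix.fromBlocks (s • Q) E 0 P) c₀ C draw) (hs : 0 < s)
    (hQ : Q ∈ Matrix.rowStochastic ℝ (Fin 2))
    (hR : Matrix.fromBlocks (s • Q) E 0 P ∈ Matrix.rowStochastic ℝ (Fin 2 ⊕ κ))
    (hc₀ : c₀ ∈ stdSimplex ℝ (Fin 2 ⊕ κ)) (hpos : 0 < c₀ ⬝ᵥ Sum.elim 1 0) (a : ℝ) (n : ℕ) :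
    ∫ ω, ∏ j ∈ Finset.range (dominatedCount draw n ω),
      (1 + -a / (c₀ ⬝ᵥ Sum.elim 1 0 / s + (j : ℝ))) ∂μ = urnGrowth (-(s * a)) n := by
  set x₀ := c₀ ⬝ᵥ Sum.elim 1 0 / s with hx₀
  set f : ℕ → ℝ := fun k => ∏ j ∈ Finset.range k, (1 + -a / (x₀ + (j : ℝ))) with hf
  change ∫ ω, f (dominatedCount draw n ω) ∂μ = _
  induction n with
  | zero => simp [dominatedCount, hf, urnGrowth]
  | succ n ih =>
    rw [h.integral_dominated_succ hs.ne' hQ hR hc₀ n fun k _ => f k, urnGrowth_succ, ← ih,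
      ← integral_mul_const]
    refine integral_congr_ae (ae_of_all _ fun ω => ?_)
    have hx0 : 0 < x₀ := div_pos hpos hs
    -- Given `k` dominated draws, the next draw is dominated with probability `s * (x₀ + k) / (n +
    -- 1)`. The denominator `x₀ + k` of the new factor of `f` cancels, so the mean is multiplied by
    -- the deterministic factor `1 - s * a / (n + 1)`.
    have hfs : f (dominatedCount draw n ω + 1) = f (dominatedCount draw n ω) *
        (1 + -a / (x₀ + dominatedCount draw n ω)) := Finset.prod_range_succ _ _
    have hS : C n ω ⬝ᵥ Sum.elim 1 0 = s * (x₀ + dominatedCount draw n ω) := by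
      rw [h.dominated_eq hQ, mul_add, hx₀, mul_div_cancel₀ _ hs.ne']
    have hS2 : ∑ i : Fin 2, C n ω (Sum.inl i) = C n ω ⬝ᵥ Sum.elim 1 0 := by simp [dotProduct]
    simp only [smul_eq_mul]
    rw [← Finset.sum_mul, ← Finset.sum_div, hS2, hS, hfs]
    have hk : 0 < x₀ + dominatedCount draw n ω := by positivity
    have hn : (0 : ℝ) < 1 + n := by positivity
    have hn' : (0 : ℝ) < n + 1 := by positivity
    field_simp
    ring

/-- The ratios `G n` have mean one, and up to a constant they dominate `((K n + 1) / n ^ s) ^ (-a)`,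
with `K n` the dominated count. Where `U = 0` they tend to infinity, whereas Fatou's lemma makes
their lower limit finite almost everywhere. -/
theorem ae_pos_of_tendsto [DecidableEq κ] [IsProbabilityMeasure μ]
    (h : IsUrn μ (Matrix.fromBlocks (s • Q) E 0 P) c₀ C draw) (hs : 0 < s)
    (hQ : Q ∈ Matrix.rowStochastic ℝ (Fin 2))
    (hR : Matrix.fromBlocks (s • Q) E 0 P ∈ Matrix.rowStochastic ℝ (Fin 2 ⊕ κ))
    (hc₀ : c₀ ∈ stdSimplex ℝ (Fin 2 ⊕ κ)) (hpos : 0 < c₀ ⬝ᵥ Sum.elim 1 0) {U : Ω → ℝ}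
    (hU : ∀ᵐ ω ∂μ, Tendsto (fun n : ℕ => C n ω ⬝ᵥ Sum.elim 1 0 / (n : ℝ) ^ s) atTop (𝓝 (U ω))) :
    ∀ᵐ ω ∂μ, 0 < U ω := by
  set x₀ := c₀ ⬝ᵥ Sum.elim 1 0 / s with hx₀
  have hx0 : 0 < x₀ := div_pos hpos hs
  -- `a < x₀` makes the factors of `f` positive, and `a < 1 / s` makes the normalisation `urnGrowth
  -- (-(s * a))` positive.
  obtain ⟨a, ha0, ha⟩ : ∃ a, 0 < a ∧ a < min x₀ (1 / s) :=
    exists_between (lt_min hx0 (by positivity))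
  have hax : a < x₀ := ha.trans_le (min_le_left _ _)
  have has : s * a < 1 := by
    have := ha.trans_le (min_le_right _ _)
    rwa [lt_div_iff₀ hs, mul_comm] at this
  set f : ℕ → ℝ := fun k => ∏ j ∈ Finset.range k, (1 + -a / (x₀ + (j : ℝ))) with hf
  have hfac : ∀ j : ℕ, 0 < 1 + -a / (x₀ + (j : ℝ)) := fun j => by
    have hj : (0 : ℝ) < x₀ + j := by positivity
    have : a / (x₀ + j) < 1 := by
      rw [div_lt_one hj]
      have : (0 : ℝ) ≤ j := j.cast_nonneg
      linarith
    rw [neg_div]; linarith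
  have hf0 : ∀ k, 0 < f k := fun k => Finset.prod_pos fun j _ => hfac j
  obtain ⟨c, hc0, hc⟩ : ∃ c, 0 < c ∧ ∀ k : ℕ, c ≤ f (k + 1) / ((k : ℝ) + 1) ^ (-a) := by
    refine exists_pos_forall_le_of_tendsto
      (fun k => div_pos (hf0 _) (Real.rpow_pos_of_pos (by positivity) _)) ?_
      (l := Real.Gamma x₀ / Real.Gamma (x₀ + -a)) ?_
    · exact div_pos (Real.Gamma_pos_of_pos hx0) (Real.Gamma_pos_of_pos (by linarith))
    · have := (tendsto_prod_one_add_div_div_rpow hx0 (show 0 < x₀ + -a by linarith)).comp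
        (tendsto_add_atTop_nat 1)
      refine this.congr fun k => ?_
      simp only [Function.comp_apply, hf]
      push_cast
      rfl
  have hlow : ∀ k : ℕ, c * ((k : ℝ) + 1) ^ (-a) ≤ f k := by
    intro k
    have h1 := hc k
    rw [le_div_iff₀ (Real.rpow_pos_of_pos (by positivity) _)] at h1
    refine h1.trans ?_
    have : f (k + 1) = f k * (1 + -a / (x₀ + k)) := Finset.prod_range_succ _ _
    rw [this]
    refine mul_le_of_le_one_right (hf0 k).le ?_
    have : 0 ≤ a / (x₀ + k) := by positivity
    rw [neg_div]; linarith
  have hg0 : ∀ n, 0 < urnGrowth (-(s * a)) n := urnGrowth_pos (by linarith)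
  set G : ℕ → Ω → ℝ := fun n ω => f (dominatedCount draw n ω) / urnGrowth (-(s * a)) n with hG
  have hGm : ∀ n, StronglyMeasurable (G n) := by
    intro n
    have h1 := h.stronglyMeasurable n fun x =>
      f ⌊(x ⬝ᵥ Sum.elim 1 0 - c₀ ⬝ᵥ Sum.elim 1 0) / s⌋₊ / urnGrowth (-(s * a)) n
    simpa only [h.dominated_eq hQ, add_sub_cancel_left, mul_div_cancel_left₀ _ hs.ne',
      Nat.floor_natCast] using h1
  have hGi : ∀ n, Integrable (G n) μ := by
    intro n
    have h1 := h.integrable (μ := μ) n fun x =>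
      f ⌊(x ⬝ᵥ Sum.elim 1 0 - c₀ ⬝ᵥ Sum.elim 1 0) / s⌋₊ / urnGrowth (-(s * a)) n
    simpa only [h.dominated_eq hQ, add_sub_cancel_left, mul_div_cancel_left₀ _ hs.ne',
      Nat.floor_natCast] using h1
  have hG1 : ∀ n, ∫⁻ ω, ENNReal.ofReal (G n ω) ∂μ = 1 := by
    intro n
    rw [← ofReal_integral_eq_lintegral_ofReal (hGi n)
      (ae_of_all _ fun ω => (div_pos (hf0 _) (hg0 n)).le)]
    simp only [hG]
    rw [integral_div, hf, h.integral_prod_dominatedCount hs hQ hR hc₀ hpos a n,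
      div_self (hg0 n).ne', ENNReal.ofReal_one]
  have hfatou : ∫⁻ ω, liminf (fun n => ENNReal.ofReal (G n ω)) atTop ∂μ ≤ 1 := by
    refine (lintegral_liminf_le fun n => (hGm n).measurable.ennreal_ofReal).trans ?_
    simp only [hG1, liminf_const, le_refl]
  have hfin : ∀ᵐ ω ∂μ, liminf (fun n => ENNReal.ofReal (G n ω)) atTop < ⊤ :=
    ae_lt_top (Measurable.liminf fun n => (hGm n).measurable.ennreal_ofReal)
      (hfatou.trans_lt ENNReal.one_lt_top).ne
  filter_upwards [hU, hfin] with ω hω hlt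
  have hge : 0 ≤ U ω := ge_of_tendsto' hω fun n =>
    div_nonneg (h.dominated_pos_of_pos hs hQ hpos n ω).le (by positivity)
  rcases hge.lt_or_eq with h0 | h0
  · exact h0
  exfalso
  refine hlt.ne ?_
  refine Tendsto.liminf_eq ?_
  refine ENNReal.tendsto_ofReal_atTop.comp ?_
  rw [← h0] at hω
  have hns : Tendsto (fun n : ℕ => (n : ℝ) ^ s) atTop atTop :=
    (tendsto_rpow_atTop hs).comp tendsto_natCast_atTop_atTop
  have hr : Tendsto (fun n : ℕ => ((dominatedCount draw n ω : ℝ) + 1) / (n : ℝ) ^ s) atTop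
      (𝓝 0) := by
    have h1 := (hω.div_const s).add ((tendsto_const_nhds (x := 1 - x₀)).div_atTop hns)
    rw [zero_div, zero_add] at h1
    refine h1.congr fun n => ?_
    rw [h.dominated_eq hQ, hx₀]
    field_simp
    ring
  have hr' : Tendsto (fun n : ℕ => ((dominatedCount draw n ω : ℝ) + 1) / (n : ℝ) ^ s) atTop
      (𝓝[>] 0) := by
    refine tendsto_nhdsWithin_iff.2 ⟨hr, ?_⟩
    filter_upwards [eventually_gt_atTop 0] with n hn
    have : 0 < (n : ℝ) ^ s := Real.rpow_pos_of_pos (by exact_mod_cast hn) _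
    exact div_pos (by positivity) this
  have h2 := (tendsto_rpow_neg_nhdsGT_zero (neg_lt_zero.2 ha0)).comp hr'
  have hgr := (tendsto_urnGrowth_div_rpow (show -1 < -(s * a) by linarith)).inv₀
    (inv_ne_zero (Real.Gamma_pos_of_pos (by linarith)).ne')
  rw [inv_inv] at hgr
  have h3 := (h2.atTop_mul_pos (Real.Gamma_pos_of_pos (by linarith)) hgr).const_mul_atTop hc0
  refine tendsto_atTop_mono' _ ?_ h3
  filter_upwards [eventually_gt_atTop 0] with n hn
  have hn' : (0 : ℝ) < n := by exact_mod_cast hn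
  have q1 := Real.rpow_pos_of_pos hn' (-(s * a))
  have q2 := hg0 n
  have q3 := hlow (dominatedCount draw n ω)
  simp only [Function.comp_apply, hG]
  rw [Real.div_rpow (by positivity) (by positivity), ← Real.rpow_mul hn'.le, inv_div,
    show s * -a = -(s * a) by ring]
  rw [le_div_iff₀ q2]
  refine le_trans (le_of_eq ?_) q3
  generalize urnGrowth (-(s * a)) n = v at *
  generalize (n : ℝ) ^ (-(s * a)) = w at *
  field_simp

theorem ae_tendsto_dominated_div {U : Ω → ℝ} (hs1 : s < 1)
    (hU : ∀ᵐ ω ∂μ, Tendsto (fun n : ℕ => C n ω ⬝ᵥ Sum.elim 1 0 / (n : ℝ) ^ s) atTop (𝓝 (U ω))) :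
    ∀ᵐ ω ∂μ, Tendsto (fun n : ℕ => C n ω ⬝ᵥ Sum.elim 1 0 / (n : ℝ)) atTop (𝓝 0) := by
  filter_upwards [hU] with ω hω
  have h1 := hω.mul ((tendsto_rpow_neg_atTop (sub_pos.2 hs1)).comp tendsto_natCast_atTop_atTop)
  rw [mul_zero] at h1
  refine h1.congr' ?_
  filter_upwards [eventually_gt_atTop 0] with n hn
  have hn' : (0 : ℝ) < n := by exact_mod_cast hn
  have q1 := Real.rpow_pos_of_pos hn' s
  simp only [Function.comp_apply]
  rw [neg_sub, Real.rpow_sub hn', Real.rpow_one]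
  field_simp

/-- Linear functionals of the dominant colours given by a non-principal eigenvector vanish on
the linear scale. -/
theorem ae_tendsto_dominant_eigenvector_div [DecidableEq κ] [IsProbabilityMeasure μ]
    (h : IsUrn μ (Matrix.fromBlocks (s • Q) E 0 P) c₀ C draw)
    (hR : Matrix.fromBlocks (s • Q) E 0 P ∈ Matrix.rowStochastic ℝ (Fin 2 ⊕ κ))
    (hc₀ : c₀ ∈ stdSimplex ℝ (Fin 2 ⊕ κ))
    (hS : ∀ᵐ ω ∂μ, Tendsto (fun n : ℕ => C n ω ⬝ᵥ Sum.elim 1 0 / (n : ℝ)) atTop (𝓝 0))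
    {ρ : ℝ} {η : κ → ℝ} (hη : P.mulVec η = ρ • η) (hρ : ρ < 1) :
    ∀ᵐ ω ∂μ, Tendsto (fun n : ℕ => C n ω ⬝ᵥ Sum.elim 0 η / (n : ℝ)) atTop (𝓝 0) := by
  set R := Matrix.fromBlocks (s • Q) E 0 P with hRdef
  -- Extension by zero of an eigenvector of `P` is not an eigenvector of `R`: the block `E` feeds
  -- mass in from the dominated colours. This inflow is controlled by the dominated mass, which is
  -- `o(n)` by `hS`.
  have hRv : R.mulVec (Sum.elim 0 η) = ρ • Sum.elim (0 : Fin 2 → ℝ) η + Sum.elim (E.mulVec η) 0 := by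
    rw [hRdef, Matrix.fromBlocks_mulVec]
    ext (i | i)
    · simp
    · simp [hη]
  obtain ⟨K, hK⟩ : ∃ K, ∀ i, (R.mulVec (Sum.elim 0 η) i) ^ 2 ≤ K := by
    obtain ⟨K, hK⟩ := (Set.finite_range fun i => (R.mulVec (Sum.elim 0 η) i) ^ 2).bddAbove
    exact ⟨K, fun i => hK ⟨i, rfl⟩⟩
  have hb : ∀ n, ∫ ω, urnNoise R C draw (Sum.elim 0 η) n ω ^ 2 ∂μ ≤ K := by
    intro n
    rw [h.integral_urnNoise_sq hR hc₀]
    have hle : ∀ ω, (C n ω ⬝ᵥ (R.mulVec (Sum.elim 0 η)) ^ 2) / ((n : ℝ) + 1) -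
        ((C n ω ⬝ᵥ R.mulVec (Sum.elim 0 η)) / ((n : ℝ) + 1)) ^ 2 ≤ K := by
      intro ω
      refine (sub_le_self _ (sq_nonneg _)).trans ?_
      rw [div_le_iff₀ (by positivity), ← h.sum_eq hR hc₀ n ω, Finset.mul_sum]
      refine Finset.sum_le_sum fun i _ => ?_
      rw [mul_comm]
      exact mul_le_mul_of_nonneg_right (hK i) (h.nonneg hR hc₀ n ω i)
    have := integral_mono (h.integrable (μ := μ) n fun x =>
      (x ⬝ᵥ (R.mulVec (Sum.elim 0 η)) ^ 2) / ((n : ℝ) + 1) -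
        ((x ⬝ᵥ R.mulVec (Sum.elim 0 η)) / ((n : ℝ) + 1)) ^ 2) (integrable_const K) hle
    simpa using this
  have hsum : Summable fun n : ℕ => (1 / ((n : ℝ) + 2)) ^ 2 * K := by
    refine Summable.mul_right _ ?_
    have := (summable_nat_add_iff 2).2 (Real.summable_one_div_nat_pow.2 (one_lt_two))
    push_cast at this
    simpa only [div_pow, one_pow] using this
  obtain ⟨g, -, hlim⟩ := h.exists_sum_urnNoise_tendsto hR hc₀ (Sum.elim 0 η)
    (fun n => 1 / ((n : ℝ) + 2)) hb hsum
  filter_upwards [hlim.2.2.1, hS] with ω hω hSω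
  have hE : Tendsto (fun n : ℕ => C n ω ⬝ᵥ Sum.elim (E.mulVec η) 0 / ((n : ℝ) + 1)) atTop
      (𝓝 0) := by
    set L := |E.mulVec η 0| + |E.mulVec η 1| with hL
    have h1 := (hSω.mul (tendsto_nat_div_add 1)).const_mul L
    rw [zero_mul, mul_zero] at h1
    refine squeeze_zero_norm' ?_ h1
    filter_upwards [eventually_gt_atTop 0] with n hn
    have hn' : (0 : ℝ) < n := by exact_mod_cast hn
    have hW := h.nonneg hR hc₀ n ω (Sum.inl 0)
    have hB := h.nonneg hR hc₀ n ω (Sum.inl 1)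
    have e : |C n ω ⬝ᵥ Sum.elim (E.mulVec η) 0| ≤ L * (C n ω ⬝ᵥ Sum.elim 1 0) := by
      rw [dotProduct_sumElim_zero, dotProduct_sumElim_zero]
      simp only [dotProduct, Fin.sum_univ_two, Pi.one_apply, mul_one]
      refine (abs_add_le _ _).trans ?_
      rw [abs_mul, abs_mul, abs_of_nonneg hW, abs_of_nonneg hB, hL]
      have := mul_nonneg hW (abs_nonneg (E.mulVec η 1))
      have := mul_nonneg hB (abs_nonneg (E.mulVec η 0))
      nlinarith
    rw [Real.norm_eq_abs, abs_div, abs_of_pos (by positivity : (0 : ℝ) < n + 1)]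
    rw [div_mul_div_cancel₀ hn'.ne', mul_div_assoc']
    gcongr
  have hρ' : 0 < 1 - ρ := by linarith
  -- The new normaliser is `n + 2`, whence the noise weights `1 / (n + 2)` and the contraction rate
  -- `(1 - ρ) / (n + 2)`; the inflow from `E` takes the role of the vanishing forcing.
  have hy : Tendsto (fun n : ℕ => C n ω ⬝ᵥ Sum.elim 0 η / ((n : ℝ) + 1)) atTop (𝓝 0) := by
    refine tendsto_zero_of_contraction_add_convergent (a := 1 - ρ)
      (c := fun n => (1 - ρ) / (n + 2))
      (ε := fun n => (C n ω ⬝ᵥ Sum.elim (E.mulVec η) 0 / ((n : ℝ) + 1)) / (1 - ρ))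
      hρ' ?_ ?_ hω fun n => ?_
    · have := (tendsto_add_div_nat_add 2 1).const_mul (1 - ρ)
      rw [mul_one] at this
      refine this.congr fun n => ?_
      ring
    · simpa using hE.div_const (1 - ρ)
    · rw [h.dotProduct_succ_noise, hRv, dotProduct_add, dotProduct_smul]
      push_cast
      have hn : (0 : ℝ) < n + 1 := by positivity
      have hn2 : (0 : ℝ) < n + 2 := by positivity
      have hn3 : (n : ℝ) + 1 + 1 = n + 2 := by ring
      rw [hn3, smul_eq_mul]
      field_simp
      ring
  have := hy.mul (tendsto_add_div_nat_add 0 1)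
  rw [zero_mul] at this
  refine this.congr fun n => ?_
  have hn : (0 : ℝ) < n + 1 := by positivity
  rw [add_zero]
  field_simp

end IsUrn

/-! ### The embedded two-colour urn -/

/-- The expectation of `F` under the law of the dominated pair of colours after `k` draws of
dominated colours. -/
noncomputable def embeddedExpectation {V : Type*} [AddCommGroup V] [Module ℝ V] (s : ℝ)
    (Q : Matrix (Fin 2) (Fin 2) ℝ) (x₀ : Fin 2 → ℝ) : ℕ → ((Fin 2 → ℝ) → V) → V
  | 0, F => F x₀
  | k + 1, F => embeddedExpectation s Q x₀ k fun x =>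
      ∑ i, (x i / (x ⬝ᵥ 1)) • F (x + s • Q i)

section Embedded

variable {s : ℝ} {Q : Matrix (Fin 2) (Fin 2) ℝ} {x₀ : Fin 2 → ℝ}

theorem embeddedExpectation_add {V : Type*} [AddCommGroup V] [Module ℝ V] (k : ℕ)
    (F G : (Fin 2 → ℝ) → V) :
    embeddedExpectation s Q x₀ k (fun x => F x + G x) =
      embeddedExpectation s Q x₀ k F + embeddedExpectation s Q x₀ k G := by
  induction k generalizing F G with
  | zero => rfl
  | succ k ih => simp only [embeddedExpectation, smul_add, Finset.sum_add_distrib, ih]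

theorem embeddedExpectation_map {V W : Type*} [AddCommGroup V] [Module ℝ V] [AddCommGroup W]
    [Module ℝ W] (A : V →ₗ[ℝ] W) (k : ℕ) (F : (Fin 2 → ℝ) → V) :
    embeddedExpectation s Q x₀ k (fun x => A (F x)) = A (embeddedExpectation s Q x₀ k F) := by
  induction k generalizing F with
  | zero => rfl
  | succ k ih => simp only [embeddedExpectation, ← ih, map_sum, map_smul]

theorem embeddedExpectation_smul {V : Type*} [AddCommGroup V] [Module ℝ V] (k : ℕ) (c : ℝ)
    (F : (Fin 2 → ℝ) → V) :
    embeddedExpectation s Q x₀ k (fun x => c • F x) = c • embeddedExpectation s Q x₀ k F :=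
  embeddedExpectation_map (LinearMap.lsmul ℝ V c) k F

theorem embeddedExpectation_sub {V : Type*} [AddCommGroup V] [Module ℝ V] (k : ℕ)
    (F G : (Fin 2 → ℝ) → V) :
    embeddedExpectation s Q x₀ k (fun x => F x - G x) =
      embeddedExpectation s Q x₀ k F - embeddedExpectation s Q x₀ k G := by
  induction k generalizing F G with
  | zero => rfl
  | succ k ih => simp only [embeddedExpectation, smul_sub, Finset.sum_sub_distrib, ih]

/-- The hypothesis is only required on reachable states: nonnegative contents whose total is `x₀ ⬝ᵥ
1 + s * k`. Under this restriction the total may be treated as a constant inside the expectation. -/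
theorem norm_embeddedExpectation_le {V : Type*} [NormedAddCommGroup V] [NormedSpace ℝ V]
    (hs : 0 < s) (hQ : Q ∈ Matrix.rowStochastic ℝ (Fin 2)) (hx₀ : ∀ i, 0 ≤ x₀ i) (k : ℕ)
    {F : (Fin 2 → ℝ) → V} {G : (Fin 2 → ℝ) → ℝ}
    (h : ∀ x : Fin 2 → ℝ, (∀ i, 0 ≤ x i) → x ⬝ᵥ 1 = x₀ ⬝ᵥ 1 + s * k → ‖F x‖ ≤ G x) :
    ‖embeddedExpectation s Q x₀ k F‖ ≤ embeddedExpectation s Q x₀ k G := by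
  induction k generalizing F G with
  | zero => exact h x₀ hx₀ (by simp)
  | succ k ih =>
    refine ih fun x hx hxk => ?_
    have h1 : 0 ≤ x ⬝ᵥ 1 := Finset.sum_nonneg fun i _ => by simpa using hx i
    refine (norm_sum_le _ _).trans (Finset.sum_le_sum fun i _ => ?_)
    rw [norm_smul, smul_eq_mul, Real.norm_of_nonneg (div_nonneg (hx i) h1)]
    refine mul_le_mul_of_nonneg_left (h _ (fun j => ?_) ?_) (div_nonneg (hx i) h1)
    · exact add_nonneg (hx j) (mul_nonneg hs.le (Matrix.nonneg_of_mem_rowStochastic hQ))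
    · have : Q i ⬝ᵥ 1 = 1 := by
        simpa [dotProduct] using Matrix.sum_row_of_mem_rowStochastic hQ i
      rw [add_dotProduct, smul_dotProduct, this, hxk]
      push_cast
      simp only [smul_eq_mul]; ring

theorem embeddedExpectation_congr {V : Type*} [NormedAddCommGroup V] [NormedSpace ℝ V]
    (hs : 0 < s) (hQ : Q ∈ Matrix.rowStochastic ℝ (Fin 2)) (hx₀ : ∀ i, 0 ≤ x₀ i) (k : ℕ)
    {F G : (Fin 2 → ℝ) → V}
    (h : ∀ x : Fin 2 → ℝ, (∀ i, 0 ≤ x i) → x ⬝ᵥ 1 = x₀ ⬝ᵥ 1 + s * k → F x = G x) :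
    embeddedExpectation s Q x₀ k F = embeddedExpectation s Q x₀ k G := by
  rw [← sub_eq_zero, ← embeddedExpectation_sub, ← norm_le_zero_iff]
  -- The zero bound is written as a scalar multiple so that homogeneity alone evaluates its
  -- expectation; the evaluation of constants rests on the present lemma.
  refine (norm_embeddedExpectation_le hs hQ hx₀ k (G := fun _ => (0 : ℝ) • (0 : ℝ))
    fun x hx hxk => ?_).trans (le_of_eq ?_)
  · simp [h x hx hxk]
  · rw [embeddedExpectation_smul, zero_smul]

theorem embeddedExpectation_mono
    (hs : 0 < s) (hQ : Q ∈ Matrix.rowStochastic ℝ (Fin 2)) (hx₀ : ∀ i, 0 ≤ x₀ i) (k : ℕ)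
    {F G : (Fin 2 → ℝ) → ℝ}
    (h : ∀ x : Fin 2 → ℝ, (∀ i, 0 ≤ x i) → x ⬝ᵥ 1 = x₀ ⬝ᵥ 1 + s * k → F x ≤ G x) :
    embeddedExpectation s Q x₀ k F ≤ embeddedExpectation s Q x₀ k G := by
  rw [← sub_nonneg, ← embeddedExpectation_sub]
  refine (norm_nonneg _).trans (norm_embeddedExpectation_le hs hQ hx₀ k
    (F := fun x => G x - F x) fun x hx hxk => ?_)
  rw [Real.norm_of_nonneg (sub_nonneg.2 (h x hx hxk))]

theorem sum_div_dotProduct_one {x : Fin 2 → ℝ} (hx : x ⬝ᵥ 1 ≠ 0) :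
    ∑ i, x i / (x ⬝ᵥ 1) = 1 := by
  rw [← Finset.sum_div, div_eq_one_iff_eq hx]
  simp [dotProduct]

theorem embeddedExpectation_const {V : Type*} [NormedAddCommGroup V] [NormedSpace ℝ V]
    (hs : 0 < s) (hQ : Q ∈ Matrix.rowStochastic ℝ (Fin 2)) (hx₀ : ∀ i, 0 ≤ x₀ i)
    (hpos : 0 < x₀ ⬝ᵥ 1) (k : ℕ) (c : V) :
    embeddedExpectation s Q x₀ k (fun _ => c) = c := by
  induction k with
  | zero => rfl
  | succ k ih =>
    rw [embeddedExpectation]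
    conv_rhs => rw [← ih]
    refine embeddedExpectation_congr hs hQ hx₀ k fun x hx hxk => ?_
    have : x ⬝ᵥ 1 ≠ 0 := by rw [hxk]; positivity
    rw [← Finset.sum_smul, sum_div_dotProduct_one this, one_smul]

theorem add_smul_dotProduct_eigenvector {lam : ℝ} {ξ : Fin 2 → ℝ} (hξ : Q.mulVec ξ = lam • ξ)
    (x : Fin 2 → ℝ) (i : Fin 2) : (x + s • Q i) ⬝ᵥ ξ = x ⬝ᵥ ξ + s * lam * ξ i := by
  have : Q i ⬝ᵥ ξ = lam * ξ i := congrFun hξ i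
  rw [add_dotProduct, smul_dotProduct, this, smul_eq_mul, mul_assoc]

/-- The second moment of `x ⬝ᵥ ξ` in the embedded urn is negligible on the quadratic scale. -/
theorem tendsto_embedded_second_moment (hs : 0 < s) (hQ : Q ∈ Matrix.rowStochastic ℝ (Fin 2))
    (hx₀ : ∀ i, 0 ≤ x₀ i) (hpos : 0 < x₀ ⬝ᵥ 1) {lam : ℝ} {ξ : Fin 2 → ℝ}
    (hξ : Q.mulVec ξ = lam • ξ) (hlam : lam ≤ 1 / 2) :
    Tendsto (fun k : ℕ => embeddedExpectation s Q x₀ k (fun x => (x ⬝ᵥ ξ / (x ⬝ᵥ 1)) ^ 2)) atTop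
      (𝓝 0) := by
  set τ : ℕ → ℝ := fun k => embeddedExpectation s Q x₀ k (fun x => (x ⬝ᵥ ξ) ^ 2) with hτ
  have hτ0 : ∀ k, 0 ≤ τ k := fun k => by
    have := embeddedExpectation_mono hs hQ hx₀ k (F := fun _ => (0 : ℝ))
      (G := fun x => (x ⬝ᵥ ξ) ^ 2) fun x _ _ => sq_nonneg _
    rwa [embeddedExpectation_const hs hQ hx₀ hpos] at this
  have he : ∀ k : ℕ, embeddedExpectation s Q x₀ k (fun x => (x ⬝ᵥ ξ / (x ⬝ᵥ 1)) ^ 2) =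
      τ k / (x₀ ⬝ᵥ 1 + s * k) ^ 2 := by
    intro k
    rw [div_eq_inv_mul, hτ, ← smul_eq_mul, ← embeddedExpectation_smul]
    refine embeddedExpectation_congr hs hQ hx₀ k fun x hx hxk => ?_
    rw [hxk, div_pow, smul_eq_mul, div_eq_inv_mul]
  set K := (s * lam) ^ 2 * (ξ 0 ^ 2 + ξ 1 ^ 2) with hK
  -- The exact drift factor is `1 + 2 * s * lam / S`, at most `1 + s / S` since `lam ≤ 1 / 2`. After
  -- division by the square of the total, which grows by `s`, what remains is a contraction by `S /
  -- (S + s)`.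
  have hstep : ∀ k : ℕ, τ (k + 1) ≤ (1 + s / (x₀ ⬝ᵥ 1 + s * k)) * τ k + K := by
    intro k
    have h1 : (1 + s / (x₀ ⬝ᵥ 1 + s * k)) * τ k + K = embeddedExpectation s Q x₀ k
        (fun x => (1 + s / (x₀ ⬝ᵥ 1 + s * k)) • (x ⬝ᵥ ξ) ^ 2 + K) := by
      rw [embeddedExpectation_add, embeddedExpectation_smul,
        embeddedExpectation_const hs hQ hx₀ hpos, smul_eq_mul]
    rw [h1]
    refine embeddedExpectation_mono hs hQ hx₀ k fun x hx hxk => ?_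
    have hS : 0 < x ⬝ᵥ 1 := by rw [hxk]; positivity
    rw [← hxk]
    simp only [add_smul_dotProduct_eigenvector hξ, Fin.sum_univ_two, smul_eq_mul]
    have hT : x ⬝ᵥ ξ = x 0 * ξ 0 + x 1 * ξ 1 := by simp [dotProduct]
    have hS' : x ⬝ᵥ 1 = x 0 + x 1 := by simp [dotProduct]
    set T := x ⬝ᵥ ξ
    set S := x ⬝ᵥ 1
    have e : x 0 / S * (T + s * lam * ξ 0) ^ 2 + x 1 / S * (T + s * lam * ξ 1) ^ 2 =
        (1 + 2 * s * lam / S) * T ^ 2 +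
          (s * lam) ^ 2 * ((x 0 * ξ 0 ^ 2 + x 1 * ξ 1 ^ 2) / S) := by
      field_simp
      linear_combination (-T ^ 2) * hS' - (2 * s * lam * T) * hT
    rw [e]
    have h2 : (x 0 * ξ 0 ^ 2 + x 1 * ξ 1 ^ 2) / S ≤ ξ 0 ^ 2 + ξ 1 ^ 2 := by
      rw [div_le_iff₀ hS, hS']
      nlinarith [mul_nonneg (hx 0) (sq_nonneg (ξ 1)), mul_nonneg (hx 1) (sq_nonneg (ξ 0))]
    have h3 : 2 * s * lam / S ≤ s / S := by
      gcongr
      nlinarith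
    rw [hK]
    gcongr
  simp only [he]
  refine tendsto_zero_of_le_contraction_of_mul_tendsto one_pos
    (c := fun k => 1 / ((k : ℝ) + (x₀ ⬝ᵥ 1 / s + 1)))
    (ε := fun k => K / s ^ 2 / ((k : ℝ) + (x₀ ⬝ᵥ 1 / s + 1))) ?_
    (Eventually.of_forall fun k => div_nonneg (hτ0 k) (sq_nonneg _))
    (tendsto_const_div_natCast_add _ _) (Eventually.of_forall fun k => ?_)
  · refine (tendsto_add_div_nat_add (x₀ ⬝ᵥ 1 / s + 1) 1).congr fun n => ?_
    ring
  · generalize x₀ ⬝ᵥ 1 = S₀ at *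
    have hSk : 0 < S₀ + s * k := by positivity
    have hSk1 : 0 < S₀ + s * (k + 1 : ℕ) := by positivity
    refine (div_le_div_of_nonneg_right (hstep k) (sq_nonneg _)).trans (le_of_eq ?_)
    have e1 : (k : ℝ) + (S₀ / s + 1) = (S₀ + s * (k + 1 : ℕ)) / s := by
      push_cast; field_simp; ring
    rw [e1]
    push_cast at hSk1 ⊢
    field_simp
    ring

/-! ### One-step expansion of characteristic functions -/

theorem norm_exp_I_mul_sub_taylor_le (y : ℝ) :
    ‖Complex.exp (Complex.I * y) - (1 + Complex.I * y - y ^ 2 / 2)‖ ≤ 4 * |y| ^ 3 := by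
  have hnI : ‖Complex.I * (y : ℂ)‖ = |y| := by simp
  rcases le_or_gt |y| 1 with h | h
  · have h1 := Complex.exp_bound (x := Complex.I * y) (by rwa [hnI]) (n := 3) (by norm_num)
    rw [hnI] at h1
    have e : ∑ m ∈ Finset.range 3, (Complex.I * (y : ℂ)) ^ m / (m.factorial : ℂ) =
        1 + Complex.I * y - y ^ 2 / 2 := by
      simp only [Finset.sum_range_succ, Finset.range_zero, Finset.sum_empty, Nat.factorial]
      rw [mul_pow, mul_pow, mul_pow, Complex.I_sq]
      push_cast
      ring
    rw [e] at h1
    refine h1.trans ?_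
    rw [mul_comm]
    refine mul_le_mul_of_nonneg_right ?_ (by positivity)
    norm_num [Nat.factorial]
  · have h1 : ‖Complex.exp (Complex.I * y)‖ = 1 := Complex.norm_exp_I_mul_ofReal y
    have h2 : ‖(1 + Complex.I * y - y ^ 2 / 2 : ℂ)‖ ≤ 1 + |y| + |y| ^ 2 / 2 := by
      refine (norm_sub_le _ _).trans (add_le_add ((norm_add_le _ _).trans ?_) ?_)
      · rw [hnI]; simp
      · simp
    refine (norm_sub_le _ _).trans ?_
    rw [h1]
    have hy2 : 1 ≤ |y| ^ 2 := one_le_pow₀ h.le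
    have hy3 : |y| ≤ |y| ^ 3 := by nlinarith
    have hy4 : |y| ^ 2 ≤ |y| ^ 3 := by nlinarith
    linarith

/-- The characteristic function of `x ⬝ᵥ ξ` in the embedded urn. -/
noncomputable def embeddedCharFun (s : ℝ) (Q : Matrix (Fin 2) (Fin 2) ℝ) (x₀ ξ : Fin 2 → ℝ)
    (k : ℕ) (u : ℝ) : ℂ :=
  embeddedExpectation s Q x₀ k fun x => Complex.exp (Complex.I * ((u * (x ⬝ᵥ ξ) : ℝ) : ℂ))

theorem norm_embeddedCharFun_le (hs : 0 < s) (hQ : Q ∈ Matrix.rowStochastic ℝ (Fin 2))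
    (hx₀ : ∀ i, 0 ≤ x₀ i) (hpos : 0 < x₀ ⬝ᵥ 1) (ξ : Fin 2 → ℝ) (k : ℕ) (u : ℝ) :
    ‖embeddedCharFun s Q x₀ ξ k u‖ ≤ 1 := by
  refine (norm_embeddedExpectation_le hs hQ hx₀ k (G := fun _ => (1 : ℝ)) fun x _ _ => ?_).trans
    (embeddedExpectation_const hs hQ hx₀ hpos k 1).le
  rw [Complex.norm_exp_I_mul_ofReal]

/-- One step of the embedded urn, for a fixed composition `x`. -/
theorem norm_embedded_step_le {lam : ℝ} {ξ : Fin 2 → ℝ} (hξ : Q.mulVec ξ = lam • ξ)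
    {x : Fin 2 → ℝ} (hx : ∀ i, 0 ≤ x i) (hS : 0 < x ⬝ᵥ 1) (u : ℝ) :
    ‖∑ i, (x i / (x ⬝ᵥ 1)) • Complex.exp (Complex.I * ((u * ((x + s • Q i) ⬝ᵥ ξ) : ℝ) : ℂ)) -
      (1 - ((u ^ 2 * ((s * lam) ^ 2 * (-(ξ 0 * ξ 1))) / 2 : ℝ) : ℂ)) *
        Complex.exp (Complex.I * ((u * (1 + s * lam / (x ⬝ᵥ 1)) * (x ⬝ᵥ ξ) : ℝ) : ℂ))‖ ≤
      4 * (|s * lam| * |ξ 0 - ξ 1|) ^ 3 * |u| ^ 3 +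
        u ^ 2 * ((s * lam) ^ 2 * (|ξ 0 + ξ 1| * |x ⬝ᵥ ξ / (x ⬝ᵥ 1)| +
          (x ⬝ᵥ ξ / (x ⬝ᵥ 1)) ^ 2)) := by
  have hT : x ⬝ᵥ ξ = x 0 * ξ 0 + x 1 * ξ 1 := by simp [dotProduct]
  have hS' : x ⬝ᵥ 1 = x 0 + x 1 := by simp [dotProduct]
  simp only [add_smul_dotProduct_eigenvector hξ]
  set T := x ⬝ᵥ ξ
  set S := x ⬝ᵥ 1
  -- `t` is the mean of `ξ` under the drawing probabilities `p`. The centred phases are `y i`, and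
  -- the mean drift is absorbed into `e₀`.
  set t := T / S with ht
  set p : Fin 2 → ℝ := fun i => x i / S with hp
  have hp0 : ∀ i, 0 ≤ p i := fun i => div_nonneg (hx i) hS.le
  have hp1 : p 0 + p 1 = 1 := by
    simp only [hp]; rw [← add_div, ← hS', div_self hS.ne']
  have hpt : p 0 * ξ 0 + p 1 * ξ 1 = t := by
    simp only [hp, ht, hT]; ring
  set y : Fin 2 → ℝ := fun i => u * (s * lam) * (ξ i - t) with hy
  set e₀ := Complex.exp (Complex.I * ((u * (1 + s * lam / S) * T : ℝ) : ℂ)) with he₀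
  have hexp : ∀ i, Complex.exp (Complex.I * ((u * (T + s * lam * ξ i) : ℝ) : ℂ)) =
      e₀ * Complex.exp (Complex.I * y i) := by
    intro i
    rw [he₀, ← Complex.exp_add, ← mul_add, ← Complex.ofReal_add]
    congr 3
    simp only [hy, ht]; ring
  have hfac : ∑ i, p i • Complex.exp (Complex.I * ((u * (T + s * lam * ξ i) : ℝ) : ℂ)) -
      (1 - ((u ^ 2 * ((s * lam) ^ 2 * (-(ξ 0 * ξ 1))) / 2 : ℝ) : ℂ)) * e₀ =
      e₀ * (∑ i, (p i : ℂ) * (Complex.exp (Complex.I * y i) -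
        (1 + Complex.I * y i - (y i) ^ 2 / 2)) -
        ((u ^ 2 * ((s * lam) ^ 2 * ((ξ 0 + ξ 1) * t - t ^ 2)) / 2 : ℝ) : ℂ)) := by
    simp only [Fin.sum_univ_two, hexp, Complex.real_smul]
    have q1 : p 0 * y 0 + p 1 * y 1 = 0 := by
      simp only [hy]
      linear_combination (u * (s * lam)) * hpt - (u * (s * lam) * t) * hp1
    -- Both values of `ξ` are roots of `X ^ 2 = (ξ 0 + ξ 1) * X - ξ 0 * ξ 1`, so the variance of `ξ`
    -- under `p` is `-(ξ 0 * ξ 1) + (ξ 0 + ξ 1) * t - t ^ 2`. The constant term is the stationary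
    -- variance, and the rest is small with `t`.
    have q2 : p 0 * y 0 ^ 2 + p 1 * y 1 ^ 2 =
        u ^ 2 * (s * lam) ^ 2 * (-(ξ 0 * ξ 1) + (ξ 0 + ξ 1) * t - t ^ 2) := by
      have hp0' : p 0 = 1 - p 1 := by linarith
      simp only [hy]
      rw [← hpt, hp0']
      ring
    have q1' : (p 0 : ℂ) * y 0 + p 1 * y 1 = 0 := by exact_mod_cast q1
    have q2' : (p 0 : ℂ) * y 0 ^ 2 + p 1 * y 1 ^ 2 =
        u ^ 2 * (s * lam) ^ 2 * (-(ξ 0 * ξ 1) + (ξ 0 + ξ 1) * t - t ^ 2) := by exact_mod_cast q2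
    have hp1' : (p 0 : ℂ) + p 1 = 1 := by exact_mod_cast hp1
    push_cast
    linear_combination e₀ * hp1' + (e₀ * Complex.I) * q1' - (e₀ / 2) * q2'
  change ‖∑ i, p i • Complex.exp (Complex.I * ((u * (T + s * lam * ξ i) : ℝ) : ℂ)) - _‖ ≤ _
  rw [hfac, norm_mul, he₀, Complex.norm_exp_I_mul_ofReal, one_mul]
  have hyb : ∀ i, |y i| ≤ |s * lam| * |ξ 0 - ξ 1| * |u| := by
    have hdist : ∀ i, |ξ i - t| ≤ |ξ 0 - ξ 1| := by
      have h0 : p 0 ≤ 1 := by linarith [hp0 1]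
      have h1 : p 1 ≤ 1 := by linarith [hp0 0]
      rw [Fin.forall_fin_two]
      constructor
      · have : ξ 0 - t = p 1 * (ξ 0 - ξ 1) := by
          rw [← hpt]; linear_combination (-ξ 0) * hp1
        rw [this, abs_mul, abs_of_nonneg (hp0 1)]
        exact mul_le_of_le_one_left (abs_nonneg _) h1
      · have : ξ 1 - t = -(p 0 * (ξ 0 - ξ 1)) := by
          rw [← hpt]; linear_combination (-ξ 1) * hp1
        rw [this, abs_neg, abs_mul, abs_of_nonneg (hp0 0)]
        exact mul_le_of_le_one_left (abs_nonneg _) h0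
    intro i
    simp only [hy]
    rw [abs_mul, abs_mul]
    calc |u| * |s * lam| * |ξ i - t| ≤ |u| * |s * lam| * |ξ 0 - ξ 1| :=
          mul_le_mul_of_nonneg_left (hdist i) (by positivity)
      _ = _ := by ring
  refine (norm_sub_le _ _).trans (add_le_add ?_ ?_)
  · refine (norm_sum_le _ _).trans ?_
    have : ∀ i, ‖(p i : ℂ) * (Complex.exp (Complex.I * y i) -
        (1 + Complex.I * y i - (y i) ^ 2 / 2))‖ ≤
        p i * (4 * (|s * lam| * |ξ 0 - ξ 1|) ^ 3 * |u| ^ 3) := by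
      intro i
      rw [norm_mul, Complex.norm_real, Real.norm_of_nonneg (hp0 i)]
      refine mul_le_mul_of_nonneg_left ((norm_exp_I_mul_sub_taylor_le _).trans ?_) (hp0 i)
      calc 4 * |y i| ^ 3 ≤ 4 * (|s * lam| * |ξ 0 - ξ 1| * |u|) ^ 3 := by
            gcongr; exact hyb i
        _ = _ := by ring
    refine (Finset.sum_le_sum fun i _ => this i).trans ?_
    rw [← Finset.sum_mul, Fin.sum_univ_two, hp1, one_mul]
  · rw [Complex.norm_real, Real.norm_eq_abs, abs_div, abs_mul, abs_mul, abs_of_nonneg (sq_nonneg u),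
      abs_of_nonneg (sq_nonneg (s * lam)), abs_two]
    have h1 : |(ξ 0 + ξ 1) * t - t ^ 2| ≤ |ξ 0 + ξ 1| * |t| + t ^ 2 := by
      refine (abs_sub _ _).trans ?_
      rw [abs_mul, abs_of_nonneg (sq_nonneg t)]
    have h2 : 0 ≤ u ^ 2 * ((s * lam) ^ 2 * |(ξ 0 + ξ 1) * t - t ^ 2|) := by positivity
    refine (half_le_self h2).trans ?_
    gcongr

end Embedded

/-! ### The central limit theorem for the embedded urn -/

section Embedded

variable {s : ℝ} {Q : Matrix (Fin 2) (Fin 2) ℝ} {x₀ : Fin 2 → ℝ}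

theorem exists_norm_embeddedCharFun_succ_sub_le (hs : 0 < s)
    (hQ : Q ∈ Matrix.rowStochastic ℝ (Fin 2)) (hx₀ : ∀ i, 0 ≤ x₀ i) (hpos : 0 < x₀ ⬝ᵥ 1)
    {lam : ℝ} {ξ : Fin 2 → ℝ} (hξ : Q.mulVec ξ = lam • ξ) (hlam : lam ≤ 1 / 2) :
    ∃ K : ℝ, 0 ≤ K ∧ ∃ ε : ℕ → ℝ, (∀ k, 0 ≤ ε k) ∧ Tendsto ε atTop (𝓝 0) ∧ ∀ (k : ℕ) (u : ℝ),
      ‖embeddedCharFun s Q x₀ ξ (k + 1) u -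
        (1 - ((u ^ 2 * ((s * lam) ^ 2 * (-(ξ 0 * ξ 1))) / 2 : ℝ) : ℂ)) *
          embeddedCharFun s Q x₀ ξ k (u * (1 + lam / (k + x₀ ⬝ᵥ 1 / s)))‖ ≤
        ε k * u ^ 2 + K * |u| ^ 3 := by
  set z : ℕ → ℝ := fun k =>
    embeddedExpectation s Q x₀ k (fun x => (x ⬝ᵥ ξ / (x ⬝ᵥ 1)) ^ 2) with hz
  have hz0 : ∀ k, 0 ≤ z k := fun k => by
    have := embeddedExpectation_mono hs hQ hx₀ k (F := fun _ => (0 : ℝ))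
      (G := fun x => (x ⬝ᵥ ξ / (x ⬝ᵥ 1)) ^ 2) fun x _ _ => sq_nonneg _
    rwa [embeddedExpectation_const hs hQ hx₀ hpos] at this
  have hzl : Tendsto z atTop (𝓝 0) := tendsto_embedded_second_moment hs hQ hx₀ hpos hξ hlam
  -- The mean of `|t|` is bounded through `|t| ≤ η + t ^ 2 / η`, in place of Cauchy-Schwarz. The
  -- choice `η ≈ √z` balances the two terms, and `1 / (k + 1)` keeps `η` positive.
  set η : ℕ → ℝ := fun k => √(z k) + 1 / ((k : ℝ) + 1) with hη
  have hη0 : ∀ k, 0 < η k := fun k => by positivity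
  have hηl : Tendsto η atTop (𝓝 0) := by
    have := hzl.sqrt.add (tendsto_one_div_add_atTop_nhds_zero_nat (𝕜 := ℝ))
    rw [Real.sqrt_zero, add_zero] at this
    exact this
  set A := (s * lam) ^ 2 with hA
  set B := |ξ 0 + ξ 1| with hB
  refine ⟨4 * (|s * lam| * |ξ 0 - ξ 1|) ^ 3, by positivity,
    fun k => A * (B * (η k + √(z k)) + z k), fun k => ?_, ?_, fun k u => ?_⟩
  · have := hz0 k
    have := (hη0 k).le
    positivity
  · have := (((hηl.add hzl.sqrt).const_mul B).add hzl).const_mul A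
    simpa using this
  · set M := 4 * (|s * lam| * |ξ 0 - ξ 1|) ^ 3 with hM
    set σ : ℝ := u ^ 2 * ((s * lam) ^ 2 * (-(ξ 0 * ξ 1))) / 2 with hσ
    have hmap : (1 - (σ : ℂ)) * embeddedCharFun s Q x₀ ξ k (u * (1 + lam / (k + x₀ ⬝ᵥ 1 / s))) =
        embeddedExpectation s Q x₀ k fun x => (1 - (σ : ℂ)) * Complex.exp (Complex.I *
          ((u * (1 + lam / (k + x₀ ⬝ᵥ 1 / s)) * (x ⬝ᵥ ξ) : ℝ) : ℂ)) :=
      (embeddedExpectation_map (LinearMap.mulLeft ℝ (1 - (σ : ℂ))) k _).symm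
    rw [hmap, embeddedCharFun, embeddedExpectation, ← embeddedExpectation_sub]
    have h1 := norm_embeddedExpectation_le hs hQ hx₀ k
      (F := fun x => ∑ i, (x i / (x ⬝ᵥ 1)) •
        Complex.exp (Complex.I * ((u * ((x + s • Q i) ⬝ᵥ ξ) : ℝ) : ℂ)) -
        (1 - (σ : ℂ)) * Complex.exp (Complex.I *
          ((u * (1 + lam / (k + x₀ ⬝ᵥ 1 / s)) * (x ⬝ᵥ ξ) : ℝ) : ℂ)))
      (G := fun x => (M * |u| ^ 3 + u ^ 2 * (A * (B * η k))) +
        (u ^ 2 * (A * (B / η k + 1))) • (x ⬝ᵥ ξ / (x ⬝ᵥ 1)) ^ 2) fun x hx hxk => by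
        have hS : 0 < x ⬝ᵥ 1 := by rw [hxk]; positivity
        have h2 := norm_embedded_step_le (s := s) hξ hx hS u
        have e1 : lam / ((k : ℝ) + x₀ ⬝ᵥ 1 / s) = s * lam / (x ⬝ᵥ 1) := by
          rw [hxk] at hS ⊢
          have : (k : ℝ) + x₀ ⬝ᵥ 1 / s = (x₀ ⬝ᵥ 1 + s * k) / s := by field_simp; ring
          rw [this]; field_simp
        rw [e1]
        refine h2.trans ?_
        set t := x ⬝ᵥ ξ / (x ⬝ᵥ 1)
        have ht : |t| ≤ η k + t ^ 2 / η k := by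
          have hk := hη0 k
          rw [← sub_nonneg]
          have : η k + t ^ 2 / η k - |t| = ((η k - |t|) ^ 2 + η k * |t|) / η k := by
            rw [← sq_abs t]; field_simp; ring
          rw [this]; positivity
        have h3 : u ^ 2 * (A * (B * |t| + t ^ 2)) ≤
            u ^ 2 * (A * (B * (η k + t ^ 2 / η k) + t ^ 2)) := by gcongr
        rw [smul_eq_mul]
        calc M * |u| ^ 3 + u ^ 2 * (A * (B * |t| + t ^ 2)) ≤ M * |u| ^ 3 +
              u ^ 2 * (A * (B * (η k + t ^ 2 / η k) + t ^ 2)) := by gcongr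
          _ = _ := by ring
    refine h1.trans ?_
    rw [embeddedExpectation_add, embeddedExpectation_const hs hQ hx₀ hpos,
      embeddedExpectation_smul, smul_eq_mul]
    change _ + _ * z k ≤ _
    have hdiv : z k / η k ≤ √(z k) := by
      rw [div_le_iff₀ (hη0 k)]
      have : 0 ≤ √(z k) * (1 / ((k : ℝ) + 1)) := by positivity
      simp only [hη]
      nlinarith [Real.mul_self_sqrt (hz0 k)]
    calc M * |u| ^ 3 + u ^ 2 * (A * (B * η k)) + u ^ 2 * (A * (B / η k + 1)) * z k
        = u ^ 2 * (A * (B * (η k + z k / η k) + z k)) + M * |u| ^ 3 := by ring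
      _ ≤ u ^ 2 * (A * (B * (η k + √(z k)) + z k)) + M * |u| ^ 3 := by gcongr
      _ = _ := by ring

/-- Replaces the quadratic factor of the one-step expansion by a Gaussian one at cubic cost for all
`u`: by Taylor for `|u| ≤ 1`, and by the size of the quadratic term beyond. -/
theorem abs_exp_neg_sub_one_add_le {σ : ℝ} (hσ : 0 ≤ σ) (u : ℝ) :
    |Real.exp (-(σ * u ^ 2 / 2)) - (1 - u ^ 2 * σ / 2)| ≤ (σ + σ ^ 2) * |u| ^ 3 := by
  set w := σ * u ^ 2 / 2 with hw
  have hw0 : 0 ≤ w := by positivity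
  have e : u ^ 2 * σ / 2 = w := by rw [hw]; ring
  rw [e]
  have h1 : 0 ≤ Real.exp (-w) - (1 - w) := by
    have := Real.add_one_le_exp (-w); linarith
  rw [abs_of_nonneg h1]
  have h2 : Real.exp (-w) ≤ 1 := Real.exp_le_one_iff.2 (by linarith)
  rw [← sq_abs u] at hw
  have ha := abs_nonneg u
  generalize |u| = a at *
  rcases le_or_gt a 1 with h | h
  · have h3 : Real.exp (-w) - (1 - w) ≤ w ^ 2 := by
      rcases le_or_gt w 1 with hw1 | hw1
      · have := Real.abs_exp_sub_one_sub_id_le (x := -w) (by rwa [abs_neg, abs_of_nonneg hw0])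
        rw [neg_sq] at this
        linarith [le_abs_self (Real.exp (-w) - 1 - -w)]
      · nlinarith
    have h4 : w ^ 2 ≤ σ ^ 2 * a ^ 3 := by
      have : w ^ 2 = σ ^ 2 * a ^ 3 * (a / 4) := by rw [hw]; ring
      rw [this]
      refine mul_le_of_le_one_right (by positivity) (by linarith)
    have : 0 ≤ σ * a ^ 3 := by positivity
    linarith
  · have h4 : w ≤ σ * a ^ 3 := by
      have : w = σ * a ^ 2 * (1 / 2) := by rw [hw]; ring
      rw [this]
      have : a ^ 3 = a ^ 2 * a := by ring
      rw [this, ← mul_assoc]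
      exact mul_le_mul_of_nonneg_left (by linarith) (by positivity)
    have : 0 ≤ σ ^ 2 * a ^ 3 := by positivity
    linarith

/-- The central limit theorem for the embedded urn, with a quantitative form of the error. -/
theorem exists_norm_embeddedCharFun_sub_gaussian_le (hs : 0 < s)
    (hQ : Q ∈ Matrix.rowStochastic ℝ (Fin 2)) (hx₀ : ∀ i, 0 ≤ x₀ i) (hpos : 0 < x₀ ⬝ᵥ 1)
    {lam : ℝ} {ξ : Fin 2 → ℝ} (hξ : Q.mulVec ξ = lam • ξ) (hlam : lam ≤ 1 / 2)
    (hm : 0 ≤ -(ξ 0 * ξ 1)) :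
    ∃ r : ℕ → ℝ, Tendsto r atTop (𝓝 0) ∧ ∀ᶠ k in atTop, ∀ u : ℝ,
      ‖embeddedCharFun s Q x₀ ξ k u - (Real.exp (-((s * lam) ^ 2 * (-(ξ 0 * ξ 1)) *
        (varianceSeq lam (x₀ ⬝ᵥ 1 / s) k * u ^ 2) / 2)) : ℝ)‖ ≤
      r k * (|u| * √(varianceSeq lam (x₀ ⬝ᵥ 1 / s) k) +
        (|u| * √(varianceSeq lam (x₀ ⬝ᵥ 1 / s) k)) ^ 2 +
        (|u| * √(varianceSeq lam (x₀ ⬝ᵥ 1 / s) k)) ^ 3) := by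
  obtain ⟨K, hK, ε, hε0, hε, hstep⟩ :=
    exists_norm_embeddedCharFun_succ_sub_le hs hQ hx₀ hpos hξ hlam
  set σ := (s * lam) ^ 2 * (-(ξ 0 * ξ 1)) with hσ
  have hσ0 : 0 ≤ σ := by positivity
  set y := x₀ ⬝ᵥ 1 / s with hy
  have hy0 : 0 < y := div_pos hpos hs
  set b := varianceSeq lam y with hb
  set ρ : ℕ → ℝ := fun k => 1 + lam / (k + y) with hρ
  have hbs : ∀ k, b (k + 1) = ρ k ^ 2 * b k + 1 := fun k => rfl
  have hb0 : ∀ k, 0 ≤ b k := varianceSeq_nonneg lam y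
  have hb1 : ∀ k, 1 ≤ b (k + 1) := one_le_varianceSeq_succ lam y
  set K' := K + (σ + σ ^ 2) with hK'
  have hK'0 : 0 ≤ K' := by positivity
  -- The error is tracked as a cubic polynomial in `|u|`: `δ` carries the initial condition, `β` the
  -- fluctuation of the one-step variance, `α` the Taylor remainders. Each step rescales `u` by `ρ
  -- k`, hence the powers of `ρ`.
  let δ : ℕ → ℝ := fun k => Nat.rec |x₀ ⬝ᵥ ξ| (fun k d => |ρ k| * d) k
  let β : ℕ → ℝ := fun k => Nat.rec 0 (fun k d => ρ k ^ 2 * d + ε k) k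
  let α : ℕ → ℝ := fun k => Nat.rec 0 (fun k d => |ρ k| ^ 3 * d + K') k
  have hδ : ∀ k, δ (k + 1) = |ρ k| * δ k := fun k => rfl
  have hβ : ∀ k, β (k + 1) = ρ k ^ 2 * β k + ε k := fun k => rfl
  have hα : ∀ k, α (k + 1) = |ρ k| ^ 3 * α k + K' := fun k => rfl
  have hδ0 : ∀ k, 0 ≤ δ k := fun k => by
    induction k with
    | zero => exact abs_nonneg _
    | succ k ih => rw [hδ]; positivity
  have hβ0 : ∀ k, 0 ≤ β k := fun k => by
    induction k with
    | zero => exact le_rfl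
    | succ k ih => rw [hβ]; have := hε0 k; positivity
  have hα0 : ∀ k, 0 ≤ α k := fun k => by
    induction k with
    | zero => exact le_rfl
    | succ k ih => rw [hα]; positivity
  have hmain : ∀ k u, ‖embeddedCharFun s Q x₀ ξ k u -
      (Real.exp (-(σ * (b k * u ^ 2) / 2)) : ℝ)‖ ≤ δ k * |u| + β k * u ^ 2 + α k * |u| ^ 3 := by
    intro k
    induction k with
    | zero =>
      intro u
      have e1 : b 0 = 0 := rfl
      have e2 : δ 0 = |x₀ ⬝ᵥ ξ| := rfl
      have e3 : β 0 = 0 := rfl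
      have e4 : α 0 = 0 := rfl
      have e5 : embeddedCharFun s Q x₀ ξ 0 u =
        Complex.exp (Complex.I * ((u * (x₀ ⬝ᵥ ξ) : ℝ) : ℂ)) := rfl
      have := Real.norm_exp_I_mul_ofReal_sub_one_le (x := u * (x₀ ⬝ᵥ ξ))
      rw [e1, e2, e3, e4, e5]
      simp only [zero_mul, mul_zero, zero_div, neg_zero, Real.exp_zero, Complex.ofReal_one,
        add_zero]
      refine this.trans (le_of_eq ?_)
      rw [Real.norm_eq_abs, abs_mul, mul_comm]
    | succ k ih =>
      intro u
      have h1 := hstep k u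
      have h2 := ih (u * ρ k)
      have h3 := abs_exp_neg_sub_one_add_le hσ0 u
      set φ := embeddedCharFun s Q x₀ ξ k (u * ρ k) with hφ
      have hφ1 : ‖φ‖ ≤ 1 := norm_embeddedCharFun_le hs hQ hx₀ hpos ξ k _
      set g := Real.exp (-(σ * u ^ 2 / 2)) with hg
      have hg1 : g ≤ 1 := Real.exp_le_one_iff.2 (by
        have : 0 ≤ σ * u ^ 2 / 2 := by positivity
        linarith)
      have hg0 : 0 ≤ g := (Real.exp_pos _).le
      set G := Real.exp (-(σ * (b k * (u * ρ k) ^ 2) / 2)) with hG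
      have hGs : Real.exp (-(σ * (b (k + 1) * u ^ 2) / 2)) = g * G := by
        rw [hg, hG, ← Real.exp_add, hbs]
        congr 1; ring
      rw [hGs]
      -- The three pieces are the one-step error, the replacement of the quadratic factor by `g`,
      -- and the inherited error damped by `g ≤ 1`.
      have hsplit : embeddedCharFun s Q x₀ ξ (k + 1) u - ((g * G : ℝ) : ℂ) =
          (embeddedCharFun s Q x₀ ξ (k + 1) u - (1 - ((u ^ 2 * σ / 2 : ℝ) : ℂ)) * φ) -
          ((g - (1 - u ^ 2 * σ / 2) : ℝ) : ℂ) * φ + (g : ℂ) * (φ - (G : ℂ)) := by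
        push_cast; ring
      rw [hsplit]
      refine (norm_add_le _ _).trans ((add_le_add ((norm_sub_le _ _).trans
        (add_le_add h1 ?_)) ?_).trans (le_of_eq ?_ : (ε k * u ^ 2 + K * |u| ^ 3 +
          (σ + σ ^ 2) * |u| ^ 3) + (δ k * |u * ρ k| + β k * (u * ρ k) ^ 2 +
            α k * |u * ρ k| ^ 3) ≤ _))
      · rw [norm_mul, Complex.norm_real, Real.norm_eq_abs]
        exact (mul_le_of_le_one_right (abs_nonneg _) hφ1).trans h3
      · rw [norm_mul, Complex.norm_real, Real.norm_of_nonneg hg0]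
        exact (mul_le_of_le_one_left (norm_nonneg _) hg1).trans h2
      · rw [hδ, hβ, hα, abs_mul, hK']
        ring
  have hbinf : Tendsto b atTop atTop := tendsto_varianceSeq_atTop hy0 hlam
  have hcns : ¬ Summable fun k => 1 / b (k + 1) := not_summable_one_div_varianceSeq hy0 hlam
  have hc0 : ∀ᶠ k in atTop, 0 ≤ 1 / b (k + 1) :=
    Eventually.of_forall fun k => by have := hb0 (k + 1); positivity
  have hc1 : ∀ᶠ k in atTop, 1 / b (k + 1) ≤ 1 :=
    Eventually.of_forall fun k => div_le_one_of_le₀ (hb1 k) (hb0 _)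
  have hbpos : ∀ᶠ k in atTop, 0 < b k := hbinf.eventually_gt_atTop 0
  -- Since `ρ k ^ 2 * b k = b (k + 1) - 1`, division by `b` turns amplification by `ρ k ^ 2` into
  -- contraction by `1 - 1 / b (k + 1)`. These rates have divergent sum.
  have r1 : Tendsto (fun k => δ k ^ 2 / b k) atTop (𝓝 0) := by
    refine tendsto_zero_of_le_contraction (Eventually.of_forall fun k =>
      div_nonneg (sq_nonneg _) (hb0 k)) hc0 hc1 hcns (tendsto_const_nhds (x := 0)) ?_
    filter_upwards [hbpos] with k hk
    have hk1 : 0 < b (k + 1) := one_pos.trans_le (hb1 k)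
    have e : ρ k ^ 2 = (b (k + 1) - 1) / b k := by rw [hbs]; field_simp; ring
    refine le_of_eq ?_
    rw [hδ, mul_pow, sq_abs, e]
    field_simp
    ring
  have r2 : Tendsto (fun k => β k / b k) atTop (𝓝 0) := by
    refine tendsto_zero_of_le_contraction (Eventually.of_forall fun k =>
      div_nonneg (hβ0 k) (hb0 k)) hc0 hc1 hcns hε ?_
    filter_upwards [hbpos] with k hk
    have hk1 : 0 < b (k + 1) := one_pos.trans_le (hb1 k)
    have e : ρ k ^ 2 = (b (k + 1) - 1) / b k := by rw [hbs]; field_simp; ring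
    refine le_of_eq ?_
    rw [hβ, e]
    field_simp
  have r3 : Tendsto (fun k => α k / √(b k) ^ 3) atTop (𝓝 0) := by
    have hsq : Tendsto (fun k => K' / √(b (k + 1))) atTop (𝓝 0) :=
      tendsto_const_nhds.div_atTop (Real.tendsto_sqrt_atTop.comp
        (hbinf.comp (tendsto_add_atTop_nat 1)))
    refine tendsto_zero_of_le_contraction (Eventually.of_forall fun k =>
      div_nonneg (hα0 k) (by positivity)) hc0 hc1 hcns hsq ?_
    filter_upwards [hbpos] with k hk
    have hk1 : 0 < b (k + 1) := one_pos.trans_le (hb1 k)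
    set B := √(b k) with hB
    set B1 := √(b (k + 1)) with hB1
    have hBp : 0 < B := Real.sqrt_pos.2 hk
    have hB1p : 0 < B1 := Real.sqrt_pos.2 hk1
    have eB : B ^ 2 = b k := Real.sq_sqrt hk.le
    have eB1 : B1 ^ 2 = b (k + 1) := Real.sq_sqrt hk1.le
    have hθ : (|ρ k| * B) ^ 2 = B1 ^ 2 - 1 := by
      rw [mul_pow, sq_abs, eB, eB1, hbs]; ring
    have hθ1 : |ρ k| * B ≤ B1 := abs_le_of_sq_le_sq' (by linarith) hB1p.le |>.2
    -- On the scale `b ^ (3 / 2)` the cubic amplification still contracts by at least `1 - 1 / b (k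
    -- + 1)`, and the constant `K'` becomes the vanishing forcing `K' / √(b (k + 1))`.
    have hcube : (|ρ k| * B) ^ 3 ≤ (B1 ^ 2 - 1) * B1 := by
      rw [pow_succ, hθ]
      refine mul_le_mul_of_nonneg_left hθ1 ?_
      rw [eB1]; linarith [hb1 k]
    rw [hα, ← eB1]
    have e1 : (|ρ k| ^ 3 * α k + K') / B1 ^ 3 =
        (|ρ k| * B) ^ 3 * (α k / B ^ 3) / B1 ^ 3 + K' / B1 ^ 3 := by
      field_simp
    have e2 : (1 - 1 / B1 ^ 2) * (α k / B ^ 3) + 1 / B1 ^ 2 * (K' / B1) =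
        (B1 ^ 2 - 1) * B1 * (α k / B ^ 3) / B1 ^ 3 + K' / B1 ^ 3 := by
      field_simp
    rw [e1, e2]
    have := hα0 k
    gcongr
  have r1' : Tendsto (fun k => δ k / √(b k)) atTop (𝓝 0) := by
    have := r1.sqrt
    rw [Real.sqrt_zero] at this
    refine this.congr fun k => ?_
    rw [Real.sqrt_div (sq_nonneg _), Real.sqrt_sq (hδ0 k)]
  refine ⟨fun k => δ k / √(b k) + β k / b k + α k / √(b k) ^ 3, ?_, ?_⟩
  · simpa using (r1'.add r2).add r3
  · filter_upwards [hbpos] with k hk u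
    refine (hmain k u).trans ?_
    set B := √(b k) with hB
    have hBp : 0 < B := Real.sqrt_pos.2 hk
    have eB : B ^ 2 = b k := Real.sq_sqrt hk.le
    have d1 : 0 ≤ δ k / B := div_nonneg (hδ0 k) hBp.le
    have d2 : 0 ≤ β k / b k := div_nonneg (hβ0 k) hk.le
    have d3 : 0 ≤ α k / B ^ 3 := div_nonneg (hα0 k) (by positivity)
    have f1 : δ k * |u| = δ k / B * (|u| * B) := by field_simp
    have f2 : β k * u ^ 2 = β k / b k * (|u| * B) ^ 2 := by
      rw [mul_pow, sq_abs, eB]; field_simp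
    have f3 : α k * |u| ^ 3 = α k / B ^ 3 * (|u| * B) ^ 3 := by
      rw [mul_pow]; field_simp
    rw [f1, f2, f3]
    generalize δ k / B = p1 at *
    generalize β k / b k = p2 at *
    generalize α k / B ^ 3 = p3 at *
    have hx : 0 ≤ |u| * B := by positivity
    generalize |u| * B = v at *
    have m1 := mul_nonneg d1 hx
    have m2 := mul_nonneg d1 (pow_nonneg hx 2)
    have m3 := mul_nonneg d1 (pow_nonneg hx 3)
    have n1 := mul_nonneg d2 hx
    have n2 := mul_nonneg d2 (pow_nonneg hx 3)
    have o1 := mul_nonneg d3 hx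
    have o2 := mul_nonneg d3 (pow_nonneg hx 2)
    nlinarith

end Embedded

/-! ### Transfer of the central limit theorem to the urn -/

namespace IsUrn

variable {Ω κ : Type*} [MeasurableSpace Ω] [Fintype κ] {μ : Measure Ω}
  {s : ℝ} {Q : Matrix (Fin 2) (Fin 2) ℝ} {E : Matrix (Fin 2) κ ℝ} {P : Matrix κ κ ℝ}
  {c₀ : Fin 2 ⊕ κ → ℝ} {C : ℕ → Ω → Fin 2 ⊕ κ → ℝ} {draw : ℕ → Ω → Fin 2 ⊕ κ}

/-- Given the number of dominated draws, the dominated pair is distributed as the embedded urn. -/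
theorem integral_dominated_eq_embedded [DecidableEq κ] [IsProbabilityMeasure μ]
    (h : IsUrn μ (Matrix.fromBlocks (s • Q) E 0 P) c₀ C draw) (hs : 0 < s)
    (hQ : Q ∈ Matrix.rowStochastic ℝ (Fin 2))
    (hR : Matrix.fromBlocks (s • Q) E 0 P ∈ Matrix.rowStochastic ℝ (Fin 2 ⊕ κ))
    (hc₀ : c₀ ∈ stdSimplex ℝ (Fin 2 ⊕ κ)) (hpos : 0 < c₀ ⬝ᵥ Sum.elim 1 0)
    {V : Type*} [NormedAddCommGroup V] [NormedSpace ℝ V] [CompleteSpace V] (n : ℕ)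
    (F : (Fin 2 → ℝ) → V) :
    ∫ ω, F (fun i => C n ω (Sum.inl i)) ∂μ =
      ∫ ω, embeddedExpectation s Q (fun i => c₀ (Sum.inl i)) (dominatedCount draw n ω) F ∂μ := by
  induction n generalizing F with
  | zero => simp [h.initial, embeddedExpectation, dominatedCount]
  | succ n ih =>
    set x₀ : Fin 2 → ℝ := fun i => c₀ (Sum.inl i) with hx₀def
    have hx₀ : ∀ i, 0 ≤ x₀ i := fun i => hc₀.1 _
    rw [dotProduct_sumElim_zero] at hpos
    rw [h.integral_dominated_succ hs.ne' hQ hR hc₀ n fun _ x => F x,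
      h.integral_dominated_succ hs.ne' hQ hR hc₀ n fun k _ => embeddedExpectation s Q x₀ k F]
    simp only [dotProduct_sumElim_zero]
    rw [ih fun x => (1 - (x ⬝ᵥ 1) / ((n : ℝ) + 1)) • F x +
      ∑ i, (x i / ((n : ℝ) + 1)) • F (x + s • Q i)]
    refine integral_congr_ae (ae_of_all _ fun ω => ?_)
    have hS := h.dominated_eq hQ n ω
    rw [dotProduct_sumElim_zero, dotProduct_sumElim_zero] at hS
    set k := dominatedCount draw n ω
    simp only
    rw [← Finset.sum_smul, ← Finset.sum_div]
    have hS1 : ∑ i : Fin 2, C n ω (Sum.inl i) = x₀ ⬝ᵥ 1 + s * k := by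
      rw [← hS]; simp [dotProduct]
    rw [hS1, hS]
    -- A dominated draw has a probability depending on the count `k` only, and given such a draw the
    -- colour is chosen as in the embedded urn. The step thus splits into staying at `k` and moving
    -- to `k + 1`.
    change _ = (1 - (x₀ ⬝ᵥ 1 + s * k) / ((n : ℝ) + 1)) • embeddedExpectation s Q x₀ k F +
      ((x₀ ⬝ᵥ 1 + s * k) / ((n : ℝ) + 1)) • embeddedExpectation s Q x₀ (k + 1) F
    rw [embeddedExpectation, ← embeddedExpectation_smul, ← embeddedExpectation_smul,
      ← embeddedExpectation_add]
    refine embeddedExpectation_congr hs hQ hx₀ k fun x hx hxk => ?_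
    have hne : x ⬝ᵥ 1 ≠ 0 := by rw [hxk]; positivity
    rw [← hxk, Finset.smul_sum]
    congr 1
    refine Finset.sum_congr rfl fun i _ => ?_
    rw [smul_smul]
    congr 1
    have hn : (n : ℝ) + 1 ≠ 0 := by positivity
    field_simp

/-- The characteristic function at `t` is the mean of the embedded one, taken at the random time
given by the count and at frequency `t / q n`. The Gaussian approximation applies along almost every
path, and dominated convergence yields the mean of `exp (-v * t ^ 2 / 2)`. Hypothesis `hq'` is
separate from `hq` because the factor `(s * lam) ^ 2 * (-(ξ 0 * ξ 1))` vanishes when `lam = 0`; it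
keeps the scaled frequency bounded. -/
theorem tendstoNormalMixture_of_tendsto [DecidableEq κ] [IsProbabilityMeasure μ]
    (h : IsUrn μ (Matrix.fromBlocks (s • Q) E 0 P) c₀ C draw) (hs : 0 < s)
    (hQ : Q ∈ Matrix.rowStochastic ℝ (Fin 2))
    (hR : Matrix.fromBlocks (s • Q) E 0 P ∈ Matrix.rowStochastic ℝ (Fin 2 ⊕ κ))
    (hc₀ : c₀ ∈ stdSimplex ℝ (Fin 2 ⊕ κ)) (hpos : 0 < c₀ ⬝ᵥ Sum.elim 1 0)
    {lam : ℝ} {ξ : Fin 2 → ℝ} (hξ : Q.mulVec ξ = lam • ξ) (hlam : lam ≤ 1 / 2)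
    (hm : 0 ≤ -(ξ 0 * ξ 1)) {q : ℕ → ℝ} {v : Ω → ℝ} (hv : Measurable v)
    (hK : ∀ᵐ ω ∂μ, Tendsto (fun n => dominatedCount draw n ω) atTop atTop)
    (hq : ∀ᵐ ω ∂μ, Tendsto (fun n => (s * lam) ^ 2 * (-(ξ 0 * ξ 1)) *
      (varianceSeq lam (c₀ ⬝ᵥ Sum.elim 1 0 / s) (dominatedCount draw n ω) / q n ^ 2)) atTop
      (𝓝 (v ω)))
    (hq' : ∀ᵐ ω ∂μ, ∃ w, Tendsto (fun n =>
      varianceSeq lam (c₀ ⬝ᵥ Sum.elim 1 0 / s) (dominatedCount draw n ω) / q n ^ 2) atTop (𝓝 w)) :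
    TendstoNormalMixture μ (fun n ω => C n ω ⬝ᵥ Sum.elim ξ 0 / q n) v := by
  set x₀ : Fin 2 → ℝ := fun i => c₀ (Sum.inl i) with hx₀def
  have hx₀ : ∀ i, 0 ≤ x₀ i := fun i => hc₀.1 _
  have hS0 : c₀ ⬝ᵥ Sum.elim 1 0 = x₀ ⬝ᵥ 1 := dotProduct_sumElim_zero _ _
  rw [hS0] at hpos
  simp only [hS0] at hq hq'
  set b := varianceSeq lam (x₀ ⬝ᵥ 1 / s) with hb
  set σ := (s * lam) ^ 2 * (-(ξ 0 * ξ 1)) with hσ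
  have hσ0 : 0 ≤ σ := by positivity
  have hb0 : ∀ k, 0 ≤ b k := varianceSeq_nonneg _ _
  have hv0 : ∀ᵐ ω ∂μ, 0 ≤ v ω := by
    filter_upwards [hq] with ω hω
    exact ge_of_tendsto' hω fun n => mul_nonneg hσ0 (div_nonneg (hb0 _) (sq_nonneg _))
  have hXm : ∀ n, Measurable fun ω => C n ω ⬝ᵥ Sum.elim ξ 0 / q n := fun n =>
    (h.stronglyMeasurable n fun x => x ⬝ᵥ Sum.elim ξ 0 / q n).measurable
  have hYm : Measurable fun p : Ω × ℝ => √(v p.1) * p.2 := by fun_prop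
  obtain ⟨r, hr, hrb⟩ := exists_norm_embeddedCharFun_sub_gaussian_le hs hQ hx₀ hpos hξ hlam hm
  refine ⟨fun n => (hXm n).aemeasurable, hYm.aemeasurable, ?_⟩
  refine ProbabilityMeasure.tendsto_iff_tendsto_charFun.2 fun t => ?_
  have hlhs : ∀ n, charFun (μ.map fun ω => C n ω ⬝ᵥ Sum.elim ξ 0 / q n) t =
      ∫ ω, embeddedCharFun s Q x₀ ξ (dominatedCount draw n ω) (t / q n) ∂μ := by
    intro n
    rw [charFun_apply_real, integral_map (hXm n).aemeasurable (by fun_prop)]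
    have := h.integral_dominated_eq_embedded hs hQ hR hc₀ (by rwa [hS0]) n
      (fun x => Complex.exp (Complex.I * ((t / q n * (x ⬝ᵥ ξ) : ℝ) : ℂ)))
    refine Eq.trans ?_ this
    refine integral_congr_ae (ae_of_all _ fun ω => ?_)
    simp only [dotProduct_sumElim_zero]
    congr 1
    push_cast
    ring
  have hrhs : charFun ((μ.prod (gaussianReal 0 1)).map fun p : Ω × ℝ => √(v p.1) * p.2) t =
      ∫ ω, ((Real.exp (-(v ω * t ^ 2 / 2)) : ℝ) : ℂ) ∂μ := by
    -- By Fubini, the inner integral is the standard normal characteristic function at `t * √(v ω)`.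
    rw [charFun_apply_real, integral_map hYm.aemeasurable (by fun_prop), integral_prod]
    · refine integral_congr_ae ?_
      filter_upwards [hv0] with ω hω
      have h1 := charFun_gaussianReal (μ := 0) (v := 1) (t * √(v ω))
      rw [charFun_apply_real] at h1
      have e : ∀ x : ℝ, Complex.exp ((t : ℂ) * ((√(v ω) * x : ℝ) : ℂ) * Complex.I) =
          Complex.exp (((t * √(v ω) : ℝ) : ℂ) * (x : ℂ) * Complex.I) := fun x => by
        congr 1; push_cast; ring
      simp only [e]
      rw [h1, Complex.ofReal_exp]
      congr 1
      have h2 : ((√(v ω) : ℝ) : ℂ) ^ 2 = (v ω : ℂ) := by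
        rw [← Complex.ofReal_pow, Real.sq_sqrt hω]
      push_cast
      linear_combination (-(t : ℂ) ^ 2 / 2) * h2
    · refine Integrable.of_bound (C := 1) (by fun_prop) (ae_of_all _ fun p => ?_)
      have : ((t : ℂ) * ((√(v p.1) * p.2 : ℝ) : ℂ) * Complex.I) =
          Complex.I * ((t * (√(v p.1) * p.2) : ℝ) : ℂ) := by push_cast; ring
      rw [this, Complex.norm_exp_I_mul_ofReal]
  change Tendsto (fun n => charFun (μ.map fun ω => C n ω ⬝ᵥ Sum.elim ξ 0 / q n) t) atTop
    (𝓝 (charFun ((μ.prod (gaussianReal 0 1)).map fun p : Ω × ℝ => √(v p.1) * p.2) t))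
  simp only [hlhs, hrhs]
  refine tendsto_integral_of_dominated_convergence (fun _ => (1 : ℝ)) (fun n => ?_)
    (integrable_const _) (fun n => ae_of_all _ fun ω =>
      norm_embeddedCharFun_le hs hQ hx₀ hpos ξ _ _) ?_
  · have h1 := h.stronglyMeasurable n fun x => embeddedCharFun s Q x₀ ξ
      ⌊(x ⬝ᵥ Sum.elim 1 0 - c₀ ⬝ᵥ Sum.elim 1 0) / s⌋₊ (t / q n)
    have h2 : StronglyMeasurable fun ω =>
        embeddedCharFun s Q x₀ ξ (dominatedCount draw n ω) (t / q n) := by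
      simpa only [h.dominated_eq hQ, add_sub_cancel_left, mul_div_cancel_left₀ _ hs.ne',
        Nat.floor_natCast] using h1
    exact h2.aestronglyMeasurable
  · filter_upwards [hK, hq, hq'] with ω hKω hqω hqω'
    obtain ⟨w, hw⟩ := hqω'
    have hexp : Tendsto (fun n => ((Real.exp (-(σ * (b (dominatedCount draw n ω) *
        (t / q n) ^ 2) / 2)) : ℝ) : ℂ)) atTop (𝓝 ((Real.exp (-(v ω * t ^ 2 / 2)) : ℝ) : ℂ)) := by
      refine (Complex.continuous_ofReal.tendsto _).comp
        ((Real.continuous_exp.tendsto _).comp ?_)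
      refine ((hqω.mul_const (t ^ 2)).div_const 2).neg.congr fun n => ?_
      rw [div_pow]; ring
    have hy : Tendsto (fun n => |t / q n| * √(b (dominatedCount draw n ω))) atTop
        (𝓝 (|t| * √w)) := by
      refine (hw.sqrt.const_mul |t|).congr fun n => ?_
      rw [Real.sqrt_div (hb0 _), Real.sqrt_sq_eq_abs, abs_div]
      ring
    have hbound := (hr.comp hKω).mul ((hy.add (hy.pow 2)).add (hy.pow 3))
    rw [zero_mul] at hbound
    have hdiff : Tendsto (fun n => embeddedCharFun s Q x₀ ξ (dominatedCount draw n ω) (t / q n) -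
        ((Real.exp (-(σ * (b (dominatedCount draw n ω) * (t / q n) ^ 2) / 2)) : ℝ) : ℂ)) atTop
        (𝓝 0) := by
      refine squeeze_zero_norm' ?_ hbound
      filter_upwards [hKω.eventually hrb] with n hn
      exact hn (t / q n)
    have := hdiff.add hexp
    simpa using this

theorem tendsto_dominatedCount_div (h : IsUrn μ (Matrix.fromBlocks (s • Q) E 0 P) c₀ C draw)
    (hs : 0 < s) (hQ : Q ∈ Matrix.rowStochastic ℝ (Fin 2)) {u : ℝ} {ω : Ω}
    (hu : Tendsto (fun n : ℕ => C n ω ⬝ᵥ Sum.elim 1 0 / (n : ℝ) ^ s) atTop (𝓝 u)) :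
    Tendsto (fun n : ℕ => (dominatedCount draw n ω : ℝ) / (n : ℝ) ^ s) atTop (𝓝 (u / s)) := by
  have hns : Tendsto (fun n : ℕ => (n : ℝ) ^ s) atTop atTop :=
    (tendsto_rpow_atTop hs).comp tendsto_natCast_atTop_atTop
  have h1 := (hu.div_const s).sub
    ((tendsto_const_nhds (x := c₀ ⬝ᵥ Sum.elim 1 0 / s)).div_atTop hns)
  rw [sub_zero] at h1
  refine h1.congr fun n => ?_
  rw [h.dominated_eq hQ]
  field_simp
  ring

theorem tendsto_dominatedCount_atTop (h : IsUrn μ (Matrix.fromBlocks (s • Q) E 0 P) c₀ C draw)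
    (hs : 0 < s) (hQ : Q ∈ Matrix.rowStochastic ℝ (Fin 2)) {u : ℝ} {ω : Ω} (hu0 : 0 < u)
    (hu : Tendsto (fun n : ℕ => C n ω ⬝ᵥ Sum.elim 1 0 / (n : ℝ) ^ s) atTop (𝓝 u)) :
    Tendsto (fun n => dominatedCount draw n ω) atTop atTop := by
  have hns : Tendsto (fun n : ℕ => (n : ℝ) ^ s) atTop atTop :=
    (tendsto_rpow_atTop hs).comp tendsto_natCast_atTop_atTop
  have h1 := (h.tendsto_dominatedCount_div hs hQ hu).pos_mul_atTop (div_pos hu0 hs) hns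
  rw [← tendsto_natCast_atTop_iff (R := ℝ)]
  refine h1.congr' ?_
  filter_upwards [eventually_gt_atTop 0] with n hn
  have : (0 : ℝ) < (n : ℝ) ^ s := Real.rpow_pos_of_pos (by exact_mod_cast hn) _
  field_simp

theorem tendsto_varianceSeq_dominatedCount_div
    (h : IsUrn μ (Matrix.fromBlocks (s • Q) E 0 P) c₀ C draw) (hs : 0 < s)
    (hQ : Q ∈ Matrix.rowStochastic ℝ (Fin 2)) (hpos : 0 < c₀ ⬝ᵥ Sum.elim 1 0) {lam : ℝ}
    (hlam : lam < 1 / 2) {u : ℝ} {ω : Ω} (hu0 : 0 < u)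
    (hu : Tendsto (fun n : ℕ => C n ω ⬝ᵥ Sum.elim 1 0 / (n : ℝ) ^ s) atTop (𝓝 u)) :
    Tendsto (fun n : ℕ => varianceSeq lam (c₀ ⬝ᵥ Sum.elim 1 0 / s) (dominatedCount draw n ω) /
      ((n : ℝ) ^ (s / 2)) ^ 2) atTop (𝓝 (u / (s * (1 - 2 * lam)))) := by
  have hK := h.tendsto_dominatedCount_atTop hs hQ hu0 hu
  have h1 := ((tendsto_varianceSeq_div (div_pos hpos hs) hlam).comp hK).mul
    (h.tendsto_dominatedCount_div hs hQ hu)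
  have e : 1 / (1 - 2 * lam) * (u / s) = u / (s * (1 - 2 * lam)) := by
    rw [div_mul_div_comm, one_mul, mul_comm s]
  rw [e] at h1
  refine h1.congr' ?_
  filter_upwards [hK.eventually_gt_atTop 0] with n hn
  have hk : (0 : ℝ) < dominatedCount draw n ω := by exact_mod_cast hn
  rw [← Real.rpow_natCast ((n : ℝ) ^ (s / 2)) 2, ← Real.rpow_mul n.cast_nonneg]
  have e2 : s / 2 * ((2 : ℕ) : ℝ) = s := by push_cast; ring
  rw [e2]
  simp only [Function.comp_apply]
  field_simp

/-- The logarithm of the count is equivalent to `s * log n`; this factor `s` cancels the `1 / s` in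
the limit of the count over `n ^ s`. -/
theorem tendsto_varianceSeq_half_dominatedCount_div
    (h : IsUrn μ (Matrix.fromBlocks (s • Q) E 0 P) c₀ C draw) (hs : 0 < s)
    (hQ : Q ∈ Matrix.rowStochastic ℝ (Fin 2)) (hpos : 0 < c₀ ⬝ᵥ Sum.elim 1 0)
    {u : ℝ} {ω : Ω} (hu0 : 0 < u)
    (hu : Tendsto (fun n : ℕ => C n ω ⬝ᵥ Sum.elim 1 0 / (n : ℝ) ^ s) atTop (𝓝 u)) :
    Tendsto (fun n : ℕ => varianceSeq (1 / 2) (c₀ ⬝ᵥ Sum.elim 1 0 / s)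
      (dominatedCount draw n ω) / (√((n : ℝ) ^ s * Real.log n)) ^ 2) atTop (𝓝 u) := by
  have hK := h.tendsto_dominatedCount_atTop hs hQ hu0 hu
  have hKd := h.tendsto_dominatedCount_div hs hQ hu
  have hlogn : Tendsto (fun n : ℕ => Real.log n) atTop atTop :=
    Real.tendsto_log_atTop.comp tendsto_natCast_atTop_atTop
  have hlog : Tendsto (fun n : ℕ => Real.log (dominatedCount draw n ω) / Real.log n) atTop
      (𝓝 s) := by
    have h1 := ((hKd.log (div_pos hu0 hs).ne').div_atTop hlogn).add_const s
    rw [zero_add] at h1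
    refine h1.congr' ?_
    filter_upwards [hK.eventually_gt_atTop 0, eventually_gt_atTop 1] with n hn hn1
    have hk : (0 : ℝ) < dominatedCount draw n ω := by exact_mod_cast hn
    have hn' : (0 : ℝ) < n := by exact_mod_cast (by omega : 0 < n)
    have hl : 0 < Real.log n := Real.log_pos (by exact_mod_cast hn1)
    rw [Real.log_div hk.ne' (Real.rpow_pos_of_pos hn' _).ne', Real.log_rpow hn']
    field_simp
    ring
  have h1 := (((tendsto_varianceSeq_div_log (div_pos hpos hs)).comp hK).mul hKd).mul hlog
  have e : 1 * (u / s) * s = u := by field_simp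
  rw [e] at h1
  refine h1.congr' ?_
  filter_upwards [hK.eventually_gt_atTop 1, eventually_gt_atTop 1] with n hn hn1
  have hk : (0 : ℝ) < dominatedCount draw n ω := by exact_mod_cast (by omega)
  have hlk : 0 < Real.log (dominatedCount draw n ω) := Real.log_pos (by exact_mod_cast hn)
  have hl : 0 < Real.log n := Real.log_pos (by exact_mod_cast hn1)
  rw [Real.sq_sqrt (by positivity)]
  simp only [Function.comp_apply]
  field_simp

end IsUrn

/-- Random variables that are limits of the same functionals of the dominated pairs of two urns
have the same law. -/
theorem identDistrib_of_tendsto_dominated {Ω Ω' κ κ' : Type*} [MeasurableSpace Ω]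
    [MeasurableSpace Ω'] [Fintype κ] [Fintype κ'] [DecidableEq κ] [DecidableEq κ']
    {μ : Measure Ω} {μ' : Measure Ω'} [IsProbabilityMeasure μ] [IsProbabilityMeasure μ'] {s : ℝ}
    {Q : Matrix (Fin 2) (Fin 2) ℝ} {E : Matrix (Fin 2) κ ℝ} {P : Matrix κ κ ℝ}
    {E' : Matrix (Fin 2) κ' ℝ} {P' : Matrix κ' κ' ℝ} {c₀ : Fin 2 ⊕ κ → ℝ} {c₀' : Fin 2 ⊕ κ' → ℝ}
    {C : ℕ → Ω → Fin 2 ⊕ κ → ℝ} {draw : ℕ → Ω → Fin 2 ⊕ κ}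
    {C' : ℕ → Ω' → Fin 2 ⊕ κ' → ℝ} {draw' : ℕ → Ω' → Fin 2 ⊕ κ'}
    (h : IsUrn μ (Matrix.fromBlocks (s • Q) E 0 P) c₀ C draw)
    (h' : IsUrn μ' (Matrix.fromBlocks (s • Q) E' 0 P') c₀' C' draw') (hs : s ≠ 0)
    (hQ : Q ∈ Matrix.rowStochastic ℝ (Fin 2))
    (hR : Matrix.fromBlocks (s • Q) E 0 P ∈ Matrix.rowStochastic ℝ (Fin 2 ⊕ κ))
    (hR' : Matrix.fromBlocks (s • Q) E' 0 P' ∈ Matrix.rowStochastic ℝ (Fin 2 ⊕ κ'))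
    (hc₀ : c₀ ∈ stdSimplex ℝ (Fin 2 ⊕ κ)) (hc₀' : c₀' ∈ stdSimplex ℝ (Fin 2 ⊕ κ'))
    (hc : ∀ i, c₀ (Sum.inl i) = c₀' (Sum.inl i)) {ζ : Fin 2 → ℝ} {q : ℕ → ℝ} {Y : Ω → ℝ}
    {Y' : Ω' → ℝ} (hY : Measurable Y) (hY' : Measurable Y')
    (hl : ∀ᵐ ω ∂μ, Tendsto (fun n => C n ω ⬝ᵥ Sum.elim ζ 0 / q n) atTop (𝓝 (Y ω)))
    (hl' : ∀ᵐ ω ∂μ', Tendsto (fun n => C' n ω ⬝ᵥ Sum.elim ζ 0 / q n) atTop (𝓝 (Y' ω))) :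
    IdentDistrib Y Y' μ μ' := by
  refine ⟨hY.aemeasurable, hY'.aemeasurable, ?_⟩
  have := Measure.isProbabilityMeasure_map (μ := μ) hY.aemeasurable
  have := Measure.isProbabilityMeasure_map (μ := μ') hY'.aemeasurable
  refine Measure.ext_of_charFun (funext fun t => ?_)
  rw [charFun_apply_real, charFun_apply_real, integral_map hY.aemeasurable (by fun_prop),
    integral_map hY'.aemeasurable (by fun_prop)]
  let F : ℕ → (Fin 2 → ℝ) → ℂ := fun n x =>
    Complex.exp ((t : ℂ) * ((x ⬝ᵥ ζ / q n : ℝ) : ℂ) * Complex.I)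
  have hFn : ∀ n x, ‖F n x‖ ≤ 1 := fun n x => by
    have : ((t : ℂ) * ((x ⬝ᵥ ζ / q n : ℝ) : ℂ) * Complex.I) =
      Complex.I * ((t * (x ⬝ᵥ ζ / q n) : ℝ) : ℂ) := by push_cast; ring
    simp only [F]
    rw [this, Complex.norm_exp_I_mul_ofReal]
  have hcont : Continuous fun y : ℝ => Complex.exp ((t : ℂ) * (y : ℂ) * Complex.I) := by fun_prop
  have l1 : Tendsto (fun n => ∫ ω, F n (fun i => C n ω (Sum.inl i)) ∂μ) atTop
      (𝓝 (∫ ω, Complex.exp ((t : ℂ) * (Y ω : ℂ) * Complex.I) ∂μ)) := by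
    refine tendsto_integral_of_dominated_convergence (fun _ => (1 : ℝ)) (fun n =>
      (h.stronglyMeasurable n fun x => F n fun i => x (Sum.inl i)).aestronglyMeasurable)
      (integrable_const _) (fun n => ae_of_all _ fun ω => hFn n _) ?_
    filter_upwards [hl] with ω hω
    simp only [dotProduct_sumElim_zero] at hω
    exact (hcont.tendsto _).comp hω
  have l2 : Tendsto (fun n => ∫ ω, F n (fun i => C' n ω (Sum.inl i)) ∂μ') atTop
      (𝓝 (∫ ω, Complex.exp ((t : ℂ) * (Y' ω : ℂ) * Complex.I) ∂μ')) := by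
    refine tendsto_integral_of_dominated_convergence (fun _ => (1 : ℝ)) (fun n =>
      (h'.stronglyMeasurable n fun x => F n fun i => x (Sum.inl i)).aestronglyMeasurable)
      (integrable_const _) (fun n => ae_of_all _ fun ω => hFn n _) ?_
    filter_upwards [hl'] with ω hω
    simp only [dotProduct_sumElim_zero] at hω
    exact (hcont.tendsto _).comp hω
  -- Before the limit the two integrals coincide: both equal `pairExpectation` from the same initial
  -- pair.
  refine tendsto_nhds_unique l1 (l2.congr fun n => ?_)
  rw [h'.integral_dominated_eq_pairExpectation hs hQ hR' hc₀' n (F n),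
    h.integral_dominated_eq_pairExpectation hs hQ hR hc₀ n (F n)]
  simp only [hc]

/-! ### Two-state stochastic matrices -/

/-- If the entry vanished, the two-state chain could never leave `i`, and the same entry of every
power would vanish. -/
theorem Matrix.IsIrreducible.offDiag_pos {M : Matrix (Fin 2) (Fin 2) ℝ} (hM : M.IsIrreducible)
    {i j : Fin 2} (hij : i ≠ j) : 0 < M i j := by
  refine (hM.nonneg i j).lt_of_ne fun h0 => ?_
  obtain ⟨k, -, hk⟩ := (Matrix.isIrreducible_iff_exists_pow_pos hM.nonneg).1 hM i j
  refine hk.ne' ?_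
  clear hk
  induction k with
  | zero => rw [pow_zero, Matrix.one_apply_ne hij]
  | succ k ih =>
    rw [pow_succ', Matrix.mul_apply]
    refine Finset.sum_eq_zero fun l _ => ?_
    rcases eq_or_ne l i with rfl | hl
    · rw [ih, mul_zero]
    · have : l = j := by omega
      rw [this, ← h0, zero_mul]

theorem stationary_balance {M : Matrix (Fin 2) (Fin 2) ℝ} (hM : M ∈ Matrix.rowStochastic ℝ (Fin 2))
    {π : Fin 2 → ℝ} (hπ : IsStationaryDistribution M π) :
    π 0 + π 1 = 1 ∧ π 0 * M 0 1 = π 1 * M 1 0 := by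
  have h1 := hπ.1.2
  have h2 := congrFun hπ.2 0
  have h3 := Matrix.sum_row_of_mem_rowStochastic hM 0
  simp only [Fin.sum_univ_two] at h1 h3
  simp only [Matrix.vecMul, dotProduct, Fin.sum_univ_two] at h2
  refine ⟨h1, ?_⟩
  linear_combination π 0 * h3 - h2

/-- Row sums reduce the eigenvector equations to `M 0 1 * (ξ 1 - ξ 0) = (lam - 1) * ξ 0` and its
mirror image. Their difference gives `lam = 1 - M 0 1 - M 1 0`, and all the claims follow from
positivity of the off-diagonal entries. -/
theorem nonprincipal_eigenvector_facts {M : Matrix (Fin 2) (Fin 2) ℝ}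
    (hM : M ∈ Matrix.rowStochastic ℝ (Fin 2)) (hirr : M.IsIrreducible) {lam : ℝ} {ξ : Fin 2 → ℝ}
    (hlam : lam ≠ 1) (hξ : ξ ≠ 0) (hMξ : M.mulVec ξ = lam • ξ) :
    lam < 1 ∧ ξ 0 ≠ 0 ∧ ξ 1 ≠ 0 ∧ ξ 0 ≠ ξ 1 ∧
      ∀ π, IsStationaryDistribution M π → π 0 * ξ 0 + π 1 * ξ 1 = 0 := by
  have ha : 0 < M 0 1 := hirr.offDiag_pos (by decide)
  have hb : 0 < M 1 0 := hirr.offDiag_pos (by decide)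
  have r0 := Matrix.sum_row_of_mem_rowStochastic hM 0
  have r1 := Matrix.sum_row_of_mem_rowStochastic hM 1
  have e0 := congrFun hMξ 0
  have e1 := congrFun hMξ 1
  simp only [Matrix.mulVec, dotProduct, Fin.sum_univ_two, Pi.smul_apply, smul_eq_mul] at r0 r1 e0 e1
  have f0 : M 0 1 * (ξ 1 - ξ 0) = (lam - 1) * ξ 0 := by linear_combination e0 - ξ 0 * r0
  have f1 : M 1 0 * (ξ 0 - ξ 1) = (lam - 1) * ξ 1 := by linear_combination e1 - ξ 1 * r1
  have hl : lam - 1 ≠ 0 := sub_ne_zero.2 hlam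
  have hd : ξ 0 ≠ ξ 1 := by
    intro h
    rw [h, sub_self, mul_zero] at f1
    have h1 : ξ 1 = 0 := by
      rcases mul_eq_zero.1 f1.symm with h | h
      · exact absurd h hl
      · exact h
    refine hξ (funext fun i => ?_)
    fin_cases i
    · exact h.trans h1
    · exact h1
  have hd' : ξ 0 - ξ 1 ≠ 0 := sub_ne_zero.2 hd
  have hlam' : lam = 1 - M 0 1 - M 1 0 := by
    refine mul_right_cancel₀ hd' ?_
    linear_combination f1 - f0
  have h0 : ξ 0 ≠ 0 := by
    intro h
    rw [h, mul_zero, sub_zero] at f0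
    rcases mul_eq_zero.1 f0 with h2 | h2
    · exact ha.ne' h2
    · exact hd (h.trans h2.symm)
  have h1 : ξ 1 ≠ 0 := by
    intro h
    rw [h, mul_zero, sub_zero] at f1
    rcases mul_eq_zero.1 f1 with h2 | h2
    · exact hb.ne' h2
    · exact h0 h2
  refine ⟨by linarith, h0, h1, hd, fun π hπ => ?_⟩
  obtain ⟨-, hbal⟩ := stationary_balance hM hπ
  have : (lam - 1) * (π 0 * ξ 0 + π 1 * ξ 1) = 0 := by
    linear_combination (ξ 1 - ξ 0) * hbal - π 0 * f0 - π 1 * f1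
  exact (mul_eq_zero.1 this).resolve_left hl

/-- The vectors `1` and `ξ` span the plane, so limits tested against them determine the limit; `u •
π` is the vector with pairings `u` and `0`. -/
theorem tendsto_smul_of_tendsto_dotProduct {f : ℕ → Fin 2 → ℝ} {u : ℝ} {π ξ : Fin 2 → ℝ}
    (hπ : π 0 + π 1 = 1) (hπξ : π 0 * ξ 0 + π 1 * ξ 1 = 0) (hξ : ξ 0 ≠ ξ 1)
    (h1 : Tendsto (fun n => f n ⬝ᵥ 1) atTop (𝓝 u))
    (h2 : Tendsto (fun n => f n ⬝ᵥ ξ) atTop (𝓝 0)) : Tendsto f atTop (𝓝 (u • π)) := by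
  have hd : ξ 0 - ξ 1 ≠ 0 := sub_ne_zero.2 hξ
  rw [tendsto_pi_nhds, Fin.forall_fin_two]
  simp only [dotProduct, Fin.sum_univ_two, Pi.one_apply, mul_one] at h1 h2
  have h3 := h2.div_const (ξ 0 - ξ 1)
  rw [zero_div] at h3
  constructor
  · have := (h1.mul_const (π 0)).add h3
    rw [add_zero] at this
    refine this.congr fun n => ?_
    have hp1 : π 1 = 1 - π 0 := by linarith
    rw [hp1] at hπξ
    field_simp
    linear_combination (f n 0 + f n 1) * hπξ
  · have := (h1.mul_const (π 1)).sub h3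
    rw [sub_zero] at this
    refine this.congr fun n => ?_
    have hp1 : π 0 = 1 - π 1 := by linarith
    rw [hp1] at hπξ
    field_simp
    linear_combination (-(f n 0 + f n 1)) * hπξ

/-! ### The three-colour urn -/

theorem threeColorMatrix_mem_rowStochastic {s : ℝ} (hs0 : 0 < s) (hs1 : s < 1)
    {Q : Matrix (Fin 2) (Fin 2) ℝ} (hQ : Q ∈ Matrix.rowStochastic ℝ (Fin 2)) :
    threeColorMatrix s Q ∈ Matrix.rowStochastic ℝ (Fin 2 ⊕ Fin 1) := by
  have hQs := Matrix.sum_row_of_mem_rowStochastic hQ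
  rw [Matrix.mem_rowStochastic_iff_sum]
  constructor
  · rintro (i | i) (j | j)
    · exact mul_nonneg hs0.le (Matrix.nonneg_of_mem_rowStochastic hQ)
    · simp [threeColorMatrix]; linarith
    · simp [threeColorMatrix]
    · simp only [threeColorMatrix, Matrix.fromBlocks_apply₂₂, Matrix.one_apply]
      split_ifs <;> norm_num
  · rintro (i | i)
    · simp [threeColorMatrix, Fintype.sum_sum_type, -Fin.sum_univ_two, ← Finset.mul_sum, hQs]
    · simp [threeColorMatrix, Fintype.sum_sum_type, Matrix.one_apply, Subsingleton.elim i 0]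

theorem mergeDominant_mem_stdSimplex {c : Fin 2 ⊕ Fin 2 → ℝ}
    (hc : c ∈ stdSimplex ℝ (Fin 2 ⊕ Fin 2)) :
    mergeDominant c ∈ stdSimplex ℝ (Fin 2 ⊕ Fin 1) := by
  refine ⟨?_, ?_⟩
  · rintro (i | i)
    · exact hc.1 _
    · exact add_nonneg (hc.1 _) (hc.1 _)
  · have := hc.2
    simp only [Fintype.sum_sum_type, Fin.sum_univ_two] at this
    simp [mergeDominant, Fintype.sum_sum_type]
    linarith

theorem dotProduct_sumElim_one_zero {κ : Type*} [Fintype κ] (x : Fin 2 ⊕ κ → ℝ) :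
    x ⬝ᵥ Sum.elim 1 0 = x (Sum.inl 0) + x (Sum.inl 1) := by
  simp [dotProduct, Fintype.sum_sum_type]

theorem mulVec_one_of_mem_rowStochastic {M : Matrix (Fin 2) (Fin 2) ℝ}
    (hM : M ∈ Matrix.rowStochastic ℝ (Fin 2)) : M.mulVec 1 = (1 : ℝ) • (1 : Fin 2 → ℝ) := by
  ext i
  have := Matrix.sum_row_of_mem_rowStochastic hM i
  simpa [Matrix.mulVec, dotProduct] using this

/-- The stationary mean of the square of a non-principal eigenvector. -/
theorem stationary_dotProduct_sq {π ξ : Fin 2 → ℝ} (hπ : π 0 + π 1 = 1)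
    (hπξ : π 0 * ξ 0 + π 1 * ξ 1 = 0) : π ⬝ᵥ ξ ^ 2 = -(ξ 0 * ξ 1) := by
  simp only [dotProduct, Fin.sum_univ_two, Pi.pow_apply]
  linear_combination (ξ 0 + ξ 1) * hπξ - ξ 0 * ξ 1 * hπ

theorem exists_nonprincipal_eigenvector {M : Matrix (Fin 2) (Fin 2) ℝ}
    (hM : M ∈ Matrix.rowStochastic ℝ (Fin 2)) (hirr : M.IsIrreducible) :
    ∃ (ρ : ℝ) (η : Fin 2 → ℝ), ρ < 1 ∧ η 0 ≠ η 1 ∧ M.mulVec η = ρ • η ∧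
      ∀ π, IsStationaryDistribution M π → π 0 * η 0 + π 1 * η 1 = 0 := by
  have ha : 0 < M 0 1 := hirr.offDiag_pos (by decide)
  have hb : 0 < M 1 0 := hirr.offDiag_pos (by decide)
  have r0 := Matrix.sum_row_of_mem_rowStochastic hM 0
  have r1 := Matrix.sum_row_of_mem_rowStochastic hM 1
  simp only [Fin.sum_univ_two] at r0 r1
  -- The eigenvalue is the trace minus one, and the eigenvector is orthogonal to `π` by the balance
  -- equation.
  refine ⟨1 - M 0 1 - M 1 0, ![M 0 1, -M 1 0], by linarith, ?_, ?_, fun π hπ => ?_⟩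
  · simp only [Matrix.cons_val_zero, Matrix.cons_val_one]
    linarith
  · ext i
    fin_cases i
    · simp [Matrix.mulVec, dotProduct, Fin.sum_univ_two]
      linear_combination M 0 1 * r0
    · simp [Matrix.mulVec, dotProduct, Fin.sum_univ_two]
      linear_combination -M 1 0 * r1
  · simp only [Matrix.cons_val_zero, Matrix.cons_val_one]
    linear_combination (stationary_balance hM hπ).2

/-! ### The limit of the whole composition on the linear scale -/

namespace IsUrn

variable {Ω : Type*} [MeasurableSpace Ω] {μ : Measure Ω} {s : ℝ} {Q E P : Matrix (Fin 2) (Fin 2) ℝ}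

theorem ae_tendsto_inv_smul {c₀ : Fin 2 ⊕ Fin 2 → ℝ} {C : ℕ → Ω → Fin 2 ⊕ Fin 2 → ℝ}
    {draw : ℕ → Ω → Fin 2 ⊕ Fin 2} [IsProbabilityMeasure μ]
    (h : IsUrn μ (Matrix.fromBlocks (s • Q) E 0 P) c₀ C draw)
    (hP : P ∈ Matrix.rowStochastic ℝ (Fin 2)) (hPirr : P.IsIrreducible)
    (hR : Matrix.fromBlocks (s • Q) E 0 P ∈ Matrix.rowStochastic ℝ (Fin 2 ⊕ Fin 2))
    (hc₀ : c₀ ∈ stdSimplex ℝ (Fin 2 ⊕ Fin 2)) {π : Fin 2 → ℝ}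
    (hπ : IsStationaryDistribution P π)
    (hS : ∀ᵐ ω ∂μ, Tendsto (fun n : ℕ => C n ω ⬝ᵥ Sum.elim 1 0 / (n : ℝ)) atTop (𝓝 0)) :
    ∀ᵐ ω ∂μ, Tendsto (fun n : ℕ => (n : ℝ)⁻¹ • C n ω) atTop (𝓝 (Sum.elim 0 π)) := by
  obtain ⟨ρ, η, hρ, hη, hPη, hπη⟩ := exists_nonprincipal_eigenvector hP hPirr
  filter_upwards [hS, h.ae_tendsto_dominant_eigenvector_div hR hc₀ hS hPη hρ] with ω hω hω'
  have hnn := h.nonneg hR hc₀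
  have htot : Tendsto (fun n : ℕ => ((n : ℝ) + 1) / n) atTop (𝓝 1) := by
    have := tendsto_const_nhds (x := (1 : ℝ)).add tendsto_inv_atTop_nhds_zero_nat
    rw [add_zero] at this
    refine this.congr' ?_
    filter_upwards [eventually_gt_atTop 0] with n hn
    have hn' : (0 : ℝ) < n := by exact_mod_cast hn
    field_simp
  -- The dominant pair has mass `n + 1` minus the dominated mass, hence limit `1` after division by
  -- `n`; its component along `η` vanishes.
  have hdom := tendsto_smul_of_tendsto_dotProduct
    (f := fun n : ℕ => (n : ℝ)⁻¹ • fun i : Fin 2 => C n ω (Sum.inr i)) (u := 1)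
    (stationary_balance hP hπ).1 (hπη π hπ) hη ?_ ?_
  · rw [one_smul, tendsto_pi_nhds] at hdom
    rw [tendsto_pi_nhds]
    rintro (i | i)
    · refine squeeze_zero (fun n => ?_) (fun n => ?_) hω
      · exact mul_nonneg (inv_nonneg.2 n.cast_nonneg) (hnn n ω _)
      · simp only [Pi.smul_apply, smul_eq_mul, dotProduct_sumElim_one_zero, div_eq_inv_mul]
        refine mul_le_mul_of_nonneg_left ?_ (inv_nonneg.2 n.cast_nonneg)
        have := hnn n ω (Sum.inl 0)
        have := hnn n ω (Sum.inl 1)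
        fin_cases i <;> simp <;> linarith
    · exact hdom i
  · have := htot.sub hω
    rw [sub_zero] at this
    refine this.congr fun n => ?_
    have hsum := h.sum_eq hR hc₀ n ω
    simp only [Fintype.sum_sum_type, Fin.sum_univ_two] at hsum
    rw [dotProduct_sumElim_one_zero, ← hsum]
    simp only [dotProduct, Fin.sum_univ_two, Pi.smul_apply, smul_eq_mul, Pi.one_apply, mul_one]
    ring
  · refine hω'.congr fun n => ?_
    simp only [dotProduct, Fintype.sum_sum_type, Fin.sum_univ_two, Pi.smul_apply, smul_eq_mul,
      Sum.elim_inl, Sum.elim_inr, Pi.zero_apply]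
    ring

end IsUrn

/-! ### The main theorem -/

theorem proposition4p2 {Ω : Type uOne} [MeasurableSpace Ω]
    (μ : Measure Ω) [IsProbabilityMeasure μ]
    (s : ℝ) (hs0 : 0 < s) (hs1 : s < 1)
    (Q E P : Matrix (Fin 2) (Fin 2) ℝ)
    (hQ : Q ∈ Matrix.rowStochastic ℝ (Fin 2)) (hQirr : Q.IsIrreducible)
    (hP : P ∈ Matrix.rowStochastic ℝ (Fin 2)) (hPirr : P.IsIrreducible)
    (hR : fourColorMatrix s Q E P ∈ Matrix.rowStochastic ℝ (Fin 2 ⊕ Fin 2))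
    (πQ πP : Fin 2 → ℝ)
    (hπQ : IsStationaryDistribution Q πQ) (hπP : IsStationaryDistribution P πP)
    -- the non-principal eigenvalue of `Q` and a corresponding eigenvector
    (lam : ℝ) (ξ : Fin 2 → ℝ) (hlam : lam ≠ 1) (hξ : ξ ≠ 0) (hQξ : Q.mulVec ξ = lam • ξ)
    (c₀ : Fin 2 ⊕ Fin 2 → ℝ) (hc₀ : c₀ ∈ stdSimplex ℝ (Fin 2 ⊕ Fin 2))
    (hc₀pos : 0 < c₀ (Sum.inl 0) + c₀ (Sum.inl 1))
    (C : ℕ → Ω → Fin 2 ⊕ Fin 2 → ℝ) (draw : ℕ → Ω → Fin 2 ⊕ Fin 2)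
    (hC : IsUrn μ (fourColorMatrix s Q E P) c₀ C draw) :
    (∀ n ω, (C n ω ⬝ᵥ 1) / ((n : ℝ) + 1) = 1) ∧
    (∀ᵐ ω ∂μ, Tendsto (fun n : ℕ => (n : ℝ)⁻¹ • C n ω) atTop (𝓝 (Sum.elim 0 πP))) ∧
    (∃ U : Ω → ℝ,
      (∀ᵐ ω ∂μ, 0 < U ω) ∧ IsNondegenerate μ U ∧
      (∀ᵐ ω ∂μ, Tendsto (fun n : ℕ => ((n : ℝ) ^ s)⁻¹ • fun i : Fin 2 => C n ω (Sum.inl i))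
        atTop (𝓝 (U ω • πQ))) ∧
      TendstoAEAndL2 μ (fun n ω => (C n ω ⬝ᵥ Sum.elim 1 0) / (n : ℝ) ^ s) U ∧
      (lam < 1 / 2 →
        TendstoNormalMixture μ (fun n ω => C n ω ⬝ᵥ Sum.elim ξ 0 / (n : ℝ) ^ (s / 2))
          (fun ω => s ^ 2 * lam ^ 2 / (s * (1 - 2 * lam)) * U ω * (πQ ⬝ᵥ ξ ^ 2))) ∧
      (lam = 1 / 2 →
        TendstoNormalMixture μ
          (fun n ω => C n ω ⬝ᵥ Sum.elim ξ 0 / √((n : ℝ) ^ s * Real.log n))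
          (fun ω => s ^ 2 * lam ^ 2 * U ω * (πQ ⬝ᵥ ξ ^ 2))) ∧
      -- `U` has the law of the corresponding limit in the three-colour urn
      (∀ (Ω' : Type uTwo) [MeasurableSpace Ω'] (μ' : Measure Ω') [IsProbabilityMeasure μ']
        (C' : ℕ → Ω' → Fin 2 ⊕ Fin 1 → ℝ) (draw' : ℕ → Ω' → Fin 2 ⊕ Fin 1),
        IsUrn μ' (threeColorMatrix s Q) (mergeDominant c₀) C' draw' →
        ∃ U' : Ω' → ℝ,
          TendstoAEAndL2 μ'
            (fun n ω => (C' n ω ⬝ᵥ Sum.elim 1 0) / ((n : ℝ) + 1) ^ s) U' ∧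
          IdentDistrib U U' μ μ')) ∧
    (1 / 2 < lam →
      ∃ V : Ω → ℝ,
        IsNondegenerate μ V ∧
        TendstoAEAndL2 μ (fun n ω => C n ω ⬝ᵥ Sum.elim ξ 0 / (n : ℝ) ^ (s * lam)) V ∧
        -- `V` has the law of the corresponding limit in the three-colour urn
        (∀ (Ω' : Type uTwo) [MeasurableSpace Ω'] (μ' : Measure Ω') [IsProbabilityMeasure μ']
          (C' : ℕ → Ω' → Fin 2 ⊕ Fin 1 → ℝ) (draw' : ℕ → Ω' → Fin 2 ⊕ Fin 1),
          IsUrn μ' (threeColorMatrix s Q) (mergeDominant c₀) C' draw' →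
          ∃ V' : Ω' → ℝ,
            TendstoAEAndL2 μ'
              (fun n ω => C' n ω ⬝ᵥ Sum.elim ξ 0 / (n : ℝ) ^ (s * lam)) V' ∧
            IdentDistrib V V' μ μ')) := by
  obtain ⟨hlam1, hξ0, hξ1, hξ01, hπξ⟩ := nonprincipal_eigenvector_facts hQ hQirr hlam hξ hQξ
  have hπ := (stationary_balance hQ hπQ).1
  have hm := stationary_dotProduct_sq hπ (hπξ πQ hπQ)
  have hm0 : 0 ≤ -(ξ 0 * ξ 1) := by
    rw [← hm]
    exact Finset.sum_nonneg fun i _ => mul_nonneg (hπQ.1.1 i) (sq_nonneg (ξ i))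
  have hpos : 0 < c₀ ⬝ᵥ Sum.elim 1 0 := by rwa [dotProduct_sumElim_one_zero]
  have hpos' : 0 < mergeDominant c₀ ⬝ᵥ Sum.elim 1 0 := by rwa [dotProduct_sumElim_one_zero]
  have hR' := threeColorMatrix_mem_rowStochastic hs0 hs1 hQ
  have hc₀' := mergeDominant_mem_stdSimplex hc₀
  have hQ1 := mulVec_one_of_mem_rowStochastic hQ
  rw [fourColorMatrix] at hC hR
  rw [threeColorMatrix] at hR'
  -- `U` is the case of the principal eigenvector `1` with eigenvalue `1`, which always exceeds `1 /
  -- 2`.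
  obtain ⟨U, hUm, hU, -, hUnd⟩ := hC.exists_tendsto_div_rpow hs0 hs1 hQ hR hc₀ hpos hQ1
    (by norm_num)
  rw [mul_one] at hU
  have hUpos := hC.ae_pos_of_tendsto hs0 hQ hR hc₀ hpos hU.2.2.1
  refine ⟨fun n ω => ?_, hC.ae_tendsto_inv_smul hP hPirr hR hc₀ hπP
    (IsUrn.ae_tendsto_dominated_div hs1 hU.2.2.1),
    ⟨U, hUpos, hUnd one_ne_zero one_ne_zero, ?_, hU, fun hl => ?_, fun hl => ?_, ?_⟩, fun hl => ?_⟩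
  · rw [dotProduct_one, hC.sum_eq hR hc₀ n ω]
    exact div_self (by positivity)
  · filter_upwards [hU.2.2.1, hC.ae_tendsto_eigenvector_div_rpow hs0 hQ hR hc₀ hQξ hlam1]
      with ω h1 h2
    refine tendsto_smul_of_tendsto_dotProduct hπ (hπξ πQ hπQ) hξ01 (h1.congr fun n => ?_)
      (h2.congr fun n => ?_)
    · rw [dotProduct_sumElim_zero, smul_dotProduct, smul_eq_mul, div_eq_inv_mul]
    · rw [dotProduct_sumElim_zero, smul_dotProduct, smul_eq_mul, div_eq_inv_mul]
  · refine hC.tendstoNormalMixture_of_tendsto hs0 hQ hR hc₀ hpos hQξ hl.le hm0 (by fun_prop) ?_ ?_ ?_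
    · filter_upwards [hUpos, hU.2.2.1] with ω h0 h1
      exact hC.tendsto_dominatedCount_atTop hs0 hQ h0 h1
    · filter_upwards [hUpos, hU.2.2.1] with ω h0 h1
      have := (hC.tendsto_varianceSeq_dominatedCount_div hs0 hQ hpos hl h0 h1).const_mul
        ((s * lam) ^ 2 * (-(ξ 0 * ξ 1)))
      -- The stationary mean of `ξ ^ 2` is `-(ξ 0 * ξ 1)`, the constant of the one-step expansion.
      rw [hm]
      convert this using 2
      ring
    · filter_upwards [hUpos, hU.2.2.1] with ω h0 h1
      exact ⟨_, hC.tendsto_varianceSeq_dominatedCount_div hs0 hQ hpos hl h0 h1⟩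
  · subst hl
    refine hC.tendstoNormalMixture_of_tendsto hs0 hQ hR hc₀ hpos hQξ le_rfl hm0
      (by fun_prop) ?_ ?_ ?_
    · filter_upwards [hUpos, hU.2.2.1] with ω h0 h1
      exact hC.tendsto_dominatedCount_atTop hs0 hQ h0 h1
    · filter_upwards [hUpos, hU.2.2.1] with ω h0 h1
      have := (hC.tendsto_varianceSeq_half_dominatedCount_div hs0 hQ hpos h0 h1).const_mul
        ((s * (1 / 2)) ^ 2 * (-(ξ 0 * ξ 1)))
      rw [hm]
      convert this using 2
      ring
    · filter_upwards [hUpos, hU.2.2.1] with ω h0 h1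
      exact ⟨_, hC.tendsto_varianceSeq_half_dominatedCount_div hs0 hQ hpos h0 h1⟩
  · intro Ω' _ μ' _ C' draw' hC'
    rw [threeColorMatrix] at hC'
    obtain ⟨U', hUm', hU', hU1', -⟩ :=
      hC'.exists_tendsto_div_rpow hs0 hs1 hQ hR' hc₀' hpos' hQ1 (by norm_num)
    rw [mul_one] at hU' hU1'
    exact ⟨U', hU1', identDistrib_of_tendsto_dominated hC hC' hs0.ne' hQ hR hR' hc₀ hc₀'
      (fun _ => rfl) hUm hUm' hU.2.2.1 hU'.2.2.1⟩
  · obtain ⟨V, hVm, hV, -, hVnd⟩ := hC.exists_tendsto_div_rpow hs0 hs1 hQ hR hc₀ hpos hQξ hl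
    refine ⟨V, hVnd hξ0 hξ1, hV, ?_⟩
    intro Ω' _ μ' _ C' draw' hC'
    rw [threeColorMatrix] at hC'
    obtain ⟨V', hVm', hV', -, -⟩ :=
      hC'.exists_tendsto_div_rpow hs0 hs1 hQ hR' hc₀' hpos' hQξ hl
    exact ⟨V', hV', identDistrib_of_tendsto_dominated hC hC' hs0.ne' hQ hR hR' hc₀ hc₀'
      (fun _ => rfl) hVm hVm' hV.2.2.1 hV'.2.2.1⟩
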